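/- Let $f$ be a real function that is $C^\infty$ near the origin of the plane, with $f=f_x=f_y=0$ at $(0,0)$ (a surface $z=f(x,y)$ in Monge form), and write $f(x,y)\sim\sum_{i+j\ge 2}c_{ij}x^iy^j$ for its Taylor expansion at the origin. The isophotes are the level curves $f=k$. A circle is tangent, respectively osculating, to an isophote at a regular point $p$ of $f$ on it if the first derivative, respectively the first two derivatives, of $f$ along the circle vanish at $p$; a tangency is ordinary if it is not osculating. The triple crossings ($A_1^3$) of the symmetry set of $f=k$ are the centres of circles tangent to $f=k$ at three distinct points; its cusps ($A_1A_2$) are the centres of circles tangent to $f=k$ at two distinct points and osculating at one of them. (1) Generically there are neither triple crossings nor cusps on the local branches of the symmetry set of the isophotes near a hyperbolic point. Precisely: there is a nonzero real polynomial $P$ in the twelve variables $c_{ij}$, $2\le i+j\le 4$, such that for every $f$ as above with $4c_{20}c_{02}<c_{11}^2$ and $P\big((c_{ij})\big)\neq 0$ there is a neighbourhood $U$ of the origin such that, for every $k\in\mathbb R$, no circle is tangent to $f=k$ at three distinct points of $U$, and no circle is tangent to $f=k$ at two distinct points of $U$ and osculating at one of them. (2) Let the origin be an umbilic, $c_{20}=c_{02}\ne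 0$ and $c_{11}=0$, with coordinates rotated so that the cubic part $b_0x^3+b_1x^2y+b_2xy^2+b_3y^3$ of $f$ has $b_0=b_2$, and suppose that $b_1\neq b_3$. If the three distinct points of contact of circles tritangent to isophotes of $f$ tend to the origin with limiting directions at angles $t_1,t_2,t_3$ to the positive $x$-axis that are pairwise distinct (modulo $360^\circ$), then $t_1,t_2,t_3$ are, in some order, $90^\circ,-30^\circ,-150^\circ$, or, in some order, the opposites $-90^\circ,150^\circ,30^\circ$. Both triples occur: for each there are three continuous curves $p_1(s),p_2(s),p_3(s)$, $0<s<\varepsilon$, tending to the origin as $s\to 0$ with these limiting directions, such that for every $s$ some circle has ordinary tangency with one isophote of $f$ at the three distinct points $p_1(s),p_2(s),p_3(s)$. -/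

import Mathlib

open Filter Topology
open scoped ContDiff

noncomputable section

namespace Isophote

/-- The Taylor coefficient of `x ^ i * y ^ j` of `f` at the origin. -/
def coeff (f : ℝ × ℝ → ℝ) (i j : ℕ) : ℝ :=
  iteratedDeriv i (fun x => iteratedDeriv j (fun y => f (x, y)) 0) 0 /
    ((i.factorial : ℝ) * (j.factorial : ℝ))

/-- The surface `z = f (x, y)` is smooth near the origin and in Monge form there:
`f`, `f_x` and `f_y` vanish at `(0, 0)`. -/
def IsMonge (f : ℝ × ℝ → ℝ) : Prop :=
  ContDiffAt ℝ ∞ f 0 ∧ coeff f 0 0 = 0 ∧ coeff f 1 0 = 0 ∧ coeff f 0 1 = 0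

/-- The origin is a hyperbolic point: the Hessian determinant is negative. -/
def IsHyperbolic (f : ℝ × ℝ → ℝ) : Prop :=
  4 * coeff f 2 0 * coeff f 0 2 - coeff f 1 1 ^ 2 < 0

/-- The origin is a (non-flat) umbilic: the quadratic part of `f` is `c * (x ^ 2 + y ^ 2)` with
`c ≠ 0`. -/
def IsUmbilic (f : ℝ × ℝ → ℝ) : Prop :=
  coeff f 2 0 = coeff f 0 2 ∧ coeff f 1 1 = 0 ∧ coeff f 2 0 ≠ 0

/-- Indices of the coefficients of the `4`-jets in Monge form: the monomials `x ^ i * y ^ j` with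
`2 ≤ i + j ≤ 4`. -/
abbrev JetIndex : Type := {m : ℕ × ℕ // 2 ≤ m.1 + m.2 ∧ m.1 + m.2 ≤ 4}

/-- The `4`-jet of `f` at the origin (for `f` in Monge form). -/
def jet (f : ℝ × ℝ → ℝ) : JetIndex → ℝ := fun m => coeff f m.1.1 m.1.2

/-- The point at angle `θ` of the circle with centre `z` and radius `R`. -/
def circlePoint (z : ℝ × ℝ) (R θ : ℝ) : ℝ × ℝ :=
  (z.1 + R * Real.cos θ, z.2 + R * Real.sin θ)

/-- `p` is a regular point of `f`, and the circle with centre `z` and radius `R > 0` passes through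
`p` and has there contact of type at least `A_m` with the isophote of `f` through `p`: the
derivatives of orders `1, …, m` of `f` along the circle vanish at `p`. So `m = 1` means that the
circle is tangent to the isophote at `p`, and `m = 2` that it is the osculating circle (circle of
curvature) of the isophote at `p`. -/
def HasContact (m : ℕ) (f : ℝ × ℝ → ℝ) (z : ℝ × ℝ) (R : ℝ) (p : ℝ × ℝ) : Prop :=
  0 < R ∧ fderiv ℝ f p ≠ 0 ∧ ∃ θ : ℝ, circlePoint z R θ = p ∧
    ∀ j : ℕ, 1 ≤ j → j ≤ m → iteratedDeriv j (fun φ => f (circlePoint z R φ)) θ = 0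

/-- Ordinary tangency (`A_1` contact). -/
def HasOrdinaryTangency (f : ℝ × ℝ → ℝ) (z : ℝ × ℝ) (R : ℝ) (p : ℝ × ℝ) : Prop :=
  HasContact 1 f z R p ∧ ¬ HasContact 2 f z R p

/-- The circle with centre `z` and radius `R` is tangent to the isophote `f = k` at the three
distinct points `p 0`, `p 1`, `p 2`. -/
def IsTritangent (f : ℝ × ℝ → ℝ) (k : ℝ) (z : ℝ × ℝ) (R : ℝ) (p : Fin 3 → ℝ × ℝ) : Prop :=
  Function.Injective p ∧ ∀ i, f (p i) = k ∧ HasContact 1 f z R (p i)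

/-- The triple crossings of the local symmetry set: centres of circles tangent to `f = k` at three
distinct points of `U`. The tangencies need not be ordinary, so this contains all `A_1^3` points. -/
def tripleCrossings (f : ℝ × ℝ → ℝ) (k : ℝ) (U : Set (ℝ × ℝ)) : Set (ℝ × ℝ) :=
  {z | ∃ (R : ℝ) (p : Fin 3 → ℝ × ℝ), (∀ i, p i ∈ U) ∧ IsTritangent f k z R p}

/-- The cusps of the local symmetry set: centres of circles tangent to `f = k` at two distinct
points of `U` and osculating at one of them. Higher contact is allowed, so this contains all
`A_1 A_2` points. -/
def cusps (f : ℝ × ℝ → ℝ) (k : ℝ) (U : Set (ℝ × ℝ)) : Set (ℝ × ℝ) :=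
  {z | ∃ (R : ℝ) (p q : ℝ × ℝ), p ∈ U ∧ q ∈ U ∧ p ≠ q ∧ f p = k ∧ f q = k ∧
    HasContact 1 f z R p ∧ HasContact 2 f z R q}

/-- The points `p s` tend to the origin in the limiting direction with angle `t` to the positive
`x`-axis. -/
def TendsToOriginAlong {ι : Type} (l : Filter ι) (p : ι → ℝ × ℝ) (t : Real.Angle) : Prop :=
  Tendsto p l (𝓝 0) ∧
    Tendsto (fun s => (p s).1 / Real.sqrt ((p s).1 ^ 2 + (p s).2 ^ 2)) l (𝓝 t.cos) ∧
    Tendsto (fun s => (p s).2 / Real.sqrt ((p s).1 ^ 2 + (p s).2 ^ 2)) l (𝓝 t.sin)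

/-- The angles `90°`, `-30°`, `-150°`. -/
def baseAngles : Fin 3 → Real.Angle :=
  ![((Real.pi / 2 : ℝ) : Real.Angle), ((-(Real.pi / 6) : ℝ) : Real.Angle),
    ((-(5 * Real.pi / 6) : ℝ) : Real.Angle)]

/-- `t` is, in some order, `90°`, `-30°`, `-150°`, or in some order the triple of the opposite
directions `-90°`, `150°`, `30°`. -/
def IsSpecialTriple (t : Fin 3 → Real.Angle) : Prop :=
  ∃ σ : Equiv.Perm (Fin 3), (∀ i, t (σ i) = baseAngles i) ∨
    (∀ i, t (σ i) = baseAngles i + ((Real.pi : ℝ) : Real.Angle))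

end Isophote

end

/-!
The obstruction behind both parts is that a circle tangent to `f = k` at two points `a ≠ b` and
meeting `f = k` once more, or osculating it at `b`, gives the restriction of `f - k` to the circle
five zeros, counted with multiplicity. Newton's divided differences depend continuously on
parameters and nodes, also where nodes coalesce, so five zeros survive in a limit as a factor
`(θ - a₀) ^ 2 * (θ - b₀) ^ 2 * (θ - c₀)` (`exists_factor_of_tendsto`). It remains to see what the
limiting functions can be when the points of contact tend to the origin. Limits are taken along
ultrafilters, which replaces the passage to subsequences.

*Hyperbolic points.* If the radii tend to `0`, then so do the centres, and suitable multiples of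
`f - k` on the circles converge to a nonzero combination of `1`, `cos θ`, `sin θ` and the quadratic
part of `f` at `(cos θ, sin θ)`. This is a trigonometric polynomial of degree two with five zeros,
so it vanishes identically (`trig_eq_zero_of_factor`). Hence the quadratic part is constant on the
unit circle, that is, the origin is an umbilic or a flat point, and not hyperbolic
(`coeff_of_small_circles`). If the radii stay away from `0`, the circles, parametrized by arc length
from a point of contact, converge to a circle or line through the origin along which `f` vanishes to
fifth order (`hasFlatBranch_of_large_circles`). Its direction is a zero `(a, b)` of the quadratic
part; the third and fourth order terms are two equations for its curvature. Elimination of the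
curvature gives a form `flatForm` of degree eight in `(a, b)`. Since `a / b` is quadratic over the
field of the coefficients, a norm turns this into a polynomial condition on the `4`-jet
(`exists_norm`, `exists_polynomial_flatBranch`), and the jet of `x ^ 2 - y ^ 2 + x ^ 4` does not
satisfy it.

*Umbilics.* Let the points of contact have distinct limiting directions. They lie at nearly the same
distance from the origin, so the centre has the form `R ^ 2 • w` with `w` bounded
(`exists_rescaled_limit`). On such circles `(f - c * R ^ 2) / R ^ 3`, where `c` is the coefficient
of `x ^ 2`, tends to `α cos θ + β sin θ + δ sin³ θ` with `δ = b₃ - b₁` (`exists_umbilic_expansion`).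
This takes one and the same value to second order in three distinct directions. In terms of
`exp (i θ)` it is a polynomial of degree six with three double roots and without terms of degree
five and one, so it is `(X ^ 3 - e) ^ 2` (`cube_eq_of_double_roots`), where `e = ± i`: the
directions are those with `sin 3 θ = 1` or those with `sin 3 θ = -1`. Conversely, for the `w` that
makes the limit `-(δ / 4) sin 3 θ`, the equations of tritangency have a nondegenerate solution at
`R = 0`, and the implicit function theorem continues it to `R > 0` (`exists_tritangent_curves`).
-/

noncomputable section

namespace Isophote

/-! ### Integrals depending on a parameter -/

section ParametricIntegral

variable {E G : Type} [NormedAddCommGroup E] [NormedSpace ℝ E] [ProperSpace E]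
  [NormedAddCommGroup G] [NormedSpace ℝ G]

theorem hasFDerivAt_integral_unit {F : E × ℝ → G} (hF : ContDiff ℝ 1 F) (x : E) :
    HasFDerivAt (fun x => ∫ t in (0 : ℝ)..1, F (x, t))
      (∫ t in (0 : ℝ)..1, (fderiv ℝ F (x, t)).comp (ContinuousLinearMap.inl ℝ E ℝ)) x := by
  have hF' : Continuous (fun q : E × ℝ => (fderiv ℝ F q).comp (ContinuousLinearMap.inl ℝ E ℝ)) :=
    (hF.continuous_fderiv one_ne_zero).clm_comp continuous_const
  obtain ⟨M, hM⟩ := ((isCompact_closedBall x 1).prod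
    (isCompact_Icc (a := (0 : ℝ)) (b := 1))).exists_bound_of_continuousOn hF'.continuousOn
  refine intervalIntegral.hasFDerivAt_integral_of_dominated_of_fderiv_le (bound := fun _ => M)
    (F' := fun x t => (fderiv ℝ F (x, t)).comp (ContinuousLinearMap.inl ℝ E ℝ))
    (Metric.ball_mem_nhds x one_pos) ?_ ?_ ?_ ?_ ?_ ?_
  · exact Eventually.of_forall fun y =>
      (hF.continuous.comp (Continuous.prodMk_right y)).aestronglyMeasurable
  · exact (hF.continuous.comp (Continuous.prodMk_right x)).intervalIntegrable _ _
  · exact (hF'.comp (Continuous.prodMk_right x)).aestronglyMeasurable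
  · refine Eventually.of_forall fun t ht y hy => hM (y, t) ⟨Metric.ball_subset_closedBall hy, ?_⟩
    rw [Set.uIoc_of_le zero_le_one] at ht
    exact ⟨ht.1.le, ht.2⟩
  · exact intervalIntegrable_const
  · refine Eventually.of_forall fun t _ y _ => ?_
    have h1 : HasFDerivAt F (fderiv ℝ F (y, t)) (y, t) :=
      (hF.differentiable one_ne_zero (y, t)).hasFDerivAt
    exact h1.comp y (hasFDerivAt_prodMk_left y t)

/-- Differentiation under the integral sign, in all orders. -/
theorem contDiff_integral_unit (n : ℕ) : ∀ {G : Type} [NormedAddCommGroup G] [NormedSpace ℝ G]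
    {F : E × ℝ → G}, ContDiff ℝ n F → ContDiff ℝ n (fun x => ∫ t in (0 : ℝ)..1, F (x, t)) := by
  induction n with
  | zero =>
    intro G _ _ F hF
    rw [Nat.cast_zero, contDiff_zero] at hF ⊢
    exact intervalIntegral.continuous_parametric_intervalIntegral_of_continuous' (by exact hF) 0 1
  | succ n ih =>
    intro G _ _ F hF
    push_cast at hF ⊢
    refine contDiff_succ_iff_hasFDerivAt.2 ⟨_, ?_, fun x => hasFDerivAt_integral_unit
      (hF.of_le le_add_self) x⟩
    exact ih (F := fun q => (fderiv ℝ F q).comp (ContinuousLinearMap.inl ℝ E ℝ))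
      ((hF.fderiv_right le_rfl).clm_comp contDiff_const)

end ParametricIntegral

/-! ### Divided differences and zeros with multiplicity -/

section Division

variable {E : Type} [NormedAddCommGroup E] [NormedSpace ℝ E] [ProperSpace E]

/-- The divided difference `(F (x, θ) - F (x, a)) / (θ - a)` in the last variable, as a function of
`((x, a), θ)`. The integral formula makes it smooth across the diagonal `θ = a`. -/
def divDiff (F : E × ℝ → ℝ) (q : (E × ℝ) × ℝ) : ℝ :=
  ∫ t in (0 : ℝ)..1, fderiv ℝ F (q.1.1, q.1.2 + t * (q.2 - q.1.2)) (0, 1)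

theorem contDiff_divDiff {n : ℕ} {F : E × ℝ → ℝ} (hF : ContDiff ℝ (n + 1 : ℕ) F) :
    ContDiff ℝ n (divDiff F) := by
  push_cast at hF
  refine contDiff_integral_unit n (E := (E × ℝ) × ℝ)
    (F := fun q => fderiv ℝ F (q.1.1.1, q.1.1.2 + q.2 * (q.1.2 - q.1.1.2)) (0, 1)) ?_
  have h : ContDiff ℝ n (fun q : ((E × ℝ) × ℝ) × ℝ =>
      (q.1.1.1, q.1.1.2 + q.2 * (q.1.2 - q.1.1.2))) := by fun_prop
  exact ((hF.fderiv_right le_rfl).comp h).clm_apply contDiff_const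

omit [ProperSpace E] in
theorem hasDerivAt_right {F : E × ℝ → ℝ} (hF : ContDiff ℝ 1 F) (x : E) (θ : ℝ) :
    HasDerivAt (fun θ => F (x, θ)) (fderiv ℝ F (x, θ) (0, 1)) θ := by
  have h1 : HasFDerivAt F (fderiv ℝ F (x, θ)) (x, θ) :=
    (hF.differentiable one_ne_zero (x, θ)).hasFDerivAt
  have h2 : HasDerivAt (fun θ : ℝ => (x, θ)) ((0 : E), (1 : ℝ)) θ :=
    (hasDerivAt_const θ x).prodMk (hasDerivAt_id θ)
  exact h1.comp_hasDerivAt θ h2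

omit [ProperSpace E] in
theorem sub_eq_mul_divDiff {F : E × ℝ → ℝ} (hF : ContDiff ℝ 1 F) (x : E) (a θ : ℝ) :
    F (x, θ) - F (x, a) = (θ - a) * divDiff F ((x, a), θ) := by
  have h : ∀ t ∈ Set.uIcc (0 : ℝ) 1, HasDerivAt (fun t => F (x, a + t * (θ - a)))
      (fderiv ℝ F (x, a + t * (θ - a)) (0, 1) * (θ - a)) t := fun t _ => by
    have := (hasDerivAt_right hF x (a + t * (θ - a))).comp t
      (((hasDerivAt_id t).mul_const (θ - a)).const_add a)
    simpa [Function.comp_def] using this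
  have hc : Continuous fun t : ℝ => fderiv ℝ F (x, a + t * (θ - a)) (0, 1) * (θ - a) := by
    have := hF.continuous_fderiv one_ne_zero
    fun_prop
  have := intervalIntegral.integral_eq_sub_of_hasDerivAt h (hc.intervalIntegrable _ _)
  rw [intervalIntegral.integral_mul_const] at this
  simp only [one_mul, zero_mul, add_zero, add_sub_cancel] at this
  rw [← this, mul_comm]; rfl

theorem iteratedDeriv_sub_mul {h : ℝ → ℝ} {j : ℕ} (hh : ContDiff ℝ (j + 1 : ℕ) h) (a x : ℝ) :
    iteratedDeriv (j + 1) (fun θ => (θ - a) * h θ) x =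
      (x - a) * iteratedDeriv (j + 1) h x + (j + 1) * iteratedDeriv j h x := by
  have h0 : ContDiff ℝ (j + 1 : ℕ) (fun θ : ℝ => θ - a) := by fun_prop
  have h2 : ∀ i, iteratedDeriv (i + 1) (fun θ : ℝ => θ - a) x = if i = 0 then 1 else 0 := by
    intro i
    rw [iteratedDeriv_succ']
    have : deriv (fun θ : ℝ => θ - a) = fun _ => 1 := by
      ext y; simp
    rw [this, iteratedDeriv_const]
  rw [iteratedDeriv_fun_mul h0.contDiffAt hh.contDiffAt, Finset.sum_range_succ',
    Finset.sum_range_succ']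
  rw [Finset.sum_eq_zero]
  · rw [zero_add, h2]; simp; ring
  · intro i _
    rw [h2]; simp

omit [ProperSpace E] in
theorem contDiff_right {n : ℕ} {F : E × ℝ → ℝ} (hF : ContDiff ℝ n F) (x : E) :
    ContDiff ℝ n (fun θ => F (x, θ)) :=
  hF.comp (contDiff_prodMk_right x)

/-- Taylor expansion in the last variable, with a remainder that is smooth in all variables. -/
theorem exists_taylor (m n : ℕ) : ∀ {F : E × ℝ → ℝ}, ContDiff ℝ (m + n : ℕ) F →
    ∃ h : E × ℝ → ℝ, ContDiff ℝ m h ∧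
      (∀ j < n, ContDiff ℝ m (fun x => iteratedDeriv j (fun R => F (x, R)) 0 / (j.factorial : ℝ))) ∧
      ∀ x R, F (x, R) = ∑ j ∈ Finset.range n,
        iteratedDeriv j (fun R => F (x, R)) 0 / (j.factorial : ℝ) * R ^ j + R ^ n * h (x, R) := by
  induction n with
  | zero => exact fun {F} hF => ⟨F, hF, by simp, by simp⟩
  | succ n ih =>
    intro F hF
    set F₁ : E × ℝ → ℝ := fun q => divDiff F ((q.1, 0), q.2) with hF₁
    have hF1 : ContDiff ℝ (m + n : ℕ) F₁ :=
      (contDiff_divDiff hF).comp (by fun_prop : ContDiff ℝ (m + n : ℕ)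
        (fun q : E × ℝ => (((q.1, 0), q.2) : (E × ℝ) × ℝ)))
    have hone : ContDiff ℝ 1 F := hF.of_le (by norm_cast; omega)
    have hFF : ∀ x R, F (x, R) = F (x, 0) + (R - 0) * F₁ (x, R) := fun x R => by
      rw [← sub_eq_mul_divDiff hone]; ring
    have hshift : ∀ j < n, ∀ x,
        iteratedDeriv (j + 1) (fun R => F (x, R)) 0 / ((j + 1).factorial : ℝ) =
          iteratedDeriv j (fun R => F₁ (x, R)) 0 / (j.factorial : ℝ) := by
      intro j hj x
      have hj' : ContDiff ℝ (j + 1 : ℕ) (fun R => F₁ (x, R)) :=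
        (contDiff_right hF1 x).of_le (by norm_cast; omega)
      have : (fun R => F (x, R)) = fun R => F (x, 0) + (R - 0) * F₁ (x, R) := funext (hFF x)
      rw [this, iteratedDeriv_const_add (by omega), iteratedDeriv_sub_mul hj', Nat.factorial_succ]
      push_cast
      have : (j.factorial : ℝ) ≠ 0 := by positivity
      field_simp
      ring
    obtain ⟨h, hh, ha, he⟩ := ih hF1
    refine ⟨h, hh, ?_, fun x R => ?_⟩
    · rintro (_ | j) hj
      · simp only [iteratedDeriv_zero, Nat.factorial_zero, Nat.cast_one, div_one]
        exact (hF.of_le (by norm_cast; omega)).comp (contDiff_prodMk_left 0)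
      · have := ha j (by omega)
        simpa only [hshift j (by omega)] using this
    · have hs : ∑ j ∈ Finset.range n, iteratedDeriv (j + 1) (fun R => F (x, R)) 0 /
          ((j + 1).factorial : ℝ) * R ^ (j + 1) = R * ∑ j ∈ Finset.range n,
          iteratedDeriv j (fun R => F₁ (x, R)) 0 / (j.factorial : ℝ) * R ^ j := by
        rw [Finset.mul_sum]
        refine Finset.sum_congr rfl fun j hj => ?_
        rw [hshift j (Finset.mem_range.1 hj) x]
        ring
      rw [Finset.sum_range_succ', hs, hFF x R, he x R]
      simp only [iteratedDeriv_zero, Nat.factorial_zero, Nat.cast_one, div_one, pow_zero]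
      ring

/-- `g` vanishes to order at least `m` at `b`. -/
def HasZero (g : ℝ → ℝ) (b : ℝ) (m : ℕ) : Prop := ∀ j < m, iteratedDeriv j g b = 0

theorem HasZero.eq_zero {g : ℝ → ℝ} {b : ℝ} {m : ℕ} (h : HasZero g b m) (hm : 0 < m) : g b = 0 := by
  simpa using h 0 hm

omit [ProperSpace E] in
theorem eq_mul_divDiff {F : E × ℝ → ℝ} (hF : ContDiff ℝ 1 F) {x : E} {a : ℝ} (h : F (x, a) = 0)
    (θ : ℝ) : F (x, θ) = (θ - a) * divDiff F ((x, a), θ) := by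
  rw [← sub_eq_mul_divDiff hF, h, sub_zero]

/-- Division by `θ - a` lowers the order of a zero at `a` by one. -/
theorem HasZero.divDiff_self {n m : ℕ} {F : E × ℝ → ℝ} (hF : ContDiff ℝ (n + 1 : ℕ) F)
    {x : E} {a : ℝ} (hm : m ≤ n) (h : HasZero (fun θ => F (x, θ)) a (m + 1)) :
    HasZero (fun θ => divDiff F ((x, a), θ)) a m := by
  intro j hj
  have hone : ContDiff ℝ 1 F := hF.of_le (by norm_cast; omega)
  have h1 := h (j + 1) (by omega)
  rw [funext (eq_mul_divDiff hone (x := x) (a := a) (h.eq_zero (by omega))),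
    iteratedDeriv_sub_mul ((contDiff_right (contDiff_divDiff hF) (x, a)).of_le
      (by norm_cast; omega))] at h1
  have : ((j : ℝ) + 1) ≠ 0 := by positivity
  simpa [this] using h1

/-- Division by `θ - a` preserves zeros away from `a`. -/
theorem HasZero.divDiff_ne {n m : ℕ} {F : E × ℝ → ℝ} (hF : ContDiff ℝ (n + 1 : ℕ) F)
    {x : E} {a b : ℝ} (hm : m ≤ n + 1) (hab : b ≠ a) (ha : F (x, a) = 0)
    (h : HasZero (fun θ => F (x, θ)) b m) :
    HasZero (fun θ => divDiff F ((x, a), θ)) b m := by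
  have hone : ContDiff ℝ 1 F := hF.of_le (by norm_cast; omega)
  have hab' : b - a ≠ 0 := sub_ne_zero.2 hab
  intro j
  induction j with
  | zero =>
    intro hj
    have h0 : F (x, b) = 0 := h.eq_zero hj
    rw [eq_mul_divDiff hone ha b] at h0
    simpa [hab'] using h0
  | succ j ih =>
    intro hj
    have h1 := h (j + 1) hj
    rw [funext (eq_mul_divDiff hone ha), iteratedDeriv_sub_mul ((contDiff_right
      (contDiff_divDiff hF) (x, a)).of_le (by norm_cast; omega)), ih (by omega)] at h1
    simpa [hab'] using h1

/-- `g` has double zeros at `a ≠ b` and vanishes once more, at a third point `c` or to third order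
at `b` (then `c = b`): five zeros `a, a, b, b, c` in all. -/
def HasFiveZeros (g : ℝ → ℝ) (a b c : ℝ) : Prop :=
  b ≠ a ∧ HasZero g a 2 ∧ HasZero g b 2 ∧ ((c ≠ a ∧ c ≠ b ∧ g c = 0) ∨ (c = b ∧ HasZero g b 3))

/-- Newton's iterated divided difference on the nodes `a, a, b, b, c`: the cofactor is jointly
continuous in the parameters and the nodes, also where nodes coalesce. Each of the five divisions
costs one derivative. -/
theorem exists_newton {F : E × ℝ → ℝ} (hF : ContDiff ℝ (8 : ℕ) F) :
    ∃ H : ((((((E × ℝ) × ℝ) × ℝ) × ℝ) × ℝ)) × ℝ → ℝ, Continuous H ∧ ∀ x a b c,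
      HasFiveZeros (fun θ => F (x, θ)) a b c → ∀ θ, F (x, θ) =
        (θ - a) ^ 2 * (θ - b) ^ 2 * (θ - c) * H ((((((x, a), a), b), b), c), θ) := by
  have h1 := contDiff_divDiff (n := 7) hF
  have h2 := contDiff_divDiff (n := 6) h1
  have h3 := contDiff_divDiff (n := 5) h2
  have h4 := contDiff_divDiff (n := 4) h3
  have h5 := contDiff_divDiff (n := 3) h4
  have one : ∀ n : ℕ, ((1 : WithTop ℕ∞)) ≤ ((n + 1 : ℕ) : WithTop ℕ∞) := fun n => by
    norm_cast; omega
  refine ⟨_, h5.continuous, fun x a b c ⟨hba, ha, hb, hc⟩ θ => ?_⟩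
  have a0 : F (x, a) = 0 := ha.eq_zero two_pos
  have a1 := (ha.divDiff_self hF (by norm_num)).eq_zero one_pos
  have b1 := hb.divDiff_ne hF (by norm_num) hba a0
  have b2 := b1.divDiff_ne h1 (by norm_num) hba a1
  have b3 := (b2.divDiff_self h2 (by norm_num)).eq_zero one_pos
  -- the fifth zero, in the two cases of `HasFiveZeros`
  have c4 : divDiff (divDiff (divDiff (divDiff F))) (((((x, a), a), b), b), c) = 0 := by
    rcases hc with ⟨hca, hcb, hc⟩ | ⟨rfl, hc⟩
    · have c0 : HasZero (fun θ => F (x, θ)) c 1 := fun j hj => by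
        obtain rfl : j = 0 := by omega
        simpa using hc
      have c1 := c0.divDiff_ne hF (by norm_num) hca a0
      have c2 := c1.divDiff_ne h1 (by norm_num) hca a1
      have c3 := c2.divDiff_ne h2 (by norm_num) hcb (b2.eq_zero two_pos)
      exact (c3.divDiff_ne h3 (by norm_num) hcb b3).eq_zero one_pos
    · have c1 := hc.divDiff_ne hF (by norm_num) hba a0
      have c2 := c1.divDiff_ne h1 (by norm_num) hba a1
      have c3 := c2.divDiff_self h2 (by norm_num)
      exact (c3.divDiff_self h3 (by norm_num)).eq_zero one_pos
  rw [eq_mul_divDiff (hF.of_le (one 7)) a0, eq_mul_divDiff (h1.of_le (one 6)) a1,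
    eq_mul_divDiff (h2.of_le (one 5)) (b2.eq_zero two_pos), eq_mul_divDiff (h3.of_le (one 4)) b3,
    eq_mul_divDiff (h4.of_le (one 3)) c4]
  ring

/-- Five zeros persist in the limit, with multiplicities adding up when they coalesce. -/
theorem exists_factor_of_tendsto {F : E × ℝ → ℝ} (hF : ContDiff ℝ (8 : ℕ) F) {ι : Type}
    {l : Filter ι} [l.NeBot] {x : ι → E} {a b c : ι → ℝ} {x₀ : E} {a₀ b₀ c₀ : ℝ}
    (hx : Tendsto x l (𝓝 x₀)) (ha : Tendsto a l (𝓝 a₀)) (hb : Tendsto b l (𝓝 b₀))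
    (hc : Tendsto c l (𝓝 c₀))
    (h : ∀ᶠ s in l, HasFiveZeros (fun θ => F (x s, θ)) (a s) (b s) (c s)) :
    ∃ K : ℝ → ℝ, Continuous K ∧
      ∀ θ, F (x₀, θ) = (θ - a₀) ^ 2 * (θ - b₀) ^ 2 * (θ - c₀) * K θ := by
  obtain ⟨H, hH, hfac⟩ := exists_newton hF
  refine ⟨fun θ => H ((((((x₀, a₀), a₀), b₀), b₀), c₀), θ), by fun_prop, fun θ => ?_⟩
  have hθ : Tendsto (fun _ : ι => θ) l (𝓝 θ) := tendsto_const_nhds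
  have t1 : Tendsto (fun s => F (x s, θ)) l (𝓝 (F (x₀, θ))) :=
    (hF.continuous.tendsto _).comp (hx.prodMk_nhds hθ)
  have t2 := (hH.tendsto ((((((x₀, a₀), a₀), b₀), b₀), c₀), θ)).comp
    (((((((hx.prodMk_nhds ha).prodMk_nhds ha).prodMk_nhds hb).prodMk_nhds hb).prodMk_nhds
      hc)).prodMk_nhds hθ)
  have t3 := ((((hθ.sub ha).pow 2).mul ((hθ.sub hb).pow 2)).mul (hθ.sub hc)).mul t2
  refine tendsto_nhds_unique (t1.congr' ?_) t3
  filter_upwards [h] with s hs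
  exact hfac _ _ _ _ hs θ

end Division

/-! ### Taylor expansion in the plane -/

section Jets

/-- The quadratic part of the Taylor expansion of `f` at the origin. -/
def quadPart (f : ℝ × ℝ → ℝ) (x y : ℝ) : ℝ :=
  coeff f 2 0 * x ^ 2 + coeff f 1 1 * x * y + coeff f 0 2 * y ^ 2

/-- The cubic part of the Taylor expansion of `f` at the origin. -/
def cubicPart (f : ℝ × ℝ → ℝ) (x y : ℝ) : ℝ :=
  coeff f 3 0 * x ^ 3 + coeff f 2 1 * x ^ 2 * y + coeff f 1 2 * x * y ^ 2 + coeff f 0 3 * y ^ 3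

/-- The quartic part of the Taylor expansion of `f` at the origin. -/
def quarticPart (f : ℝ × ℝ → ℝ) (x y : ℝ) : ℝ :=
  coeff f 4 0 * x ^ 4 + coeff f 3 1 * x ^ 3 * y + coeff f 2 2 * x ^ 2 * y ^ 2 +
    coeff f 1 3 * x * y ^ 3 + coeff f 0 4 * y ^ 4

theorem isBigO_monomial_mul {k : ℝ × ℝ → ℝ} (hk : Continuous k) {i j n : ℕ} (hn : n ≤ i + j) :
    (fun p : ℝ × ℝ => p.1 ^ i * p.2 ^ j * k p) =O[𝓝 0] fun p => ‖p‖ ^ n := by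
  have h1 : (fun p : ℝ × ℝ => p.1) =O[𝓝 0] fun p => ‖p‖ :=
    Asymptotics.IsBigO.of_norm_le fun p => by simpa using norm_fst_le p
  have h2 : (fun p : ℝ × ℝ => p.2) =O[𝓝 0] fun p => ‖p‖ :=
    Asymptotics.IsBigO.of_norm_le fun p => by simpa using norm_snd_le p
  have h3 : k =O[𝓝 0] fun _ => (1 : ℝ) := (hk.tendsto 0).isBigO_one ℝ
  have h4 : (fun p : ℝ × ℝ => ‖p‖ ^ (i + j - n)) =O[𝓝 0] fun _ => (1 : ℝ) :=
    (((continuous_norm.pow (i + j - n)).tendsto (0 : ℝ × ℝ)).isBigO_one ℝ)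
  have h5 := ((((h1.pow i).mul (h2.pow j)).mul h3))
  have h6 := (Asymptotics.isBigO_refl (fun p : ℝ × ℝ => ‖p‖ ^ n) (𝓝 0)).mul h4
  have h7 := h6.congr (f₂ := fun p => ‖p‖ ^ i * ‖p‖ ^ j * 1) (g₂ := fun p => ‖p‖ ^ n)
    (fun p => by rw [← pow_add, ← pow_add, mul_one]; congr 1; omega) (fun p => mul_one _)
  exact h5.trans h7

/-- Taylor's theorem in the plane, in terms of the iterated derivatives that define `coeff`. -/
theorem taylor_isBigO_aux {f : ℝ × ℝ → ℝ} (hf : ContDiff ℝ (10 : ℕ) f) :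
    (fun p : ℝ × ℝ => f p - ∑ j ∈ Finset.range 5, ∑ i ∈ Finset.range 5,
      p.1 ^ i * p.2 ^ j * coeff f i j) =O[𝓝 0] fun p => ‖p‖ ^ 5 := by
  obtain ⟨h, hh, ha, he⟩ := exists_taylor 5 5 (F := f) hf
  have key : ∀ j : ℕ, ∃ k : ℝ → ℝ, j < 5 → (Continuous k ∧ ∀ x,
      iteratedDeriv j (fun R => f (x, R)) 0 / (j.factorial : ℝ) =
        ∑ i ∈ Finset.range 5, x ^ i * coeff f i j + x ^ 5 * k x) := by
    intro j
    by_cases hj : j < 5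
    swap
    · exact ⟨0, fun h => absurd h hj⟩
    obtain ⟨k, hk, -, hk'⟩ := exists_taylor 0 5 (E := ℝ) (F := fun q =>
      iteratedDeriv j (fun R => f (q.2, R)) 0 / (j.factorial : ℝ)) ((ha j hj).comp contDiff_snd)
    refine ⟨fun x => k (0, x), fun _ => ⟨hk.continuous.comp (by fun_prop), fun x => ?_⟩⟩
    have := hk' 0 x
    simp only at this
    rw [this]
    congr 1
    refine Finset.sum_congr rfl fun i _ => ?_
    simp only [div_eq_mul_inv, iteratedDeriv_mul_const_field, coeff, mul_inv]
    ring
  choose k hk using key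
  have hexp : ∀ p : ℝ × ℝ, f p - ∑ j ∈ Finset.range 5, ∑ i ∈ Finset.range 5,
      p.1 ^ i * p.2 ^ j * coeff f i j =
      ∑ j ∈ Finset.range 5, p.1 ^ 5 * p.2 ^ j * k j p.1 + p.1 ^ 0 * p.2 ^ 5 * h p := by
    rintro ⟨x, y⟩
    rw [he x y, Finset.sum_congr rfl fun j hj => by rw [(hk j (Finset.mem_range.1 hj)).2 x]]
    simp only [add_mul, Finset.sum_add_distrib, Finset.sum_mul]
    have e1 : ∑ j ∈ Finset.range 5, ∑ i ∈ Finset.range 5, x ^ i * coeff f i j * y ^ j =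
        ∑ j ∈ Finset.range 5, ∑ i ∈ Finset.range 5, x ^ i * y ^ j * coeff f i j :=
      Finset.sum_congr rfl fun j _ => Finset.sum_congr rfl fun i _ => by ring
    have e2 : ∑ j ∈ Finset.range 5, x ^ 5 * k j x * y ^ j =
        ∑ j ∈ Finset.range 5, x ^ 5 * y ^ j * k j x :=
      Finset.sum_congr rfl fun j _ => by ring
    rw [e1, e2]
    ring
  simp only [hexp]
  have h1 := Asymptotics.IsBigO.sum (s := Finset.range 5) (l := 𝓝 (0 : ℝ × ℝ))
    (A := fun j (p : ℝ × ℝ) => p.1 ^ 5 * p.2 ^ j * k j p.1) (g := fun p => ‖p‖ ^ 5) fun j hj =>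
      isBigO_monomial_mul (k := fun p => k j p.1)
        ((hk j (Finset.mem_range.1 hj)).1.comp continuous_fst) (by omega)
  refine (h1.congr_left fun p => Finset.sum_apply _ _ _).add
    (isBigO_monomial_mul (i := 0) (j := 5) hh.continuous le_rfl)

/-- Taylor's theorem for functions in Monge form. The double sum in `taylor_isBigO_aux` runs over a
square of indices; its terms of total degree at least five go into the error. -/
theorem taylor_isBigO {f : ℝ × ℝ → ℝ} (hf : ContDiff ℝ (10 : ℕ) f)
    (h00 : coeff f 0 0 = 0) (h10 : coeff f 1 0 = 0) (h01 : coeff f 0 1 = 0) :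
    (fun p : ℝ × ℝ => f p - (quadPart f p.1 p.2 + cubicPart f p.1 p.2 + quarticPart f p.1 p.2))
      =O[𝓝 0] fun p => ‖p‖ ^ 5 := by
  have hm : ∀ i j : ℕ, 5 ≤ i + j → (fun p : ℝ × ℝ => p.1 ^ i * p.2 ^ j * coeff f i j) =O[𝓝 0]
      fun p => ‖p‖ ^ 5 := fun i j h => isBigO_monomial_mul (k := fun _ => coeff f i j)
        continuous_const h
  have h := ((((((((((taylor_isBigO_aux hf).add (hm 4 1 (by norm_num))).add
    (hm 3 2 (by norm_num))).add (hm 4 2 (by norm_num))).add (hm 2 3 (by norm_num))).add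
    (hm 3 3 (by norm_num))).add (hm 4 3 (by norm_num))).add (hm 1 4 (by norm_num))).add
    (hm 2 4 (by norm_num))).add (hm 3 4 (by norm_num))).add (hm 4 4 (by norm_num))
  refine h.congr_left fun p => ?_
  simp only [Finset.sum_range_succ, Finset.sum_range_zero, h00, h10, h01, quadPart, cubicPart,
    quarticPart]
  ring

theorem coeff_congr {f g : ℝ × ℝ → ℝ} (h : f =ᶠ[𝓝 0] g) (i j : ℕ) : coeff f i j = coeff g i j := by
  have h' : ∀ᶠ x in 𝓝 (0 : ℝ), ∀ᶠ y in 𝓝 (0 : ℝ), f (x, y) = g (x, y) := by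
    have : ∀ᶠ q in 𝓝 (0 : ℝ) ×ˢ 𝓝 (0 : ℝ), f q = g q := by rwa [← nhds_prod_eq]
    exact this.curry
  have : (fun x => iteratedDeriv j (fun y => f (x, y)) 0) =ᶠ[𝓝 0]
      fun x => iteratedDeriv j (fun y => g (x, y)) 0 :=
    h'.mono fun x hx => Filter.EventuallyEq.iteratedDeriv_eq j hx
  rw [coeff, coeff, this.iteratedDeriv_eq i]

/-- A germ of a smooth function extends to a function of any prescribed finite smoothness on the
whole plane. (`ContDiffAt ℝ ∞` provides a neighbourhood for each finite order separately.) -/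
theorem exists_global_extension {f : ℝ × ℝ → ℝ} (hf : ContDiffAt ℝ ∞ f 0) (n : ℕ) :
    ∃ g : ℝ × ℝ → ℝ, ContDiff ℝ n g ∧ f =ᶠ[𝓝 0] g := by
  obtain ⟨ε, hε, hfε⟩ : ∃ ε > 0, ContDiffOn ℝ n f (Metric.ball 0 ε) := by
    have h1 : ContDiffAt ℝ n f 0 := hf.of_le (by exact_mod_cast le_top)
    obtain ⟨u, hu, hfu⟩ := h1.contDiffOn (m := n) le_rfl (by simp)
    have hu' : u ∈ 𝓝 (0 : ℝ × ℝ) := by simpa using hu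
    obtain ⟨ε, hε, hs⟩ := Metric.mem_nhds_iff.1 hu'
    exact ⟨ε, hε, hfu.mono hs⟩
  -- multiply by a bump function
  let b : ContDiffBump (0 : ℝ × ℝ) := ⟨ε / 4, ε / 2, by positivity, by linarith⟩
  refine ⟨fun p => b p * f p, ?_, ?_⟩
  · refine contDiff_iff_contDiffAt.2 fun p => ?_
    by_cases hp : p ∈ Metric.ball (0 : ℝ × ℝ) ε
    · exact b.contDiffAt.mul (hfε.contDiffAt (Metric.isOpen_ball.mem_nhds hp))
    · have hp' : p ∈ (Metric.closedBall (0 : ℝ × ℝ) (ε / 2))ᶜ := by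
        simp only [Metric.mem_ball, not_lt] at hp
        simp only [Set.mem_compl_iff, Metric.mem_closedBall, not_le]
        linarith
      have : (fun p => b p * f p) =ᶠ[𝓝 p] fun _ => 0 := by
        filter_upwards [Metric.isClosed_closedBall.isOpen_compl.mem_nhds hp'] with q hq
        have : b q = 0 := b.zero_of_le_dist (by
          simp only [Set.mem_compl_iff, Metric.mem_closedBall, not_le] at hq
          exact hq.le)
        rw [this, zero_mul]
      exact contDiffAt_const.congr_of_eventuallyEq this
  · filter_upwards [b.eventuallyEq_one] with q hq
    rw [hq]; simp

end Jets

/-! ### Contact in terms of zeros of a function of the angle -/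

section Contact

variable {f g : ℝ × ℝ → ℝ} {z p : ℝ × ℝ} {R θ : ℝ} {m : ℕ}

theorem continuous_circlePoint (z : ℝ × ℝ) (R : ℝ) : Continuous (circlePoint z R) := by
  unfold circlePoint; fun_prop

theorem HasContact.congr (h : f =ᶠ[𝓝 p] g) (hc : HasContact m f z R p) : HasContact m g z R p := by
  obtain ⟨hR, hd, θ, hθ, hj⟩ := hc
  refine ⟨hR, by rwa [← h.fderiv_eq], θ, hθ, fun j h1 h2 => ?_⟩
  rw [← hj j h1 h2]
  refine Filter.EventuallyEq.iteratedDeriv_eq j ?_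
  have : Tendsto (circlePoint z R) (𝓝 θ) (𝓝 p) := hθ ▸ (continuous_circlePoint z R).tendsto θ
  exact (this.eventually h).mono fun _ h => h.symm

theorem iteratedDeriv_circle_eq {θ' : ℝ} (hR : R ≠ 0)
    (h : circlePoint z R θ = circlePoint z R θ') (j : ℕ) :
    iteratedDeriv j (fun φ => f (circlePoint z R φ)) θ =
      iteratedDeriv j (fun φ => f (circlePoint z R φ)) θ' := by
  simp only [circlePoint, Prod.mk.injEq, add_right_inj, mul_right_inj' hR] at h
  have hc : Real.cos (θ' - θ) = 1 := by
    rw [Real.cos_sub, h.1, h.2, ← Real.cos_sq_add_sin_sq θ']; ring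
  have hs : Real.sin (θ' - θ) = 0 := by rw [Real.sin_sub, h.1, h.2]; ring
  have : (fun φ => f (circlePoint z R φ)) = fun φ => f (circlePoint z R (φ + (θ' - θ))) := by
    ext φ
    simp only [circlePoint, Real.cos_add φ, Real.sin_add φ, hc, hs]
    simp
  conv_lhs => rw [this]
  rw [iteratedDeriv_comp_add_const j (fun φ => f (circlePoint z R φ)) (θ' - θ)]
  simp

/-- Contact in terms of any angle `θ` that represents the point. -/
theorem HasContact.hasZero (hc : HasContact m f z R p) (hθ : circlePoint z R θ = p) :
    HasZero (fun φ => f (circlePoint z R φ) - f p) θ (m + 1) := by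
  obtain ⟨hR, -, θ', hθ', hj⟩ := hc
  rintro (_ | j) hjm
  · simp [hθ]
  · simp only [sub_eq_neg_add]
    rw [iteratedDeriv_const_add (by omega), iteratedDeriv_circle_eq hR.ne' (hθ.trans hθ'.symm)]
    exact hj _ (by omega) (by omega)

theorem HasContact.exists_angle (hc : HasContact m f z R p) : ∃ θ, circlePoint z R θ = p :=
  let ⟨_, _, θ, hθ, _⟩ := hc
  ⟨θ, hθ⟩

end Contact

/-! ### Zeros of trigonometric polynomials -/

section TrigonometricZeros

open Polynomial

theorem continuous_dslope_exp (a : ℝ) :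
    Continuous (dslope (fun θ : ℝ => Complex.exp (θ * Complex.I)) a) := by
  rw [← continuousOn_univ, continuousOn_dslope Filter.univ_mem]
  refine ⟨by fun_prop, ?_⟩
  fun_prop

theorem exp_mul_I_injOn : Set.InjOn (fun θ : ℝ => Complex.exp (θ * Complex.I))
    (Set.Ioc (-Real.pi) Real.pi) := by
  intro x hx y hy h
  have := congrArg Complex.arg h
  simpa only [Complex.exp_mul_I, Complex.arg_cos_add_sin_mul_I hx,
    Complex.arg_cos_add_sin_mul_I hy] using this

theorem dslope_exp_ne_zero {a θ : ℝ} (ha : a ∈ Set.Ioc (-Real.pi) Real.pi)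
    (hθ : θ ∈ Set.Ioc (-Real.pi) Real.pi) :
    dslope (fun θ : ℝ => Complex.exp (θ * Complex.I)) a θ ≠ 0 := by
  rcases eq_or_ne θ a with rfl | hne
  · have h1 : HasDerivAt (fun θ : ℝ => Complex.exp (θ * Complex.I))
        (Complex.exp (θ * Complex.I) * (1 * Complex.I)) θ :=
      ((Complex.ofRealCLM.hasDerivAt (x := θ)).mul_const Complex.I).cexp
    rw [dslope_same, h1.deriv]
    simp [Complex.exp_ne_zero]
  · intro h0
    have := sub_smul_dslope (fun θ : ℝ => Complex.exp (θ * Complex.I)) a θ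
    rw [h0, smul_zero] at this
    exact hne (exp_mul_I_injOn hθ ha (sub_eq_zero.1 this.symm))

/-- Zeros, with multiplicity, of `θ ↦ p (exp (i θ))` on a fundamental interval are roots of `p` with
at least the same multiplicity. -/
theorem prod_X_sub_C_dvd (L : List ℝ) : (∀ a ∈ L, a ∈ Set.Ioc (-Real.pi) Real.pi) →
    ∀ (p : ℂ[X]) (w k : ℝ → ℂ), Continuous w → Continuous k →
    (∀ θ ∈ Set.Ioc (-Real.pi) Real.pi, w θ ≠ 0) →
    (∀ θ : ℝ, p.eval (Complex.exp (θ * Complex.I)) * w θ =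
      (L.map fun a : ℝ => ((θ : ℂ) - a)).prod * k θ) →
    (L.map fun a : ℝ => X - C (Complex.exp (a * Complex.I))).prod ∣ p := by
  induction L with
  | nil => intros; simp
  | cons a L ih =>
    intro hL p w k hw hk hw0 h
    have ha : a ∈ Set.Ioc (-Real.pi) Real.pi := hL a (by simp)
    have hroot : p.IsRoot (Complex.exp (a * Complex.I)) := by
      have := h a
      simpa [hw0 a ha] using this
    obtain ⟨q, rfl⟩ := dvd_iff_isRoot.2 hroot
    rw [List.map_cons, List.prod_cons]
    refine mul_dvd_mul_left _ (ih (fun b hb => hL b (by simp [hb])) q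
      (fun θ => dslope (fun θ : ℝ => Complex.exp (θ * Complex.I)) a θ * w θ) k
      ((continuous_dslope_exp a).mul hw) hk
      (fun θ hθ => mul_ne_zero (dslope_exp_ne_zero ha hθ) (hw0 θ hθ)) ?_)
    have hpc : Continuous (fun θ : ℝ => q.eval (Complex.exp (θ * Complex.I))) :=
      q.continuous.comp (by fun_prop)
    have hprod : Continuous fun θ : ℝ => (L.map fun a : ℝ => ((θ : ℂ) - a)).prod :=
      continuous_list_prod L fun a _ => by fun_prop
    -- cancel `θ - a` for `θ ≠ a`, and conclude by continuity
    refine congrFun (Continuous.ext_on (dense_compl_singleton a)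
      (hpc.mul ((continuous_dslope_exp a).mul hw)) (hprod.mul hk) fun θ hθ => ?_)
    have hθ' : (θ : ℂ) - a ≠ 0 := sub_ne_zero.2 (by exact_mod_cast hθ)
    have h1 := h θ
    have h2 := sub_smul_dslope (fun θ : ℝ => Complex.exp (θ * Complex.I)) a θ
    simp only [eval_mul, eval_sub, eval_X, eval_C, List.map_cons, List.prod_cons] at h1
    simp only [Complex.real_smul, Complex.ofReal_sub] at h2
    rw [← h2] at h1
    refine mul_left_cancel₀ hθ' ?_
    linear_combination h1

theorem ofReal_cos_eq (θ : ℝ) : ((Real.cos θ : ℝ) : ℂ) =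
    (Complex.exp (θ * Complex.I) + (Complex.exp (θ * Complex.I))⁻¹) / 2 := by
  rw [Complex.ofReal_cos, Complex.cos, ← Complex.exp_neg, neg_mul]

theorem ofReal_sin_eq (θ : ℝ) : ((Real.sin θ : ℝ) : ℂ) =
    ((Complex.exp (θ * Complex.I))⁻¹ - Complex.exp (θ * Complex.I)) * Complex.I / 2 := by
  rw [Complex.ofReal_sin, Complex.sin, ← Complex.exp_neg, neg_mul]

/-- A trigonometric polynomial of degree two with five zeros, counted with multiplicity, vanishes
identically. -/
theorem trig_eq_zero_of_factor {c : Fin 5 → ℝ} {x y z : ℝ} (hx : x ∈ Set.Ioc (-Real.pi) Real.pi)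
    (hy : y ∈ Set.Ioc (-Real.pi) Real.pi) (hz : z ∈ Set.Ioc (-Real.pi) Real.pi) {K : ℝ → ℝ}
    (hK : Continuous K)
    (h : ∀ θ, c 0 + c 1 * Real.cos θ + c 2 * Real.sin θ + c 3 * Real.cos θ ^ 2 +
      c 4 * (Real.cos θ * Real.sin θ) = (θ - x) ^ 2 * (θ - y) ^ 2 * (θ - z) * K θ) (θ : ℝ) :
    c 0 + c 1 * Real.cos θ + c 2 * Real.sin θ + c 3 * Real.cos θ ^ 2 +
      c 4 * (Real.cos θ * Real.sin θ) = 0 := by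
  -- with `X = exp (i θ)`, this is `X ^ 2` times the trigonometric polynomial
  let p : ℂ[X] := C (c 0 : ℂ) * X ^ 2 + C (c 1 / 2 : ℂ) * (X ^ 3 + X) +
    C (c 2 * Complex.I / 2) * (X - X ^ 3) + C (c 3 / 4 : ℂ) * (X ^ 2 + 1) ^ 2 +
    C (c 4 * Complex.I / 4) * (1 - X ^ 4)
  have hp : ∀ θ : ℝ, p.eval (Complex.exp (θ * Complex.I)) = Complex.exp (θ * Complex.I) ^ 2 *
      ((c 0 + c 1 * Real.cos θ + c 2 * Real.sin θ + c 3 * Real.cos θ ^ 2 +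
      c 4 * (Real.cos θ * Real.sin θ) : ℝ) : ℂ) := by
    intro θ
    push_cast [-Complex.ofReal_cos, -Complex.ofReal_sin]
    rw [ofReal_cos_eq, ofReal_sin_eq]
    have := Complex.exp_ne_zero (θ * Complex.I)
    simp only [p, eval_add, eval_sub, eval_mul, eval_C, eval_X, eval_pow, eval_one]
    field_simp
    ring
  have hdeg : p.natDegree ≤ 4 := by
    simp only [p]
    compute_degree
  have hdvd := prod_X_sub_C_dvd [x, x, y, y, z] (by simp [hx.1, hx.2, hy.1, hy.2, hz.1, hz.2]) p
    (fun _ => 1) (fun θ => Complex.exp (θ * Complex.I) ^ 2 * (K θ : ℂ)) continuous_const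
    (by fun_prop) (by simp) (fun θ => by
      rw [hp θ, h θ]
      push_cast
      simp only [List.map_cons, List.map_nil, List.prod_cons, List.prod_nil]
      ring)
  have hp0 : p = 0 := by
    refine eq_zero_of_dvd_of_natDegree_lt hdvd (hdeg.trans_lt ?_)
    simp only [List.map_cons, List.map_nil, List.prod_cons, List.prod_nil, mul_one]
    have hm : ∀ a : ℝ, (X - C (Complex.exp (a * Complex.I))).Monic := fun a => monic_X_sub_C _
    rw [(hm x).natDegree_mul ((hm x).mul ((hm y).mul ((hm y).mul (hm z)))),
      (hm x).natDegree_mul ((hm y).mul ((hm y).mul (hm z))),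
      (hm y).natDegree_mul ((hm y).mul (hm z)), (hm y).natDegree_mul (hm z)]
    simp
  have h3 := hp θ
  rw [hp0, eval_zero, zero_eq_mul] at h3
  exact_mod_cast h3.resolve_left (pow_ne_zero 2 (Complex.exp_ne_zero _))

end TrigonometricZeros

/-! ### Vanishing of coefficients of asymptotically small polynomials -/

section Asymptotic

/-- Uniqueness of Taylor coefficients. -/
theorem eq_zero_of_isBigO_pow (n : ℕ) : ∀ {c : ℕ → ℝ} {k : ℝ → ℝ}, ContinuousAt k 0 →
    (fun R : ℝ => ∑ j ∈ Finset.range n, c j * R ^ j + R ^ n * k R) =O[𝓝[≠] 0]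
      (fun R => R ^ (n + 1)) → (∀ j < n, c j = 0) ∧ k 0 = 0 := by
  have hpow : ∀ m : ℕ, Tendsto (fun R : ℝ => R ^ (m + 1)) (𝓝[≠] 0) (𝓝 0) := fun m => by
    have : Tendsto (fun R : ℝ => R ^ (m + 1)) (𝓝 0) (𝓝 (0 ^ (m + 1))) :=
      (continuous_pow (m + 1)).tendsto 0
    rw [zero_pow (by omega)] at this
    exact this.mono_left nhdsWithin_le_nhds
  induction n with
  | zero =>
    intro c k hk h
    simp only [Finset.range_zero, Finset.sum_empty, zero_add, pow_zero, one_mul] at h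
    exact ⟨by simp, tendsto_nhds_unique (hk.mono_left nhdsWithin_le_nhds)
      (h.trans_tendsto (by simpa using hpow 0))⟩
  | succ n ih =>
    intro c k hk h
    have hsplit : ∀ R : ℝ, ∑ j ∈ Finset.range (n + 1), c j * R ^ j + R ^ (n + 1) * k R =
        c 0 + R * (∑ j ∈ Finset.range n, c (j + 1) * R ^ j + R ^ n * k R) := fun R => by
      rw [Finset.sum_range_succ', mul_add, Finset.mul_sum,
        Finset.sum_congr rfl fun j _ => show c (j + 1) * R ^ (j + 1) = R * (c (j + 1) * R ^ j) by
          ring]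
      ring
    simp only [hsplit] at h
    have h0 : c 0 = 0 := by
      have hc : ContinuousAt (fun R : ℝ => c 0 + R * (∑ j ∈ Finset.range n, c (j + 1) * R ^ j +
          R ^ n * k R)) 0 := by fun_prop
      have := tendsto_nhds_unique (hc.mono_left nhdsWithin_le_nhds)
        (h.trans_tendsto (hpow (n + 1)))
      simpa using this
    simp only [h0, zero_add] at h
    have h' : (fun R : ℝ => ∑ j ∈ Finset.range n, c (j + 1) * R ^ j + R ^ n * k R) =O[𝓝[≠] 0]
        (fun R => R ^ (n + 1)) := by
      have h2 := (Asymptotics.isBigO_refl (fun R : ℝ => R⁻¹) (𝓝[≠] 0)).mul h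
      refine h2.congr' ?_ ?_
      all_goals
        filter_upwards [self_mem_nhdsWithin] with R hR
        have hR' : R ≠ 0 := hR
        field_simp
        try ring
    obtain ⟨h3, h4⟩ := ih (c := fun j => c (j + 1)) hk h'
    refine ⟨?_, h4⟩
    rintro (_ | j) hj
    · exact h0
    · exact h3 j (by omega)

end Asymptotic

/-! ### Circles with five-fold contact -/

section FiveContact

/-- The circle with centre `z` and radius `R` touches the isophote of `f` through `a` and `b` there,
and has in addition a third point `c` in common with this isophote, where `c = b` is allowed if it
is osculating at `b`. This covers triple crossings and cusps of the symmetry set. -/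
def IsFiveContact (f : ℝ × ℝ → ℝ) (z : ℝ × ℝ) (R : ℝ) (a b c : ℝ × ℝ) : Prop :=
  b ≠ a ∧ f b = f a ∧ f c = f a ∧ HasContact 1 f z R a ∧ HasContact 1 f z R b ∧
    (∃ θ, circlePoint z R θ = c) ∧ ((c ≠ a ∧ c ≠ b) ∨ (c = b ∧ HasContact 2 f z R b))

variable {f g : ℝ × ℝ → ℝ} {z a b c : ℝ × ℝ} {R : ℝ}

theorem IsFiveContact.pos (h : IsFiveContact f z R a b c) : 0 < R := h.2.2.2.1.1

/-- Five-fold contact depends only on the germs of `f` at the three points. -/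
theorem IsFiveContact.congr (ha : f =ᶠ[𝓝 a] g) (hb : f =ᶠ[𝓝 b] g) (hc : f =ᶠ[𝓝 c] g)
    (h : IsFiveContact f z R a b c) : IsFiveContact g z R a b c := by
  obtain ⟨h1, h2, h3, h4, h5, h6, h7⟩ := h
  rw [ha.eq_of_nhds, hb.eq_of_nhds] at h2
  rw [ha.eq_of_nhds, hc.eq_of_nhds] at h3
  exact ⟨h1, h2, h3, h4.congr ha, h5.congr hb, h6, h7.imp_right fun h => ⟨h.1, h.2.congr hb⟩⟩

/-- Angles of the three points are zeros of `f - f a` on the circle, five with multiplicity. The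
angles of `b` and `c` have to agree as numbers, and not just modulo `2 π`, when `b = c`. -/
theorem IsFiveContact.hasFiveZeros (h : IsFiveContact f z R a b c) {α β γ : ℝ}
    (hα : circlePoint z R α = a) (hβ : circlePoint z R β = b) (hγ : circlePoint z R γ = c)
    (hbc : c = b → γ = β) : HasFiveZeros (fun φ => f (circlePoint z R φ) - f a) α β γ := by
  obtain ⟨h1, h2, h3, h4, h5, h6, h7⟩ := h
  refine ⟨fun h => h1 (by rw [← hα, ← hβ, h]), h4.hasZero hα, h2 ▸ h5.hasZero hβ, ?_⟩
  rcases h7 with ⟨hca, hcb⟩ | ⟨hcb, hb2⟩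
  · refine Or.inl ⟨fun h => hca (by rw [← hα, ← hγ, h]), fun h => hcb (by rw [← hβ, ← hγ, h]), ?_⟩
    simp only [hγ, h3, sub_self]
  · exact Or.inr ⟨hbc hcb, h2 ▸ hb2.hasZero hβ⟩

theorem HasZero.const_mul {g : ℝ → ℝ} {b : ℝ} {m : ℕ} (h : HasZero g b m) (r : ℝ) :
    HasZero (fun θ => r * g θ) b m := fun j hj => by
  rw [iteratedDeriv_const_mul_field, h j hj, mul_zero]

theorem HasFiveZeros.const_mul {g : ℝ → ℝ} {a b c : ℝ} (h : HasFiveZeros g a b c) (r : ℝ) :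
    HasFiveZeros (fun θ => r * g θ) a b c := by
  obtain ⟨h1, h2, h3, h4⟩ := h
  refine ⟨h1, h2.const_mul r, h3.const_mul r, h4.imp ?_ ?_⟩
  · rintro ⟨hca, hcb, h⟩
    exact ⟨hca, hcb, by simp [h]⟩
  · rintro ⟨hcb, h⟩
    exact ⟨hcb, h.const_mul r⟩

/-- Angles along an ultrafilter have representatives that converge to a point of the half-open
interval `(-π, π]`; so limits are distinct as angles as soon as they are distinct numbers. -/
theorem exists_angle_tendsto {ι : Type} (l : Ultrafilter ι) (θ : ι → ℝ) :
    ∃ (θ' : ι → ℝ) (t : ℝ), t ∈ Set.Ioc (-Real.pi) Real.pi ∧ Tendsto θ' l (𝓝 t) ∧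
      ∀ s, Real.cos (θ' s) = Real.cos (θ s) ∧ Real.sin (θ' s) = Real.sin (θ s) := by
  set θ₀ : ι → ℝ := fun s => ((θ s : ℝ) : Real.Angle).toReal with hθ₀
  have hcs : ∀ s, Real.cos (θ₀ s) = Real.cos (θ s) ∧ Real.sin (θ₀ s) = Real.sin (θ s) := fun s => by
    rw [hθ₀]
    simp only [Real.Angle.cos_toReal, Real.Angle.sin_toReal, Real.Angle.cos_coe,
      Real.Angle.sin_coe, and_self]
  have hmem : ∀ s, θ₀ s ∈ Set.Icc (-Real.pi) Real.pi := fun s =>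
    ⟨(Real.Angle.neg_pi_lt_toReal _).le, Real.Angle.toReal_le_pi _⟩
  obtain ⟨t, ht, hlim⟩ := (isCompact_Icc (a := -Real.pi) (b := Real.pi)).ultrafilter_le_nhds
    (l.map θ₀) (by
      rw [le_principal_iff]
      exact Ultrafilter.mem_map.2 (univ_mem' hmem))
  have hlim' : Tendsto θ₀ l (𝓝 t) := hlim
  rcases ht.1.lt_or_eq with h | h
  · exact ⟨θ₀, t, ⟨h, ht.2⟩, hlim', hcs⟩
  -- angles that tend to `-π` are moved to `π`
  · refine ⟨fun s => θ₀ s + 2 * Real.pi, Real.pi, ⟨by linarith [Real.pi_pos], le_rfl⟩, ?_, ?_⟩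
    · have : t + 2 * Real.pi = Real.pi := by rw [← h]; ring
      simpa only [this] using hlim'.add_const (2 * Real.pi)
    · intro s
      simpa using hcs s

/-- Any angles of the points of a five-fold contact may be replaced by convergent ones. -/
theorem exists_fiveZeros_tendsto {ι : Type} (l : Ultrafilter ι) {z a b c : ι → ℝ × ℝ} {R : ι → ℝ}
    (h : ∀ᶠ s in (l : Filter ι), IsFiveContact f (z s) (R s) (a s) (b s) (c s)) :
    ∃ (α β γ : ι → ℝ) (x y w : ℝ), x ∈ Set.Ioc (-Real.pi) Real.pi ∧
      y ∈ Set.Ioc (-Real.pi) Real.pi ∧ w ∈ Set.Ioc (-Real.pi) Real.pi ∧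
      Tendsto α l (𝓝 x) ∧ Tendsto β l (𝓝 y) ∧ Tendsto γ l (𝓝 w) ∧ ∀ᶠ s in (l : Filter ι),
      HasFiveZeros (fun φ => f (circlePoint (z s) (R s) φ) - f (a s)) (α s) (β s) (γ s) := by
  have hex : ∀ (p : ι → ℝ × ℝ), (∀ᶠ s in (l : Filter ι), ∃ θ, circlePoint (z s) (R s) θ = p s) →
      ∃ (θ : ι → ℝ) (t : ℝ), t ∈ Set.Ioc (-Real.pi) Real.pi ∧ Tendsto θ l (𝓝 t) ∧
        ∀ᶠ s in (l : Filter ι), circlePoint (z s) (R s) (θ s) = p s := by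
    intro p hp
    obtain ⟨θ₀, hθ₀⟩ := hp.choice
    obtain ⟨θ, t, ht, hlim, hcs⟩ := exists_angle_tendsto l θ₀
    refine ⟨θ, t, ht, hlim, hθ₀.mono fun s hs => ?_⟩
    rw [← hs, circlePoint, circlePoint, (hcs s).1, (hcs s).2]
  obtain ⟨α, x, hx, hαx, hα⟩ := hex a (h.mono fun s hs => hs.2.2.2.1.exists_angle)
  obtain ⟨β, y, hy, hβy, hβ⟩ := hex b (h.mono fun s hs => hs.2.2.2.2.1.exists_angle)
  obtain ⟨γ, w, hw, hγw, hγ⟩ := hex c (h.mono fun s hs => hs.2.2.2.2.2.1)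
  by_cases hbc : ∀ᶠ s in (l : Filter ι), c s = b s
  · refine ⟨α, β, β, x, y, y, hx, hy, hy, hαx, hβy, hβy, ?_⟩
    filter_upwards [h, hα, hβ, hbc] with s hs hα hβ hbc
    exact hs.hasFiveZeros hα hβ (hβ.trans hbc.symm) fun _ => rfl
  · refine ⟨α, β, γ, x, y, w, hx, hy, hw, hαx, hβy, hγw, ?_⟩
    filter_upwards [h, hα, hβ, hγ, Ultrafilter.eventually_not.2 hbc] with s hs hα hβ hγ hbc
    exact hs.hasFiveZeros hα hβ hγ fun h => absurd h hbc

end FiveContact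

/-! ### Limits of small circles -/

section SmallCircles

variable {f : ℝ × ℝ → ℝ}

/-- Taylor's theorem along a curve through the origin. -/
theorem taylor_comp_isBigO (hf : ContDiff ℝ (10 : ℕ) f)
    (h00 : coeff f 0 0 = 0) (h10 : coeff f 1 0 = 0) (h01 : coeff f 0 1 = 0) {γ : ℝ → ℝ × ℝ}
    (hγ : γ =O[𝓝[≠] 0] fun s => s) :
    (fun s => f (γ s) - (quadPart f (γ s).1 (γ s).2 + cubicPart f (γ s).1 (γ s).2 +
      quarticPart f (γ s).1 (γ s).2)) =O[𝓝[≠] 0] fun s => s ^ 5 := by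
  have h0 : Tendsto γ (𝓝[≠] 0) (𝓝 0) :=
    hγ.trans_tendsto (tendsto_id.mono_left nhdsWithin_le_nhds)
  exact ((taylor_isBigO hf h00 h10 h01).comp_tendsto h0).trans ((hγ.norm_left).pow 5)

theorem isBigO_pow_pow {m n : ℕ} (h : n ≤ m) :
    (fun s : ℝ => s ^ m) =O[𝓝[≠] 0] fun s => s ^ n := by
  rcases h.eq_or_lt with rfl | h
  · exact Asymptotics.isBigO_refl _ _
  · exact (Asymptotics.isLittleO_pow_pow h).isBigO.mono nhdsWithin_le_nhds

/-- If circles with five-fold contact shrink to the origin, the quadratic part is a multiple of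
`x ^ 2 + y ^ 2`. To leading order, the function `f - f a` on a circle is a combination of `1`,
`cos θ`, `sin θ` and the quadratic part; after normalization of its coefficients, the limit is a
nonzero combination, with five zeros. -/
theorem coeff_of_small_circles (hf : ContDiff ℝ (10 : ℕ) f) (h00 : coeff f 0 0 = 0)
    (h10 : coeff f 1 0 = 0) (h01 : coeff f 0 1 = 0) {ι : Type} (l : Ultrafilter ι)
    {z a b c : ι → ℝ × ℝ} {R : ι → ℝ} (hz : Tendsto z l (𝓝 0)) (hR : Tendsto R l (𝓝 0))
    (h : ∀ᶠ s in (l : Filter ι), IsFiveContact f (z s) (R s) (a s) (b s) (c s)) :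
    coeff f 2 0 = coeff f 0 2 ∧ coeff f 1 1 = 0 := by
  obtain ⟨k, hk, -, hexp⟩ := exists_taylor 8 2 (E := (ℝ × ℝ) × ℝ)
    (F := fun q => f (circlePoint q.1.1 q.2 q.1.2)) (by
      refine hf.comp ?_
      unfold circlePoint
      fun_prop)
  -- the gradient at the centre gives the linear part on the circle
  have hlin : ∀ (z : ℝ × ℝ) (θ R : ℝ), f (circlePoint z R θ) =
      f z + R * (fderiv ℝ f z (1, 0) * Real.cos θ + fderiv ℝ f z (0, 1) * Real.sin θ) +
        R ^ 2 * k ((z, θ), R) := by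
    intro z θ R
    have h1 := hexp (z, θ) R
    simp only [Finset.sum_range_succ, Finset.sum_range_zero, iteratedDeriv_zero,
      iteratedDeriv_one] at h1
    have h2 : HasDerivAt (fun R => f (circlePoint z R θ))
        (fderiv ℝ f z (Real.cos θ, Real.sin θ)) 0 := by
      have h3 : HasDerivAt (fun R => circlePoint z R θ) (Real.cos θ, Real.sin θ) 0 := by
        unfold circlePoint
        refine HasDerivAt.prodMk ?_ ?_
        · simpa using ((hasDerivAt_id (0 : ℝ)).mul_const (Real.cos θ)).const_add z.1
        · simpa using ((hasDerivAt_id (0 : ℝ)).mul_const (Real.sin θ)).const_add z.2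
      have h4 : circlePoint z 0 θ = z := by simp [circlePoint]
      have h5 : HasFDerivAt f (fderiv ℝ f z) (circlePoint z 0 θ) := by
        rw [h4]
        exact (hf.differentiable (by norm_num) z).hasFDerivAt
      exact h5.comp_hasDerivAt 0 h3
    have h6 : ((Real.cos θ, Real.sin θ) : ℝ × ℝ) =
        Real.cos θ • ((1, 0) : ℝ × ℝ) + Real.sin θ • ((0, 1) : ℝ × ℝ) := by simp
    rw [h1, h2.deriv, h6, map_add, map_smul, map_smul]
    simp [circlePoint]
    ring
  -- the limit of the quadratic remainder
  have hquad : ∀ θ : ℝ, k ((0, θ), 0) = quadPart f (Real.cos θ) (Real.sin θ) := by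
    intro θ
    have hO : (fun R : ℝ => circlePoint 0 R θ) =O[𝓝[≠] 0] fun R => R := by
      refine Asymptotics.IsBigO.of_bound 1 (Eventually.of_forall fun R => ?_)
      simp only [circlePoint, Prod.fst_zero, Prod.snd_zero, zero_add, Prod.norm_def, norm_mul,
        one_mul]
      exact max_le (mul_le_of_le_one_right (norm_nonneg _) (Real.abs_cos_le_one θ))
        (mul_le_of_le_one_right (norm_nonneg _) (Real.abs_sin_le_one θ))
    have h1 := (taylor_comp_isBigO hf h00 h10 h01 hO).trans (isBigO_pow_pow (n := 3) (by norm_num))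
    have h2 := (h1.add ((isBigO_pow_pow (m := 3) le_rfl).const_mul_left
      (cubicPart f (Real.cos θ) (Real.sin θ)))).add ((isBigO_pow_pow (m := 4) (n := 3)
      (by norm_num)).const_mul_left (quarticPart f (Real.cos θ) (Real.sin θ)))
    have h3 := (eq_zero_of_isBigO_pow 2
      (c := fun j => if j = 0 then f 0 else fderiv ℝ f 0 (1, 0) * Real.cos θ +
        fderiv ℝ f 0 (0, 1) * Real.sin θ)
      (k := fun R => k ((0, θ), R) - quadPart f (Real.cos θ) (Real.sin θ))
      (by
        have := hk.continuous
        fun_prop)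
      (h2.congr_left fun R => by
        rw [hlin]
        simp only [circlePoint, Prod.fst_zero, Prod.snd_zero, zero_add, Finset.sum_range_succ,
          Finset.sum_range_zero, quadPart, cubicPart, quarticPart]
        simp
        ring)).2
    linarith
  -- The coefficients of `1`, `cos`, `sin` and of the quadratic remainder in `(f - f a) / R`, as a
  -- vector normalized to length one, so that its limit `e` does not vanish.
  obtain ⟨α, β, γ, x, y, w, hx, hy, hw, hα, hβ, hγ, h5⟩ := exists_fiveZeros_tendsto l h
  set v : ι → ℝ × ℝ × ℝ × ℝ := fun s => ((f (z s) - f (a s)) / R s, fderiv ℝ f (z s) (1, 0),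
    fderiv ℝ f (z s) (0, 1), R s) with hv
  have hvpos : ∀ᶠ s in (l : Filter ι), 0 < ‖v s‖ := h.mono fun s hs => by
    refine norm_pos_iff.2 fun h0 => hs.pos.ne' ?_
    have := congrArg (fun q : ℝ × ℝ × ℝ × ℝ => q.2.2.2) h0
    simpa [hv] using this
  obtain ⟨e, he, hlim⟩ := (isCompact_sphere (0 : ℝ × ℝ × ℝ × ℝ) 1).ultrafilter_le_nhds
    (l.map fun s => ‖v s‖⁻¹ • v s) (by
      rw [le_principal_iff]
      refine Ultrafilter.mem_map.2 (hvpos.mono fun s hs => ?_)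
      simp only [mem_sphere_zero_iff_norm, norm_smul, norm_inv, norm_norm]
      exact inv_mul_cancel₀ hs.ne')
  have hlim' : Tendsto (fun s => ‖v s‖⁻¹ • v s) l (𝓝 e) := hlim
  have he1 : ‖e‖ = 1 := by simpa using he
  have hG : ContDiff ℝ (8 : ℕ) (fun q : ((ℝ × ℝ × ℝ × ℝ) × (ℝ × ℝ) × ℝ) × ℝ =>
      q.1.1.1 + q.1.1.2.1 * Real.cos q.2 + q.1.1.2.2.1 * Real.sin q.2 +
        q.1.1.2.2.2 * k ((q.1.2.1, q.2), q.1.2.2)) := by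
    have : ContDiff ℝ (8 : ℕ) (fun q : ((ℝ × ℝ × ℝ × ℝ) × (ℝ × ℝ) × ℝ) × ℝ =>
      k ((q.1.2.1, q.2), q.1.2.2)) := hk.comp (by fun_prop)
    fun_prop
  obtain ⟨K, hK, hfac⟩ := exists_factor_of_tendsto hG (hlim'.prodMk_nhds (hz.prodMk_nhds hR))
    hα hβ hγ (by
      filter_upwards [h5, h, hvpos] with s hs hs' hpos
      have hRs := hs'.pos.ne'
      have := hs.const_mul (‖v s‖⁻¹ * (R s)⁻¹)
      convert this using 2 with φ
      rw [hlin]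
      simp only [hv, Prod.smul_mk, smul_eq_mul]
      field_simp
      ring)
  simp only [hquad, quadPart] at hfac
  have hT := trig_eq_zero_of_factor (c := ![e.1 + e.2.2.2 * coeff f 0 2, e.2.1, e.2.2.1,
    e.2.2.2 * (coeff f 2 0 - coeff f 0 2), e.2.2.2 * coeff f 1 1]) hx hy hw hK (fun θ => by
      rw [← hfac θ]
      simp [Matrix.cons_val_zero]
      linear_combination (-(e.2.2.2 * coeff f 0 2)) * Real.sin_sq_add_cos_sq θ)
  -- compare coefficients by evaluation at special angles
  have t1 := hT 0
  have t2 := hT Real.pi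
  have t3 := hT (Real.pi / 2)
  have t4 := hT (-(Real.pi / 2))
  have t5 := hT (Real.pi / 4)
  simp at t1 t2 t3 t4
  have c0 : e.1 + e.2.2.2 * coeff f 0 2 = 0 := by linarith
  have c1 : e.2.1 = 0 := by linarith
  have c2 : e.2.2.1 = 0 := by linarith
  have c3 : e.2.2.2 * (coeff f 2 0 - coeff f 0 2) = 0 := by linarith
  have c4 : e.2.2.2 * coeff f 1 1 = 0 := by
    simpa [c0, c1, c2, c3] using t5
  have he3 : e.2.2.2 ≠ 0 := by
    intro h0
    rw [h0, zero_mul, add_zero] at c0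
    have : e = 0 := by
      ext <;> simp [c0, c1, c2, h0]
    rw [this, norm_zero] at he1
    exact zero_ne_one he1
  exact ⟨sub_eq_zero.1 ((mul_eq_zero.1 c3).resolve_left he3), (mul_eq_zero.1 c4).resolve_left he3⟩

end SmallCircles

/-! ### Circular arcs parametrized by arc length -/

section Arcs

/-- `sin (κ s) / κ` and `(1 - cos (κ s)) / κ` extend to smooth functions of `(κ, s)`, with the
expansions displayed here. -/
theorem exists_arc_functions : ∃ u v : ℝ → ℝ, ContDiff ℝ (10 : ℕ) u ∧ ContDiff ℝ (10 : ℕ) v ∧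
    (∀ κ s : ℝ, Real.sin (κ * s) = κ * (s - κ ^ 2 / 6 * s ^ 3 + κ ^ 3 * s ^ 4 * u (κ * s))) ∧
    ∀ κ s : ℝ, 1 - Real.cos (κ * s) = κ * (κ / 2 * s ^ 2 + κ ^ 3 * s ^ 4 * v (κ * s)) := by
  obtain ⟨u, hu, -, hu'⟩ := exists_taylor 10 4 (E := ℝ) (F := fun q => Real.sin q.2)
    (Real.contDiff_sin.comp contDiff_snd)
  obtain ⟨v, hv, -, hv'⟩ := exists_taylor 10 4 (E := ℝ) (F := fun q => Real.cos q.2)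
    (Real.contDiff_cos.comp contDiff_snd)
  refine ⟨fun x => u (0, x), fun x => -v (0, x), hu.comp (contDiff_prodMk_right 0),
    (hv.comp (contDiff_prodMk_right 0)).neg, fun κ s => ?_, fun κ s => ?_⟩
  · have h := hu' 0 (κ * s)
    have e0 : iteratedDeriv 2 Real.sin 0 = 0 := by simp [iteratedDeriv_succ]
    have e1 : iteratedDeriv 3 Real.sin 0 = -1 := by simp [iteratedDeriv_succ]
    simp [Finset.sum_range_succ, e0, e1, Nat.factorial] at h
    rw [h]
    ring
  · have h := hv' 0 (κ * s)
    have e0 : iteratedDeriv 2 Real.cos 0 = -1 := by simp [iteratedDeriv_succ]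
    have e1 : iteratedDeriv 3 Real.cos 0 = 0 := by simp [iteratedDeriv_succ]
    simp [Finset.sum_range_succ, e0, e1, Nat.factorial] at h
    rw [h]
    ring

theorem HasZero.comp_affine {g : ℝ → ℝ} {b : ℝ} {m n : ℕ} (hg : ContDiff ℝ n g) (hm : m ≤ n)
    (h : HasZero g b m) {θ κ s : ℝ} (hs : θ + κ * s = b) :
    HasZero (fun s => g (θ + κ * s)) s m := fun j hj => by
  have hg' : ContDiff ℝ j (fun x => g (θ + x)) :=
    (hg.of_le (by norm_cast; omega)).comp (by fun_prop)
  rw [iteratedDeriv_comp_const_mul hg' κ]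
  simp only [iteratedDeriv_comp_const_add]
  rw [hs, h j hj, mul_zero]

theorem HasFiveZeros.comp_affine {g : ℝ → ℝ} {a b c : ℝ} (hg : ContDiff ℝ (3 : ℕ) g)
    (h : HasFiveZeros g a b c) {θ κ s t r : ℝ} (ha : θ + κ * s = a) (hb : θ + κ * t = b)
    (hc : θ + κ * r = c) (hbc : r = t ∨ c ≠ b) : HasFiveZeros (fun s => g (θ + κ * s)) s t r := by
  obtain ⟨h1, h2, h3, h4⟩ := h
  refine ⟨?_, h2.comp_affine hg (by norm_num) ha, h3.comp_affine hg (by norm_num) hb, ?_⟩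
  · rintro rfl
    exact h1 (by rw [← ha, ← hb])
  rcases h4 with ⟨hca, hcb, h⟩ | ⟨hcb, h⟩
  · refine Or.inl ⟨?_, ?_, by simp only [hc, h]⟩
    · rintro rfl
      exact hca (by rw [← ha, ← hc])
    · rintro rfl
      exact hcb (by rw [← hb, ← hc])
  · exact Or.inr ⟨hbc.resolve_right fun h => h hcb, h.comp_affine hg le_rfl hb⟩

/-- Arc length on a circle is at most a multiple of the chord, for a suitable choice of angle. -/
theorem exists_angle_arc_le {z a b : ℝ × ℝ} {R α β : ℝ} (hR : 0 < R) (hα : circlePoint z R α = a)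
    (hβ : circlePoint z R β = b) :
    ∃ β', circlePoint z R β' = b ∧ |R * (β' - α)| ≤ Real.pi * ‖b - a‖ := by
  set d : ℝ := ((β - α : ℝ) : Real.Angle).toReal with hd
  have hc : Real.cos d = Real.cos (β - α) := by rw [hd, Real.Angle.cos_toReal, Real.Angle.cos_coe]
  have hs : Real.sin d = Real.sin (β - α) := by rw [hd, Real.Angle.sin_toReal, Real.Angle.sin_coe]
  have hdpi : |d| ≤ Real.pi := Real.Angle.abs_toReal_le_pi _
  have hb' : circlePoint z R (α + d) = b := by
    rw [← hβ]
    simp only [circlePoint, Real.cos_add, Real.sin_add, hc, hs]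
    rw [← Real.cos_add, ← Real.sin_add, add_sub_cancel]
  refine ⟨α + d, hb', ?_⟩
  have hhalf : 2 / Real.pi * |d / 2| ≤ |Real.sin (d / 2)| := Real.mul_abs_le_abs_sin (by
    rw [abs_div, abs_two]; linarith)
  have hchord : (b.1 - a.1) ^ 2 + (b.2 - a.2) ^ 2 = 4 * R ^ 2 * Real.sin (d / 2) ^ 2 := by
    rw [← hα, ← hb']
    simp only [circlePoint, Real.cos_add, Real.sin_add]
    have h1 : Real.cos d = 1 - 2 * Real.sin (d / 2) ^ 2 := by
      have := Real.cos_two_mul (d / 2)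
      rw [mul_div_cancel₀ d two_ne_zero] at this
      have := Real.sin_sq_add_cos_sq (d / 2)
      linarith
    have h2 := Real.sin_sq_add_cos_sq d
    have h3 := Real.sin_sq_add_cos_sq α
    have h4 : Real.sin d ^ 2 = 4 * Real.sin (d / 2) ^ 2 - 4 * Real.sin (d / 2) ^ 4 := by
      rw [h1] at h2; linarith
    rw [h1]
    linear_combination (R ^ 2 * (4 * Real.sin (d / 2) ^ 4 + Real.sin d ^ 2)) * h3 + R ^ 2 * h4
  have h1 : |b.1 - a.1| ≤ ‖b - a‖ := by simpa using norm_fst_le (b - a)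
  have h2 : |b.2 - a.2| ≤ ‖b - a‖ := by simpa using norm_snd_le (b - a)
  have h3 : (2 * R * |Real.sin (d / 2)|) ^ 2 ≤ (2 * ‖b - a‖) ^ 2 := by
    have e1 := pow_le_pow_left₀ (abs_nonneg _) h1 2
    have e2 := pow_le_pow_left₀ (abs_nonneg _) h2 2
    rw [sq_abs] at e1 e2
    rw [mul_pow, mul_pow, sq_abs]
    nlinarith [sq_nonneg ‖b - a‖]
  have h5 : 2 * R * |Real.sin (d / 2)| ≤ 2 * ‖b - a‖ :=
    (le_abs_self _).trans (abs_le_of_sq_le_sq h3 (by positivity))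
  rw [add_sub_cancel_left, abs_mul, abs_of_pos hR]
  have h6 : |d| = Real.pi * (2 / Real.pi * |d / 2|) := by
    rw [abs_div, abs_two]
    field_simp
  rw [h6]
  calc R * (Real.pi * (2 / Real.pi * |d / 2|)) ≤ R * (Real.pi * |Real.sin (d / 2)|) := by gcongr
    _ = Real.pi * (2 * R * |Real.sin (d / 2)|) / 2 := by ring
    _ ≤ Real.pi * (2 * ‖b - a‖) / 2 := by gcongr
    _ = _ := by ring

end Arcs

/-! ### Limits of large circles -/

section FlatPoints

variable {f : ℝ × ℝ → ℝ}

/-- Derivative of the quadratic part at `(a, b)` in the normal direction `(-b, a)`. -/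
def quadNormal (f : ℝ × ℝ → ℝ) (a b : ℝ) : ℝ :=
  2 * coeff f 2 0 * a * (-b) + coeff f 1 1 * (a * a + b * (-b)) + 2 * coeff f 0 2 * b * a

/-- Derivative of the cubic part at `(a, b)` in the normal direction `(-b, a)`. -/
def cubicNormal (f : ℝ × ℝ → ℝ) (a b : ℝ) : ℝ :=
  3 * coeff f 3 0 * a ^ 2 * (-b) + coeff f 2 1 * (2 * a * b * (-b) + a ^ 2 * a) +
    coeff f 1 2 * ((-b) * b ^ 2 + 2 * a * b * a) + 3 * coeff f 0 3 * b ^ 2 * a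

/-- The isophote of `f` through the origin has a branch in the direction of the unit vector `(a, b)`
which has contact of order at least `4` with the circle (or line) of curvature `2 m`. -/
def HasFlatBranch (f : ℝ × ℝ → ℝ) : Prop := ∃ a b m : ℝ, a ^ 2 + b ^ 2 = 1 ∧ quadPart f a b = 0 ∧
  cubicPart f a b + m * quadNormal f a b = 0 ∧
  quarticPart f a b + m * cubicNormal f a b + m ^ 2 * quadPart f (-b) a = 0

/-- A curve through the origin in the direction `(a, b)` that differs from an arc of curvature `κ`
by terms of order four, and along which `f` vanishes to fifth order, gives a flat branch with
`m = κ / 2`. -/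
theorem hasFlatBranch_of_isBigO (hf : ContDiff ℝ (10 : ℕ) f) (h00 : coeff f 0 0 = 0)
    (h10 : coeff f 1 0 = 0) (h01 : coeff f 0 1 = 0) {a b κ : ℝ} {ρ σ : ℝ → ℝ}
    (hab : a ^ 2 + b ^ 2 = 1) (hρ : Continuous ρ) (hσ : Continuous σ) {γ : ℝ → ℝ × ℝ}
    (hγ : ∀ s, γ s = (a * (s - κ ^ 2 / 6 * s ^ 3 + s ^ 4 * ρ s) - b * (κ / 2 * s ^ 2 + s ^ 4 * σ s),
      b * (s - κ ^ 2 / 6 * s ^ 3 + s ^ 4 * ρ s) + a * (κ / 2 * s ^ 2 + s ^ 4 * σ s)))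
    (h : (fun s => f (γ s)) =O[𝓝[≠] 0] fun s => s ^ 5) : HasFlatBranch f := by
  -- the curve is `s • (a + s * W₁, b + s * W₂)`
  set V₁ : ℝ → ℝ := fun s => a * (-κ ^ 2 / 6 + s * ρ s) - b * (s * σ s) with hV₁
  set V₂ : ℝ → ℝ := fun s => b * (-κ ^ 2 / 6 + s * ρ s) + a * (s * σ s) with hV₂
  set W₁ : ℝ → ℝ := fun s => -b * (κ / 2) + s * V₁ s with hW₁
  set W₂ : ℝ → ℝ := fun s => a * (κ / 2) + s * V₂ s with hW₂
  have hγ' : ∀ s, γ s = (s * (a + s * W₁ s), s * (b + s * W₂ s)) := fun s => by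
    rw [hγ]
    ext <;> simp only [hW₁, hW₂, hV₁, hV₂] <;> ring
  have cV₁ : Continuous V₁ := by fun_prop
  have cV₂ : Continuous V₂ := by fun_prop
  have cW₁ : Continuous W₁ := by fun_prop
  have cW₂ : Continuous W₂ := by fun_prop
  have hO : γ =O[𝓝[≠] 0] fun s => s := by
    have h1 : ∀ g : ℝ → ℝ, Continuous g → (fun s => s * g s) =O[𝓝[≠] 0] fun s => s := by
      intro g hg
      have := (Asymptotics.isBigO_refl (fun s : ℝ => s) (𝓝[≠] 0)).mul
        (((hg.tendsto 0).mono_left nhdsWithin_le_nhds).isBigO_one ℝ)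
      simpa using this
    rw [funext hγ']
    exact (h1 _ (by fun_prop)).prod_left (h1 _ (by fun_prop))
  have hT := h.sub (taylor_comp_isBigO hf h00 h10 h01 hO)
  -- `s ^ 4 * k s` consists of the terms of order at least four
  set k : ℝ → ℝ := fun s =>
    (2 * coeff f 2 0 * a * V₁ s + coeff f 1 1 * (a * V₂ s + b * V₁ s) +
      2 * coeff f 0 2 * b * V₂ s) + quadPart f (-b * (κ / 2)) (a * (κ / 2)) +
    s * (2 * coeff f 2 0 * (-b * (κ / 2)) * V₁ s + coeff f 1 1 * ((-b * (κ / 2)) * V₂ s +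
      (a * (κ / 2)) * V₁ s) + 2 * coeff f 0 2 * (a * (κ / 2)) * V₂ s) +
    s ^ 2 * quadPart f (V₁ s) (V₂ s) +
    (coeff f 3 0 * W₁ s * ((a + s * W₁ s) ^ 2 + (a + s * W₁ s) * a + a ^ 2) +
      coeff f 2 1 * ((a + s * W₁ s) ^ 2 * W₂ s + b * W₁ s * (a + s * W₁ s + a)) +
      coeff f 1 2 * (W₁ s * (b + s * W₂ s) ^ 2 + a * W₂ s * (b + s * W₂ s + b)) +
      coeff f 0 3 * W₂ s * ((b + s * W₂ s) ^ 2 + (b + s * W₂ s) * b + b ^ 2)) +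
    quarticPart f (a + s * W₁ s) (b + s * W₂ s) with hk
  have ck : Continuous k := by
    rw [hk]
    unfold quadPart quarticPart
    fun_prop
  obtain ⟨h1, h2⟩ := eq_zero_of_isBigO_pow 4 (c := fun j => if j = 2 then quadPart f a b else
    if j = 3 then cubicPart f a b + κ / 2 * quadNormal f a b else 0) (k := k) ck.continuousAt
    (hT.congr_left fun s => by
      rw [hγ' s]
      simp only [Finset.sum_range_succ, Finset.sum_range_zero]
      simp [hk, quadPart, cubicPart, quarticPart, quadNormal, hW₁, hW₂]
      ring)
  have e2 : quadPart f a b = 0 := by simpa using h1 2 (by norm_num)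
  have e3 : cubicPart f a b + κ / 2 * quadNormal f a b = 0 := by simpa using h1 3 (by norm_num)
  refine ⟨a, b, κ / 2, hab, e2, e3, ?_⟩
  rw [← h2]
  simp only [hk, hV₁, hV₂, hW₁, hW₂, quadPart, cubicNormal, quarticPart] at e2 ⊢
  -- the cubic term of the parametrization contributes only a multiple of `quadPart f a b`
  linear_combination (κ ^ 2 / 3) * e2

/-- If the points of five-fold contact tend to the origin while the radii stay away from `0`, the
circles have a limit, a circle or a line, with five-fold contact at the origin. -/
theorem hasFlatBranch_of_large_circles (hf : ContDiff ℝ (10 : ℕ) f) (h00 : coeff f 0 0 = 0)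
    (h10 : coeff f 1 0 = 0) (h01 : coeff f 0 1 = 0) {ι : Type} (l : Ultrafilter ι)
    {z a b c : ι → ℝ × ℝ} {R : ι → ℝ} {δ : ℝ} (hδ : 0 < δ) (ha : Tendsto a l (𝓝 0))
    (hb : Tendsto b l (𝓝 0)) (hc : Tendsto c l (𝓝 0))
    (hR : ∀ᶠ s in (l : Filter ι), δ ≤ R s)
    (h : ∀ᶠ s in (l : Filter ι), IsFiveContact f (z s) (R s) (a s) (b s) (c s)) :
    HasFlatBranch f := by
  obtain ⟨u, v, hu, hv, husin, hvcos⟩ := exists_arc_functions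
  obtain ⟨α₀, hα₀⟩ := (h.mono fun s hs => hs.2.2.2.1.exists_angle).choice
  obtain ⟨α, x, -, hαx, hcs⟩ := exists_angle_tendsto l α₀
  have hα : ∀ᶠ s in (l : Filter ι), circlePoint (z s) (R s) (α s) = a s := hα₀.mono fun s hs => by
    rw [← hs, circlePoint, circlePoint, (hcs s).1, (hcs s).2]
  obtain ⟨κ, -, hκ⟩ := (isCompact_Icc (a := (0 : ℝ)) (b := δ⁻¹)).ultrafilter_le_nhds
    (l.map fun s => (R s)⁻¹) (by
      rw [le_principal_iff]
      refine Ultrafilter.mem_map.2 (hR.mono fun s hs => ?_)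
      exact ⟨inv_nonneg.2 (hδ.le.trans hs), inv_anti₀ hδ hs⟩)
  have hκ' : Tendsto (fun s => (R s)⁻¹) l (𝓝 κ) := hκ
  -- arc length parameters of the other points of contact
  have harc : ∀ p : ι → ℝ × ℝ, Tendsto p l (𝓝 0) →
      (∀ᶠ s in (l : Filter ι), ∃ θ, circlePoint (z s) (R s) θ = p s) →
      ∃ β : ι → ℝ, (∀ᶠ s in (l : Filter ι), circlePoint (z s) (R s) (β s) = p s) ∧
        Tendsto (fun s => R s * (β s - α s)) l (𝓝 0) := by
    intro p hp hex
    have : ∀ᶠ s in (l : Filter ι), ∃ β', circlePoint (z s) (R s) β' = p s ∧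
        |R s * (β' - α s)| ≤ Real.pi * ‖p s - a s‖ := by
      filter_upwards [hex, hα, h] with s ⟨θ, hθ⟩ hα hs
      exact exists_angle_arc_le hs.pos hα hθ
    obtain ⟨β, hβ⟩ := this.choice
    refine ⟨β, hβ.mono fun s hs => hs.1, ?_⟩
    have h1 : Tendsto (fun s => Real.pi * ‖p s - a s‖) l (𝓝 0) := by
      simpa using (hp.sub ha).norm.const_mul Real.pi
    exact squeeze_zero_norm' (hβ.mono fun s hs => hs.2) h1
  obtain ⟨β, hβ, hβ0⟩ := harc b hb (h.mono fun s hs => hs.2.2.2.2.1.exists_angle)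
  obtain ⟨γ, hγ, hγ0, hγβ⟩ : ∃ γ : ι → ℝ,
      (∀ᶠ s in (l : Filter ι), circlePoint (z s) (R s) (γ s) = c s) ∧
      Tendsto (fun s => R s * (γ s - α s)) l (𝓝 0) ∧
      ∀ᶠ s in (l : Filter ι), c s = b s → γ s = β s := by
    by_cases hbc : ∀ᶠ s in (l : Filter ι), c s = b s
    · refine ⟨β, ?_, hβ0, Eventually.of_forall fun _ _ => rfl⟩
      filter_upwards [hβ, hbc] with s h1 h2
      rw [h1, h2]
    · obtain ⟨γ, h1, h2⟩ := harc c hc (h.mono fun s hs => hs.2.2.2.2.2.1)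
      exact ⟨γ, h1, h2, (Ultrafilter.eventually_not.2 hbc).mono fun s h1 h2 => absurd h2 h1⟩
  -- The arc of curvature `κ` from a given point with normal angle `α`, as a function of
  -- `((point, α, κ), s)`; it extends smoothly to lines, `κ = 0`.
  let Γ : (((ℝ × ℝ) × ℝ × ℝ) × ℝ) → ℝ × ℝ := fun q =>
    (q.1.1.1 + (-Real.sin q.1.2.1 * (q.2 - q.1.2.2 ^ 2 / 6 * q.2 ^ 3 +
        q.1.2.2 ^ 3 * q.2 ^ 4 * u (q.1.2.2 * q.2)) -
        Real.cos q.1.2.1 * (q.1.2.2 / 2 * q.2 ^ 2 + q.1.2.2 ^ 3 * q.2 ^ 4 * v (q.1.2.2 * q.2))),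
      q.1.1.2 + (Real.cos q.1.2.1 * (q.2 - q.1.2.2 ^ 2 / 6 * q.2 ^ 3 +
        q.1.2.2 ^ 3 * q.2 ^ 4 * u (q.1.2.2 * q.2)) +
        -Real.sin q.1.2.1 * (q.1.2.2 / 2 * q.2 ^ 2 +
          q.1.2.2 ^ 3 * q.2 ^ 4 * v (q.1.2.2 * q.2))))
  have hΓ : ContDiff ℝ (8 : ℕ) (fun q => f (Γ q) - f q.1.1) := by
    have e1 : ContDiff ℝ (8 : ℕ) Γ := by
      have hu' := hu.of_le (m := ((8 : ℕ) : WithTop ℕ∞)) (by norm_cast)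
      have hv' := hv.of_le (m := ((8 : ℕ) : WithTop ℕ∞)) (by norm_cast)
      fun_prop
    have hf' := hf.of_le (m := ((8 : ℕ) : WithTop ℕ∞)) (by norm_cast)
    exact (hf'.comp e1).sub (hf'.comp (by fun_prop))
  have hΓcirc : ∀ (z : ℝ × ℝ) (R α s : ℝ), R ≠ 0 →
      Γ ((circlePoint z R α, α, R⁻¹), s) = circlePoint z R (α + R⁻¹ * s) := by
    intro z R α s hR
    have h1 := husin R⁻¹ s
    have h2 := hvcos R⁻¹ s
    simp only [Γ, circlePoint, Real.cos_add, Real.sin_add, h1]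
    have h3 : Real.cos (R⁻¹ * s) = 1 - R⁻¹ * (R⁻¹ / 2 * s ^ 2 +
        R⁻¹ ^ 3 * s ^ 4 * v (R⁻¹ * s)) := by linarith
    rw [h3]
    ext <;> field_simp <;> ring
  obtain ⟨K, hK, hfac⟩ := exists_factor_of_tendsto hΓ
    (ha.prodMk_nhds (hαx.prodMk_nhds hκ')) (tendsto_const_nhds (x := (0 : ℝ))) hβ0 hγ0 (by
      filter_upwards [h, hα, hβ, hγ, hγβ] with s hs hα hβ hγ hγβ
      have hRs := hs.pos.ne'
      have h5 := hs.hasFiveZeros hα hβ hγ hγβ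
      have hsm : ContDiff ℝ (3 : ℕ) (fun φ => f (circlePoint (z s) (R s) φ) - f (a s)) := by
        have hf' := hf.of_le (m := ((3 : ℕ) : WithTop ℕ∞)) (by norm_cast)
        refine (hf'.comp ?_).sub contDiff_const
        unfold circlePoint
        fun_prop
      have h6 := h5.comp_affine hsm (θ := α s) (κ := (R s)⁻¹) (s := 0)
        (t := R s * (β s - α s)) (r := R s * (γ s - α s)) (by simp)
        (by field_simp; ring) (by field_simp; ring) (by
          by_cases hcb : c s = b s
          · left; rw [hγβ hcb]
          · right
            intro h7
            exact hcb (by rw [← hγ, ← hβ, h7]))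
      convert h6 using 2 with t
      rw [← hΓcirc _ _ _ _ hRs, hα])
  have hf0 : f 0 = 0 := by simpa [coeff, Prod.mk_zero_zero] using h00
  refine hasFlatBranch_of_isBigO hf h00 h10 h01 (a := -Real.sin x) (b := Real.cos x) (κ := κ)
    (ρ := fun s => κ ^ 3 * u (κ * s)) (σ := fun s => κ ^ 3 * v (κ * s))
    (by rw [neg_sq, Real.sin_sq_add_cos_sq]) (by have := hu.continuous; fun_prop)
    (by have := hv.continuous; fun_prop) (γ := fun s => Γ ((0, x, κ), s)) (fun s => ?_) ?_
  · simp only [Γ]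
    ext <;> simp <;> ring
  · have h1 : (fun s => f (Γ ((0, x, κ), s))) = fun s => s ^ 5 * K s := by
      ext s
      have := hfac s
      simp only [hf0, sub_zero] at this
      rw [this]
      ring
    rw [h1]
    have := (Asymptotics.isBigO_refl (fun s : ℝ => s ^ 5) (𝓝[≠] 0)).mul
      (((hK.tendsto 0).mono_left nhdsWithin_le_nhds).isBigO_one ℝ)
    simpa using this

end FlatPoints

/-! ### Elimination of direction and curvature -/

section Resultant

open Polynomial

/-- The condition for a flat branch in the direction `(a, b)`, with the curvature eliminated, in
terms of the coefficients `c i j` of a `4`-jet. -/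
def flatForm {S : Type} [CommRing S] (c : ℕ → ℕ → S) (a b : S) : S :=
  let B := 2 * c 2 0 * a * (-b) + c 1 1 * (a * a + b * (-b)) + 2 * c 0 2 * b * a
  let C := c 3 0 * a ^ 3 + c 2 1 * a ^ 2 * b + c 1 2 * a * b ^ 2 + c 0 3 * b ^ 3
  let D := 3 * c 3 0 * a ^ 2 * (-b) + c 2 1 * (2 * a * b * (-b) + a ^ 2 * a) +
    c 1 2 * ((-b) * b ^ 2 + 2 * a * b * a) + 3 * c 0 3 * b ^ 2 * a
  (c 4 0 * a ^ 4 + c 3 1 * a ^ 3 * b + c 2 2 * a ^ 2 * b ^ 2 + c 1 3 * a * b ^ 3 + c 0 4 * b ^ 4) *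
    B ^ 2 - C * B * D + C ^ 2 * (c 2 0 * b ^ 2 - c 1 1 * a * b + c 0 2 * a ^ 2)

/-- Naturality of `flatForm`, for specialization of the coefficients. -/
theorem map_flatForm {S T : Type} [CommRing S] [CommRing T] (φ : S →+* T) (c : ℕ → ℕ → S)
    (a b : S) : φ (flatForm c a b) = flatForm (fun i j => φ (c i j)) (φ a) (φ b) := by
  have h2 : φ 2 = 2 := map_ofNat φ 2
  have h3 : φ 3 = 3 := map_ofNat φ 3
  simp [flatForm, h2, h3]

theorem flatForm_mul {S : Type} [CommRing S] (c : ℕ → ℕ → S) (t a b : S) :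
    flatForm c (t * a) (t * b) = t ^ 8 * flatForm c a b := by
  simp only [flatForm]; ring

/-- The coordinate `c i j` as a polynomial on the space of `4`-jets; it is `0` where `(i, j)` is not
the index of a coordinate. -/
def jetVar (i j : ℕ) : MvPolynomial JetIndex ℝ :=
  if h : 2 ≤ i + j ∧ i + j ≤ 4 then MvPolynomial.X ⟨(i, j), h⟩ else 0

/-- The norm of `W` from `A[√Δ]` to `A`, computed from the remainder of `W` modulo `X ^ 2 - Δ`.
After specialization to `ℝ` it is the product of the values of `W` at the two square roots of `Δ`. -/
theorem exists_norm {A : Type} [CommRing A] [Nontrivial A] (Δ : A) (W : A[X]) :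
    ∃ N : A, ∀ (φ : A →+* ℝ) (τ : ℝ), τ ^ 2 = φ Δ →
      φ N = W.eval₂ φ τ * W.eval₂ φ (-τ) := by
  have hm : (X ^ 2 - C Δ).Monic := monic_X_pow_sub_C Δ two_ne_zero
  set r := W %ₘ (X ^ 2 - C Δ) with hr
  refine ⟨r.coeff 0 ^ 2 - Δ * r.coeff 1 ^ 2, fun φ τ hτ => ?_⟩
  have hdeg : r.natDegree ≤ 1 := by
    have := natDegree_modByMonic_lt W hm (by
      intro h
      have := congrArg natDegree h
      rw [natDegree_X_pow_sub_C, natDegree_one] at this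
      norm_num at this)
    rw [natDegree_X_pow_sub_C, ← hr] at this
    omega
  have hev : ∀ σ : ℝ, σ ^ 2 = φ Δ → W.eval₂ φ σ = φ (r.coeff 1) * σ + φ (r.coeff 0) := by
    intro σ hσ
    conv_lhs => rw [← modByMonic_add_div W (X ^ 2 - C Δ), ← hr,
      eq_X_add_C_of_natDegree_le_one hdeg]
    simp [eval₂_add, eval₂_mul, eval₂_sub, hσ]
  rw [hev τ hτ, hev (-τ) (by rw [neg_sq, hτ])]
  simp only [map_sub, map_mul, map_pow, ← hτ]
  ring

/-- Jets with a flat branch satisfy a nontrivial polynomial equation. With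
`τ ^ 2 = c₁₁ ^ 2 - 4 c₂₀ c₀₂`, the zeros of the quadratic part are the multiples of
`(τ - c₁₁, 2 c₂₀)`, provided that `c₂₀ ≠ 0`; the equation is the norm of `flatForm` there, times
`c₂₀`. -/
theorem exists_polynomial_flatBranch : ∃ P : MvPolynomial JetIndex ℝ, P ≠ 0 ∧
    ∀ f : ℝ × ℝ → ℝ, MvPolynomial.eval (jet f) P ≠ 0 → ¬ HasFlatBranch f := by
  set Δ : MvPolynomial JetIndex ℝ := jetVar 1 1 ^ 2 - 4 * jetVar 2 0 * jetVar 0 2 with hΔ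
  set W : (MvPolynomial JetIndex ℝ)[X] :=
    flatForm (fun i j => C (jetVar i j)) (X - C (jetVar 1 1)) (C (2 * jetVar 2 0)) with hW
  obtain ⟨N, hN⟩ := exists_norm Δ W
  have hWev : ∀ (φ : MvPolynomial JetIndex ℝ →+* ℝ) (τ : ℝ), W.eval₂ φ τ =
      flatForm (fun i j => φ (jetVar i j)) (τ - φ (jetVar 1 1)) (2 * φ (jetVar 2 0)) := by
    intro φ τ
    have h2 : φ 2 = 2 := map_ofNat φ 2
    rw [← coe_eval₂RingHom, hW, map_flatForm]
    simp [h2]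
  refine ⟨jetVar 2 0 * N, ?_, ?_⟩
  · -- the jet of `x ^ 2 - y ^ 2 + x ^ 4`
    set c : JetIndex → ℝ := fun m => if m.1 = (2, 0) then 1 else if m.1 = (0, 2) then -1 else
      if m.1 = (4, 0) then 1 else 0 with hc
    intro h0
    have h1 := congrArg (MvPolynomial.eval c) h0
    rw [map_mul, map_zero, hN (MvPolynomial.eval c) 2 (by simp [hΔ, jetVar, hc]; norm_num), hWev,
      hWev] at h1
    simp [flatForm, jetVar, hc] at h1
  · rintro f hf ⟨a, b, m, hab, h2, h3, h4⟩
    refine hf ?_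
    have hcoef : ∀ i j : ℕ, 2 ≤ i + j ∧ i + j ≤ 4 →
        MvPolynomial.eval (jet f) (jetVar i j) = coeff f i j := fun i j h => by
      rw [jetVar, dif_pos h, MvPolynomial.eval_X]; rfl
    rw [map_mul, hcoef 2 0 (by norm_num)]
    by_cases h20 : coeff f 2 0 = 0
    · rw [h20, zero_mul]
    have hb : b ≠ 0 := by
      rintro rfl
      have ha : a ^ 2 = 1 := by simpa using hab
      simp only [quadPart] at h2
      apply h20
      linear_combination h2 - coeff f 2 0 * ha
    set τ := 2 * coeff f 2 0 * a / b + coeff f 1 1 with hτ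
    have hτ2 : τ ^ 2 = MvPolynomial.eval (jet f) Δ := by
      simp only [hΔ, map_sub, map_mul, map_pow, map_ofNat, hcoef 2 0 (by norm_num),
        hcoef 1 1 (by norm_num), hcoef 0 2 (by norm_num), hτ]
      simp only [quadPart] at h2
      field_simp
      linear_combination (4 * coeff f 2 0) * h2
    rw [hN _ τ hτ2, hWev, hcoef 1 1 (by norm_num), hcoef 2 0 (by norm_num)]
    have ha' : τ - coeff f 1 1 = 2 * coeff f 2 0 / b * a := by rw [hτ]; ring
    have hb' : 2 * coeff f 2 0 = 2 * coeff f 2 0 / b * b := by field_simp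
    have hE : flatForm (fun i j => MvPolynomial.eval (jet f) (jetVar i j)) a b = 0 := by
      simp only [flatForm, hcoef 2 0 (by norm_num), hcoef 1 1 (by norm_num),
        hcoef 0 2 (by norm_num), hcoef 3 0 (by norm_num), hcoef 2 1 (by norm_num),
        hcoef 1 2 (by norm_num), hcoef 0 3 (by norm_num), hcoef 4 0 (by norm_num),
        hcoef 3 1 (by norm_num), hcoef 2 2 (by norm_num), hcoef 1 3 (by norm_num),
        hcoef 0 4 (by norm_num)]
      -- the resultant of the linear and the quadratic equation for the curvature
      have e : flatForm (coeff f) a b = quarticPart f a b * quadNormal f a b ^ 2 -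
          cubicPart f a b * quadNormal f a b * cubicNormal f a b +
          cubicPart f a b ^ 2 * quadPart f (-b) a := by
        simp only [flatForm, quarticPart, quadNormal, cubicPart, cubicNormal, quadPart]; ring
      have e' := e
      simp only [flatForm] at e'
      rw [e']
      linear_combination (quadNormal f a b ^ 2) * h4 +
        (quadPart f (-b) a * (cubicPart f a b - m * quadNormal f a b) -
          quadNormal f a b * cubicNormal f a b) * h3
    rw [ha']
    nth_rewrite 2 [hb']
    rw [flatForm_mul, hE]
    ring

end Resultant

/-! ### Hyperbolic points -/

section Hyperbolic

/-- Near a hyperbolic point whose `4`-jet avoids the flat branches there are neither triple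
crossings nor cusps: five-fold contacts accumulating at the origin would have radii with a limit
point `0`, or bounded away from `0`. -/
theorem hyperbolic_part : ∃ P : MvPolynomial JetIndex ℝ, P ≠ 0 ∧
    ∀ f : ℝ × ℝ → ℝ, IsMonge f → IsHyperbolic f → MvPolynomial.eval (jet f) P ≠ 0 →
      ∃ U ∈ 𝓝 (0 : ℝ × ℝ), ∀ k : ℝ, tripleCrossings f k U = ∅ ∧ cusps f k U = ∅ := by
  obtain ⟨P, hP, hflat⟩ := exists_polynomial_flatBranch
  refine ⟨P, hP, fun f ⟨hf, h00, h10, h01⟩ hhyp hPf => ?_⟩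
  obtain ⟨g, hg, hfg⟩ := exists_global_extension hf 10
  have hcoef := fun i j => coeff_congr hfg i j
  have hjet : jet f = jet g := funext fun m => hcoef _ _
  by_contra! hcon
  -- five-fold contacts arbitrarily close to the origin
  have hseq : ∀ n : ℕ, ∃ (z a b c : ℝ × ℝ) (R : ℝ), (∀ p ∈ ({a, b, c} : Set (ℝ × ℝ)),
      p ∈ Metric.ball (0 : ℝ × ℝ) (1 / (n + 1))) ∧ IsFiveContact f z R a b c := by
    intro n
    obtain ⟨k, hk⟩ := hcon _ (Metric.ball_mem_nhds (0 : ℝ × ℝ)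
      (by positivity : (0 : ℝ) < 1 / (n + 1)))
    by_cases hT : tripleCrossings f k (Metric.ball 0 (1 / (n + 1))) = ∅
    · obtain ⟨z, R, p, q, hp, hq, hpq, hfp, hfq, h1, h2⟩ := hk hT
      have h2' : HasContact 1 f z R q := by
        obtain ⟨hR, hd, θ, hθ, hj⟩ := h2
        exact ⟨hR, hd, θ, hθ, fun j h1 h2 => hj j h1 (h2.trans one_le_two)⟩
      refine ⟨z, p, q, q, R, ?_, hpq.symm, by rw [hfp, hfq], by rw [hfp, hfq], h1, h2',
        h2.exists_angle, Or.inr ⟨rfl, h2⟩⟩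
      simp only [Set.mem_insert_iff, Set.mem_singleton_iff]
      rintro _ (rfl | rfl | rfl) <;> assumption
    · obtain ⟨z, R, p, hp, hinj, hpk⟩ := Set.nonempty_iff_ne_empty.2 hT
      refine ⟨z, p 0, p 1, p 2, R, ?_, hinj.ne (by decide), by rw [(hpk 0).1, (hpk 1).1],
        by rw [(hpk 0).1, (hpk 2).1], (hpk 0).2, (hpk 1).2, (hpk 2).2.exists_angle,
        Or.inl ⟨hinj.ne (by decide), hinj.ne (by decide)⟩⟩
      simp only [Set.mem_insert_iff, Set.mem_singleton_iff]
      rintro _ (rfl | rfl | rfl) <;> exact hp _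
  choose z a b c R hmem hfive using hseq
  have hlim : ∀ p : ℕ → ℝ × ℝ, (∀ n : ℕ, p n ∈ Metric.ball (0 : ℝ × ℝ) (1 / ((n : ℝ) + 1))) →
      Tendsto p (hyperfilter ℕ : Filter ℕ) (𝓝 0) := by
    intro p hp
    have h1 : Tendsto p atTop (𝓝 0) := squeeze_zero_norm
      (fun n => (by simpa using (hp n) : ‖p n‖ < _).le) (by
        simpa using tendsto_one_div_add_atTop_nhds_zero_nat (𝕜 := ℝ))
    exact h1.mono_left Nat.hyperfilter_le_atTop
  have ha := hlim a fun n => hmem n _ (by simp)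
  have hb := hlim b fun n => hmem n _ (by simp)
  have hc := hlim c fun n => hmem n _ (by simp)
  have hloc : ∀ᶠ p in 𝓝 (0 : ℝ × ℝ), f =ᶠ[𝓝 p] g := eventually_eventually_nhds.2 hfg
  have hfive' : ∀ᶠ n in (hyperfilter ℕ : Filter ℕ),
      IsFiveContact g (z n) (R n) (a n) (b n) (c n) := by
    filter_upwards [ha.eventually hloc, hb.eventually hloc, hc.eventually hloc] with n h1 h2 h3
    exact (hfive n).congr h1 h2 h3
  rw [hcoef] at h00 h10 h01
  -- the limit exists in `[0, ∞]` along an ultrafilter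
  by_cases hR : Tendsto R (hyperfilter ℕ : Filter ℕ) (𝓝 0)
  · have hz : Tendsto z (hyperfilter ℕ : Filter ℕ) (𝓝 0) := by
      have h1 : ∀ n, ‖z n‖ ≤ ‖a n‖ + R n := fun n => by
        obtain ⟨θ, hθ⟩ := (hfive n).2.2.2.1.exists_angle
        have hpos := (hfive n).pos
        have h2 : ‖z n - a n‖ ≤ R n := by
          rw [← hθ, circlePoint, Prod.norm_def]
          simp only [Prod.fst_sub, Prod.snd_sub, sub_add_cancel_left, norm_neg, norm_mul,
            Real.norm_eq_abs, abs_of_pos hpos]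
          exact max_le (mul_le_of_le_one_right hpos.le (Real.abs_cos_le_one θ))
            (mul_le_of_le_one_right hpos.le (Real.abs_sin_le_one θ))
        calc ‖z n‖ = ‖a n + (z n - a n)‖ := by rw [add_sub_cancel]
          _ ≤ _ := (norm_add_le _ _).trans (by gcongr)
      exact squeeze_zero_norm h1 (by simpa using ha.norm.add hR)
    obtain ⟨e1, e2⟩ := coeff_of_small_circles hg h00 h10 h01 (hyperfilter ℕ) hz hR hfive'
    unfold IsHyperbolic at hhyp
    rw [hcoef, hcoef 0 2, hcoef 1 1, e1, e2] at hhyp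
    nlinarith [sq_nonneg (coeff g 0 2)]
  · obtain ⟨δ, hδ, hδR⟩ : ∃ δ > 0, ∀ᶠ n in (hyperfilter ℕ : Filter ℕ), δ ≤ R n := by
      by_contra! hcon'
      refine hR (Metric.tendsto_nhds.2 fun ε hε => ?_)
      refine (hcon' ε hε).mono fun n hn => ?_
      rwa [Real.dist_eq, sub_zero, abs_of_pos (hfive n).pos]
    rw [hjet] at hPf
    exact hflat g hPf (hasFlatBranch_of_large_circles hg h00 h10 h01 (hyperfilter ℕ) hδ ha hb hc
      hδR hfive')

end Hyperbolic

/-! ### Expansion on small circles at an umbilic -/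

section UmbilicExpansion

variable {f : ℝ × ℝ → ℝ}

/-- The leading part, on circles with centre `R ^ 2 • w` and radius `R → 0`, of
`(f - c R ^ 2) / R ^ 3` at an umbilic with `b₀ = b₂`, where `f = c (x ^ 2 + y ^ 2) + …`. -/
def leading (f : ℝ × ℝ → ℝ) (w : ℝ × ℝ) (θ : ℝ) : ℝ :=
  (2 * coeff f 2 0 * w.1 + coeff f 3 0) * Real.cos θ +
    (2 * coeff f 2 0 * w.2 + coeff f 2 1) * Real.sin θ +
    (coeff f 0 3 - coeff f 2 1) * Real.sin θ ^ 3

/-- The derivative of `leading f w`. -/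
def leadingDeriv (f : ℝ × ℝ → ℝ) (w : ℝ × ℝ) (θ : ℝ) : ℝ :=
  -(2 * coeff f 2 0 * w.1 + coeff f 3 0) * Real.sin θ +
    (2 * coeff f 2 0 * w.2 + coeff f 2 1) * Real.cos θ +
    3 * (coeff f 0 3 - coeff f 2 1) * Real.sin θ ^ 2 * Real.cos θ

/-- The second derivative of `leading f w`. -/
def leadingDeriv₂ (f : ℝ × ℝ → ℝ) (w : ℝ × ℝ) (θ : ℝ) : ℝ :=
  -(2 * coeff f 2 0 * w.1 + coeff f 3 0) * Real.cos θ -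
    (2 * coeff f 2 0 * w.2 + coeff f 2 1) * Real.sin θ +
    3 * (coeff f 0 3 - coeff f 2 1) * (2 * Real.sin θ * Real.cos θ ^ 2 - Real.sin θ ^ 3)

/-- The derivative of `leading f w θ` along a line in the space of all `(w, θ)`. -/
theorem hasDerivAt_leading_line (w d : ℝ × ℝ) (θ φ : ℝ) :
    HasDerivAt (fun τ : ℝ => leading f (w + τ • d) (θ + τ * φ))
      (2 * coeff f 2 0 * (d.1 * Real.cos θ + d.2 * Real.sin θ) + φ * leadingDeriv f w θ) 0 := by
  have h0 : HasDerivAt (fun τ : ℝ => θ + τ * φ) φ 0 := by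
    simpa using ((hasDerivAt_id (0 : ℝ)).mul_const φ).const_add θ
  have h1 : HasDerivAt (fun τ : ℝ => 2 * coeff f 2 0 * (w.1 + τ * d.1) + coeff f 3 0)
      (2 * coeff f 2 0 * d.1) 0 := by
    simpa using ((((hasDerivAt_id (0 : ℝ)).mul_const d.1).const_add w.1).const_mul
      (2 * coeff f 2 0)).add_const (coeff f 3 0)
  have h2 : HasDerivAt (fun τ : ℝ => 2 * coeff f 2 0 * (w.2 + τ * d.2) + coeff f 2 1)
      (2 * coeff f 2 0 * d.2) 0 := by
    simpa using ((((hasDerivAt_id (0 : ℝ)).mul_const d.2).const_add w.2).const_mul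
      (2 * coeff f 2 0)).add_const (coeff f 2 1)
  have h3 := ((h1.mul h0.cos).add (h2.mul h0.sin)).add
    ((h0.sin.pow 3).const_mul (coeff f 0 3 - coeff f 2 1))
  refine h3.congr_deriv ?_
  simp [leadingDeriv]
  ring

theorem hasDerivAt_leadingDeriv_line (w d : ℝ × ℝ) (θ φ : ℝ) :
    HasDerivAt (fun τ : ℝ => leadingDeriv f (w + τ • d) (θ + τ * φ))
      (2 * coeff f 2 0 * (-d.1 * Real.sin θ + d.2 * Real.cos θ) + φ * leadingDeriv₂ f w θ) 0 := by
  have h0 : HasDerivAt (fun τ : ℝ => θ + τ * φ) φ 0 := by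
    simpa using ((hasDerivAt_id (0 : ℝ)).mul_const φ).const_add θ
  have h1 : HasDerivAt (fun τ : ℝ => -(2 * coeff f 2 0 * (w.1 + τ * d.1) + coeff f 3 0))
      (-(2 * coeff f 2 0 * d.1)) 0 := by
    have := (((((hasDerivAt_id (0 : ℝ)).mul_const d.1).const_add w.1).const_mul
      (2 * coeff f 2 0)).add_const (coeff f 3 0)).fun_neg
    simpa only [id, one_mul] using this
  have h2 : HasDerivAt (fun τ : ℝ => 2 * coeff f 2 0 * (w.2 + τ * d.2) + coeff f 2 1)
      (2 * coeff f 2 0 * d.2) 0 := by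
    simpa using ((((hasDerivAt_id (0 : ℝ)).mul_const d.2).const_add w.2).const_mul
      (2 * coeff f 2 0)).add_const (coeff f 2 1)
  have h3 := ((h1.mul h0.sin).add (h2.mul h0.cos)).add
    (((h0.sin.pow 2).const_mul (3 * (coeff f 0 3 - coeff f 2 1))).mul h0.cos)
  refine h3.congr_deriv ?_
  simp [leadingDeriv₂]
  ring

theorem hasDerivAt_leading (w : ℝ × ℝ) (θ : ℝ) :
    HasDerivAt (leading f w) (leadingDeriv f w θ) θ := by
  have h := hasDerivAt_leading_line (f := f) w 0 θ 1
  simp only [smul_zero, add_zero, mul_one, Prod.fst_zero, Prod.snd_zero, zero_mul, mul_zero,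
    one_mul, zero_add] at h
  have h' : HasDerivAt (fun τ => leading f w (θ + τ)) (leadingDeriv f w θ) (θ - θ) := by
    rwa [sub_self]
  simpa using (h'.comp_sub_const θ θ)

theorem hasDerivAt_leadingDeriv (w : ℝ × ℝ) (θ : ℝ) :
    HasDerivAt (leadingDeriv f w) (leadingDeriv₂ f w θ) θ := by
  have h := hasDerivAt_leadingDeriv_line (f := f) w 0 θ 1
  simp only [smul_zero, add_zero, mul_one, Prod.fst_zero, Prod.snd_zero, neg_zero, zero_mul,
    mul_zero, one_mul, zero_add] at h
  have h' : HasDerivAt (fun τ => leadingDeriv f w (θ + τ)) (leadingDeriv₂ f w θ) (θ - θ) := by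
    rwa [sub_self]
  simpa using (h'.comp_sub_const θ θ)

/-- The expansion of `f` on small circles about points near an umbilic. -/
theorem exists_umbilic_expansion (hf : ContDiff ℝ (10 : ℕ) f) (h00 : coeff f 0 0 = 0)
    (h10 : coeff f 1 0 = 0) (h01 : coeff f 0 1 = 0) (hu : coeff f 2 0 = coeff f 0 2)
    (h11 : coeff f 1 1 = 0) (hb : coeff f 3 0 = coeff f 1 2) :
    ∃ h : ((ℝ × ℝ) × ℝ) × ℝ → ℝ, ContDiff ℝ (7 : ℕ) h ∧
      (∀ w θ R, f (circlePoint (R ^ 2 • w) R θ) = coeff f 2 0 * R ^ 2 + R ^ 3 * h ((w, θ), R)) ∧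
      ∀ w θ, h ((w, θ), 0) = leading f w θ := by
  obtain ⟨h, hh, -, hexp⟩ := exists_taylor 7 3 (E := (ℝ × ℝ) × ℝ)
    (F := fun q => f (circlePoint (q.2 ^ 2 • q.1.1) q.2 q.1.2)) (by
      refine hf.comp ?_
      simp only [circlePoint, Prod.smul_fst, Prod.smul_snd, smul_eq_mul]
      fun_prop)
  have key : ∀ w θ, (∀ R, f (circlePoint (R ^ 2 • w) R θ) =
      coeff f 2 0 * R ^ 2 + R ^ 3 * h ((w, θ), R)) ∧ h ((w, θ), 0) = leading f w θ := by
    intro w θ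
    set x := Real.cos θ with hx
    set y := Real.sin θ with hy
    have hxy : x ^ 2 + y ^ 2 = 1 := Real.cos_sq_add_sin_sq θ
    have hγ : ∀ R, circlePoint (R ^ 2 • w) R θ =
        (R * (x + R * w.1), R * (y + R * w.2)) := fun R => by
      ext <;> simp only [circlePoint, Prod.smul_fst, Prod.smul_snd, smul_eq_mul, hx, hy] <;> ring
    have hO : (fun R : ℝ => circlePoint (R ^ 2 • w) R θ) =O[𝓝[≠] 0] fun R => R := by
      have h1 : ∀ g : ℝ → ℝ, Continuous g → (fun s => s * g s) =O[𝓝[≠] 0] fun s => s := by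
        intro g hg
        have := (Asymptotics.isBigO_refl (fun s : ℝ => s) (𝓝[≠] 0)).mul
          (((hg.tendsto 0).mono_left nhdsWithin_le_nhds).isBigO_one ℝ)
        simpa using this
      rw [funext hγ]
      exact (h1 _ (by fun_prop)).prod_left (h1 _ (by fun_prop))
    have h1 := (taylor_comp_isBigO hf h00 h10 h01 hO).trans (isBigO_pow_pow (n := 4) (by norm_num))
    set a : ℕ → ℝ := fun j =>
      iteratedDeriv j (fun R => f (circlePoint (R ^ 2 • w) R θ)) 0 / (j.factorial : ℝ) with ha
    obtain ⟨h2, h3⟩ := eq_zero_of_isBigO_pow 3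
      (c := fun j => if j = 2 then a 2 - coeff f 2 0 else a j)
      (k := fun R => h ((w, θ), R) - (2 * coeff f 2 0 * (w.1 * x + w.2 * y) +
        coeff f 2 0 * R * (w.1 ^ 2 + w.2 ^ 2) + cubicPart f (x + R * w.1) (y + R * w.2) +
        R * quarticPart f (x + R * w.1) (y + R * w.2)))
      (by
        have := hh.continuous
        unfold cubicPart quarticPart
        fun_prop)
      (h1.congr_left fun R => by
        have := hexp (w, θ) R
        simp only [Finset.sum_range_succ, Finset.sum_range_zero] at this
        rw [this, hγ]
        simp [Finset.sum_range_succ, quadPart, cubicPart, quarticPart, ← hu, h11, ha]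
        linear_combination (-(coeff f 2 0 * R ^ 2)) * hxy)
    have e0 : a 0 = 0 := by simpa using h2 0 (by norm_num)
    have e1 : a 1 = 0 := by simpa using h2 1 (by norm_num)
    have e2 : a 2 = coeff f 2 0 := by
      have := h2 2 (by norm_num)
      simp only [if_true] at this
      linarith
    refine ⟨fun R => ?_, ?_⟩
    · have := hexp (w, θ) R
      simp only [Finset.sum_range_succ, Finset.sum_range_zero] at this
      rw [this]
      simp only [ha] at e0 e1 e2
      rw [e0, e1, e2]
      ring
    · simp only [cubicPart, ← hb] at h3
      simp only [leading, ← hx, ← hy]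
      linear_combination h3 + (coeff f 3 0 * x + coeff f 2 1 * y) * hxy
  exact ⟨h, hh, fun w θ => (key w θ).1, fun w θ => (key w θ).2⟩

variable {h : ((ℝ × ℝ) × ℝ) × ℝ → ℝ}

/-- The derivative with respect to the angle of a function of (centre, angle, radius). -/
def angleDeriv (h : ((ℝ × ℝ) × ℝ) × ℝ → ℝ) (q : ((ℝ × ℝ) × ℝ) × ℝ) : ℝ :=
  fderiv ℝ h q ((0, 1), 0)

theorem contDiff_angleDeriv {n : ℕ} (hh : ContDiff ℝ (n + 1 : ℕ) h) :
    ContDiff ℝ n (angleDeriv h) := by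
  push_cast at hh
  exact (hh.fderiv_right le_rfl).clm_apply contDiff_const

theorem hasDerivAt_angle (hh : ContDiff ℝ 1 h) (w : ℝ × ℝ) (θ R : ℝ) :
    HasDerivAt (fun θ => h ((w, θ), R)) (angleDeriv h ((w, θ), R)) θ := by
  have h1 : HasFDerivAt h (fderiv ℝ h ((w, θ), R)) ((w, θ), R) :=
    (hh.differentiable one_ne_zero _).hasFDerivAt
  have h2 : HasDerivAt (fun θ : ℝ => ((w, θ), R)) (((0 : ℝ × ℝ), (1 : ℝ)), (0 : ℝ)) θ :=
    ((hasDerivAt_const θ w).prodMk (hasDerivAt_id θ)).prodMk (hasDerivAt_const θ R)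
  exact h1.comp_hasDerivAt θ h2

theorem angleDeriv_zero (hh : ContDiff ℝ 1 h) (h0 : ∀ w θ, h ((w, θ), 0) = leading f w θ)
    (w : ℝ × ℝ) (θ : ℝ) : angleDeriv h ((w, θ), 0) = leadingDeriv f w θ := by
  have := hasDerivAt_angle hh w θ 0
  simp only [h0] at this
  exact this.unique (hasDerivAt_leading w θ)

theorem angleDeriv_angleDeriv_zero (hh : ContDiff ℝ (2 : ℕ) h)
    (h0 : ∀ w θ, h ((w, θ), 0) = leading f w θ) (w : ℝ × ℝ) (θ : ℝ) :
    angleDeriv (angleDeriv h) ((w, θ), 0) = leadingDeriv₂ f w θ := by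
  have h1 : ContDiff ℝ (1 : ℕ) (angleDeriv h) := contDiff_angleDeriv hh
  have := hasDerivAt_angle (by exact_mod_cast h1) w θ 0
  simp only [angleDeriv_zero (hh.of_le (by norm_cast)) h0] at this
  exact this.unique (hasDerivAt_leadingDeriv w θ)

end UmbilicExpansion

/-! ### Three points on the unit circle -/

section CirclePoints

/-- Three distinct points of the unit circle are not collinear. -/
theorem det_ne_zero_of_unit {x y : Fin 3 → ℝ} (hxy : ∀ i, x i ^ 2 + y i ^ 2 = 1)
    (hne : ∀ i j, i ≠ j → x i ≠ x j ∨ y i ≠ y j) :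
    (x 1 - x 0) * (y 2 - y 0) - (x 2 - x 0) * (y 1 - y 0) ≠ 0 := by
  intro h
  have key : ∀ a b : Fin 3, a ≠ b → 0 < (x a - x b) ^ 2 + (y a - y b) ^ 2 := by
    intro a b hab
    rcases hne a b hab with h | h
    · have := sub_ne_zero.2 h; positivity
    · have := sub_ne_zero.2 h; positivity
  have e0 := hxy 0
  have e1 := hxy 1
  have e2 := hxy 2
  -- for parallel chords `a`, `b` from the first point, `|a| ^ 2 = a · b = |b| ^ 2`
  have h1 : (x 2 - x 0) ^ 2 + (y 2 - y 0) ^ 2 =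
      (x 1 - x 0) * (x 2 - x 0) + (y 1 - y 0) * (y 2 - y 0) := by
    refine mul_right_cancel₀ (key 1 0 (by decide)).ne' ?_
    linear_combination ((x 1 - x 0) ^ 2 + (y 1 - y 0) ^ 2) * (e2 - e0) -
      ((x 1 - x 0) * (x 2 - x 0) + (y 1 - y 0) * (y 2 - y 0)) * (e1 - e0) +
      2 * (x 0 * (y 1 - y 0) - y 0 * (x 1 - x 0)) * h
  have h2 : (x 1 - x 0) ^ 2 + (y 1 - y 0) ^ 2 =
      (x 1 - x 0) * (x 2 - x 0) + (y 1 - y 0) * (y 2 - y 0) := by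
    refine mul_right_cancel₀ (key 2 0 (by decide)).ne' ?_
    linear_combination ((x 2 - x 0) ^ 2 + (y 2 - y 0) ^ 2) * (e1 - e0) -
      ((x 1 - x 0) * (x 2 - x 0) + (y 1 - y 0) * (y 2 - y 0)) * (e2 - e0) -
      2 * (x 0 * (y 2 - y 0) - y 0 * (x 2 - x 0)) * h
  have h3 := key 2 1 (by decide)
  nlinarith

end CirclePoints

/-! ### Three double zeros and the special triples -/

section SpecialTriples

open Polynomial

/-- A monic polynomial of degree six without terms of degree five and one, with three distinct
double roots and constant term `-1`, is `(X ^ 3 - e) ^ 2` with `e ^ 2 = -1`. -/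
theorem cube_eq_of_double_roots {l m n : ℂ} {a : Fin 3 → ℂ} (ha : Function.Injective a)
    (h0 : ∀ i, a i ^ 6 + l * a i ^ 4 + m * a i ^ 3 + n * a i ^ 2 - 1 = 0)
    (h1 : ∀ i, 6 * a i ^ 5 + 4 * l * a i ^ 3 + 3 * m * a i ^ 2 + 2 * n * a i = 0) :
    ∃ e : ℂ, e ^ 2 = -1 ∧ ∀ i, a i ^ 3 = e := by
  let p : ℂ[X] := X ^ 6 + C l * X ^ 4 + C m * X ^ 3 + C n * X ^ 2 - 1
  have hpm : p.Monic := by simp only [p]; monicity!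
  have hpd : p.natDegree = 6 := by simp only [p]; compute_degree!
  have hdvd : ∀ i, (X - C (a i)) ^ 2 ∣ p := by
    intro i
    refine (le_rootMultiplicity_iff hpm.ne_zero).1
      ((one_lt_rootMultiplicity_iff_isRoot hpm.ne_zero).2 ⟨?_, ?_⟩)
    · simp only [IsRoot.def, p]
      simpa using h0 i
    · simp only [IsRoot.def, p]
      simp
      linear_combination h1 i
  have hcop : Pairwise fun i j => IsCoprime ((X - C (a i)) ^ 2) ((X - C (a j)) ^ 2) :=
    fun i j hij => (pairwise_coprime_X_sub_C ha hij).pow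
  have hprod : ∏ i, (X - C (a i)) ^ 2 ∣ p := Fintype.prod_dvd_of_coprime hcop hdvd
  have hqm : (∏ i, (X - C (a i)) ^ 2).Monic := monic_prod_of_monic _ _ fun i _ =>
    (monic_X_sub_C _).pow 2
  have heq : p = ∏ i, (X - C (a i)) ^ 2 := by
    refine (eq_of_monic_of_dvd_of_natDegree_le hqm hpm hprod ?_)
    rw [hpd, natDegree_prod_of_monic _ _ fun i _ => (monic_X_sub_C _).pow 2]
    simp [natDegree_pow]
  -- Vieta: `e₁ = 0` and `e₂ * e₃ = 0`, where `e₃ ≠ 0`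
  rw [Fin.prod_univ_three] at heq
  set e₁ := a 0 + a 1 + a 2 with he₁
  set e₂ := a 0 * a 1 + a 0 * a 2 + a 1 * a 2 with he₂
  set e₃ := a 0 * a 1 * a 2 with he₃
  have hexp : (X - C (a 0)) ^ 2 * (X - C (a 1)) ^ 2 * (X - C (a 2)) ^ 2 =
      X ^ 6 + C (-2 * e₁) * X ^ 5 + C (e₁ ^ 2 + 2 * e₂) * X ^ 4 + C (-2 * (e₁ * e₂ + e₃)) * X ^ 3 +
        C (e₂ ^ 2 + 2 * e₁ * e₃) * X ^ 2 + C (-2 * e₂ * e₃) * X + C (e₃ ^ 2) := by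
    simp only [he₁, he₂, he₃, C_add, C_mul, C_pow, C_neg, C_ofNat]
    ring
  rw [hexp] at heq
  have hcoef : ∀ k₅ k₄ k₃ k₂ k₁ k₀ : ℂ, p = X ^ 6 + C k₅ * X ^ 5 + C k₄ * X ^ 4 + C k₃ * X ^ 3 +
      C k₂ * X ^ 2 + C k₁ * X + C k₀ → k₅ = 0 ∧ k₁ = 0 ∧ k₀ = -1 := by
    intro k₅ k₄ k₃ k₂ k₁ k₀ h
    have c5 := congrArg (fun q : ℂ[X] => q.coeff 5) h
    have c1 := congrArg (fun q : ℂ[X] => q.coeff 1) h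
    have c0 := congrArg (fun q : ℂ[X] => q.coeff 0) h
    simp [p, coeff_X, coeff_one, coeff_C, coeff_X_pow] at c5 c1 c0
    exact ⟨c5.symm, c1.symm, c0.symm⟩
  obtain ⟨c5, c1, hs3⟩ := hcoef _ _ _ _ _ _ heq
  have hs3' : e₃ ≠ 0 := by
    intro h; rw [h] at hs3; norm_num at hs3
  have hs2 : e₂ = 0 := by simpa [hs3'] using c1
  refine ⟨e₃, hs3, fun i => ?_⟩
  have hroot : a i ^ 3 - e₁ * a i ^ 2 + e₂ * a i - e₃ = 0 := by
    fin_cases i <;> simp only [he₁, he₂, he₃] <;> simp <;> ring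
  linear_combination hroot - a i ^ 2 / 2 * c5 - a i * hs2

/-- Three distinct double zeros of `θ ↦ α cos θ + β sin θ + sin³ θ - γ` on the unit circle are the
vertices of one of two equilateral triangles. -/
theorem unit_points_of_double_zeros {α β γ : ℝ} {x y : Fin 3 → ℝ} (hxy : ∀ i, x i ^ 2 + y i ^ 2 = 1)
    (hne : Function.Injective fun i => (x i, y i))
    (h0 : ∀ i, α * x i + β * y i + y i ^ 3 = γ)
    (h1 : ∀ i, -α * y i + β * x i + 3 * y i ^ 2 * x i = 0) :
    ∃ ε : ℝ, ε ^ 2 = 1 ∧ ∀ i, x i ^ 3 - 3 * x i * y i ^ 2 = 0 ∧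
      3 * x i ^ 2 * y i - y i ^ 3 = ε := by
  set a : Fin 3 → ℂ := fun i => (x i : ℂ) + y i * Complex.I with ha
  have hI := Complex.I_sq
  have hainj : Function.Injective a := by
    intro i j hij
    refine hne (Prod.ext ?_ ?_)
    · simpa [ha] using congrArg Complex.re hij
    · simpa [ha] using congrArg Complex.im hij
  have hc : ∀ i, ((x i : ℂ)) ^ 2 + (y i : ℂ) ^ 2 = 1 := fun i => by exact_mod_cast hxy i
  -- `x = (a + b) / 2` and `y = (a - b) / (2 i)` with `a b = 1`
  have hab : ∀ i, a i * ((x i : ℂ) - y i * Complex.I) = 1 := fun i => by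
    simp only [ha]
    linear_combination hc i - (y i : ℂ) ^ 2 * hI
  have hh0 : ∀ i, (α : ℂ) * x i + β * y i + (y i : ℂ) ^ 3 = γ := fun i => by exact_mod_cast h0 i
  have hh1 : ∀ i, -(α : ℂ) * y i + β * x i + 3 * (y i : ℂ) ^ 2 * x i = 0 := fun i => by
    exact_mod_cast h1 i
  -- coefficients of the polynomial in `exp (i θ)` that arises from the factor `-8 i exp (3 i θ)`
  set A : ℂ := (4 * β + 3) + 4 * α * Complex.I with hA
  set B : ℂ := (4 * β + 3) - 4 * α * Complex.I with hB
  have hpoly : ∀ i, a i ^ 6 + (-A) * a i ^ 4 + (8 * Complex.I * γ) * a i ^ 3 + B * a i ^ 2 - 1 = 0 ∧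
      6 * a i ^ 5 + 4 * (-A) * a i ^ 3 + 3 * (8 * Complex.I * γ) * a i ^ 2 + 2 * B * a i = 0 := by
    intro i
    set b : ℂ := (x i : ℂ) - y i * Complex.I with hb
    have hx2 : (x i : ℂ) = (a i + b) / 2 := by simp only [ha, hb]; ring
    have hy2 : (y i : ℂ) = (b - a i) * Complex.I / 2 := by
      simp only [ha, hb]; linear_combination (y i : ℂ) * hI
    have e := hab i
    have g0 := hh0 i
    have g1 := hh1 i
    rw [hx2, hy2] at g0 g1
    have e1 : a i * (b - a i) = 1 - a i ^ 2 := by linear_combination e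
    have e2 : a i * (a i + b) = a i ^ 2 + 1 := by linear_combination e
    have ha0 : a i ≠ 0 := left_ne_zero_of_mul_eq_one e
    have g0' : α * a i ^ 2 * (a i ^ 2 + 1) / 2 + β * a i ^ 2 * (1 - a i ^ 2) * Complex.I / 2 +
        (1 - a i ^ 2) ^ 3 * Complex.I ^ 3 / 8 - a i ^ 3 * γ = 0 := by
      rw [← e1, ← e2]; linear_combination a i ^ 3 * g0
    have g1' : -α * a i ^ 2 * (1 - a i ^ 2) * Complex.I / 2 + β * a i ^ 2 * (a i ^ 2 + 1) / 2 +
        3 * (1 - a i ^ 2) ^ 2 * Complex.I ^ 2 * (a i ^ 2 + 1) / 8 = 0 := by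
      rw [← e1, ← e2]; linear_combination a i ^ 3 * g1
    have hp : a i ^ 6 + (-A) * a i ^ 4 + (8 * Complex.I * γ) * a i ^ 3 + B * a i ^ 2 - 1 = 0 := by
      simp only [hA, hB]
      linear_combination (-8 * Complex.I) * g0' + ((1 - a i ^ 2) ^ 3 * (Complex.I ^ 2 - 1) +
        4 * β * a i ^ 2 * (1 - a i ^ 2)) * hI
    refine ⟨hp, mul_left_cancel₀ ha0 ?_⟩
    simp only [hA, hB] at hp ⊢
    linear_combination 3 * hp - 8 * g1' + 3 * (1 - a i ^ 2) ^ 2 * (1 + a i ^ 2) * hI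
  obtain ⟨e, he, hcube⟩ := cube_eq_of_double_roots hainj (fun i => (hpoly i).1)
    (fun i => (hpoly i).2)
  obtain ⟨ε, hε, rfl⟩ : ∃ ε : ℝ, ε ^ 2 = 1 ∧ e = ε * Complex.I := by
    have : (e - Complex.I) * (e + Complex.I) = 0 := by linear_combination he - hI
    rcases mul_eq_zero.1 this with h | h
    · exact ⟨1, by norm_num, by simpa using sub_eq_zero.1 h⟩
    · exact ⟨-1, by norm_num, by simpa using eq_neg_of_add_eq_zero_left h⟩
  refine ⟨ε, hε, fun i => ?_⟩
  have h3 : a i ^ 3 = ((x i ^ 3 - 3 * x i * y i ^ 2 : ℝ) : ℂ) +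
      ((3 * x i ^ 2 * y i - y i ^ 3 : ℝ) : ℂ) * Complex.I := by
    simp only [ha]; push_cast
    linear_combination (3 * (x i : ℂ) * (y i : ℂ) ^ 2 + (y i : ℂ) ^ 3 * Complex.I) * hI
  rw [hcube i] at h3
  constructor
  · simpa [-Complex.ofReal_sub, -Complex.ofReal_mul, -Complex.ofReal_pow] using
      (congrArg Complex.re h3).symm
  · simpa [-Complex.ofReal_sub, -Complex.ofReal_mul, -Complex.ofReal_pow] using
      (congrArg Complex.im h3).symm

theorem angle_eq_of_cos_sin {s t : Real.Angle} (hc : s.cos = t.cos) (hs : s.sin = t.sin) :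
    s = t := by
  rw [← Real.Angle.coe_toReal s, ← Real.Angle.coe_toReal t] at hc hs ⊢
  exact Real.Angle.cos_sin_inj (by simpa using hc) (by simpa using hs)

theorem cos_sin_baseAngles :
    ((baseAngles 0).cos = 0 ∧ (baseAngles 0).sin = 1) ∧
    ((baseAngles 1).cos = Real.sqrt 3 / 2 ∧ (baseAngles 1).sin = -(1 / 2)) ∧
    ((baseAngles 2).cos = -(Real.sqrt 3 / 2) ∧ (baseAngles 2).sin = -(1 / 2)) := by
  have h5 : -(5 * Real.pi / 6) = Real.pi / 6 - Real.pi := by ring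
  refine ⟨⟨?_, ?_⟩, ⟨?_, ?_⟩, ?_, ?_⟩ <;> simp [baseAngles, h5]

/-- The angles with `sin 3 t = -1`. -/
theorem exists_baseAngle {t : Real.Angle} (h : 3 * t.cos ^ 2 * t.sin - t.sin ^ 3 = -1) :
    ∃ j, t = baseAngles j := by
  obtain ⟨⟨c0, s0⟩, ⟨c1, s1⟩, c2, s2⟩ := cos_sin_baseAngles
  have hcs : t.cos ^ 2 + t.sin ^ 2 = 1 := Real.Angle.cos_sq_add_sin_sq t
  have hf : (t.sin - 1) * (2 * t.sin + 1) ^ 2 = 0 := by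
    linear_combination -h + 3 * t.sin * hcs
  rcases mul_eq_zero.1 hf with h1 | h1
  · have hs : t.sin = 1 := by linarith
    have hc : t.cos = 0 := by
      rw [hs] at hcs
      exact pow_eq_zero_iff two_ne_zero |>.1 (by linarith)
    exact ⟨0, angle_eq_of_cos_sin (by rw [hc, c0]) (by rw [hs, s0])⟩
  · have hs : t.sin = -(1 / 2) := by
      have := pow_eq_zero_iff two_ne_zero |>.1 h1
      linarith
    have h3 : Real.sqrt 3 * Real.sqrt 3 = 3 := Real.mul_self_sqrt (by norm_num)
    have hc : (t.cos - Real.sqrt 3 / 2) * (t.cos + Real.sqrt 3 / 2) = 0 := by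
      rw [hs] at hcs
      linear_combination hcs - h3 / 4
    rcases mul_eq_zero.1 hc with h2 | h2
    · exact ⟨1, angle_eq_of_cos_sin (by rw [c1]; linarith) (by rw [hs, s1])⟩
    · exact ⟨2, angle_eq_of_cos_sin (by rw [c2]; linarith) (by rw [hs, s2])⟩

/-- Distinct angles with the same value `1` or `-1` of `sin 3 t` form a special triple. -/
theorem isSpecialTriple_of_sin_three {t : Fin 3 → Real.Angle} (ht : Function.Injective t) {ε : ℝ}
    (hε : ε ^ 2 = 1) (h : ∀ i, 3 * (t i).cos ^ 2 * (t i).sin - (t i).sin ^ 3 = ε) :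
    IsSpecialTriple t := by
  have key : ∀ s : Fin 3 → Real.Angle, Function.Injective s → (∀ i, ∃ j, s i = baseAngles j) →
      ∃ σ : Equiv.Perm (Fin 3), ∀ i, s (σ i) = baseAngles i := by
    intro s hs hex
    choose σ hσ using hex
    have hinj : Function.Injective σ := fun i j hij => hs (by rw [hσ, hσ, hij])
    let e : Equiv.Perm (Fin 3) := Equiv.ofBijective σ (Finite.injective_iff_bijective.1 hinj)
    refine ⟨e.symm, fun i => ?_⟩
    rw [hσ]
    exact congrArg baseAngles (e.apply_symm_apply i)
  have hpi : ((Real.pi : ℝ) : Real.Angle) + ((Real.pi : ℝ) : Real.Angle) = 0 :=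
    Real.Angle.coe_pi_add_coe_pi
  rcases (show ε = 1 ∨ ε = -1 by simpa using hε) with rfl | rfl
  · obtain ⟨σ, hσ⟩ := key (fun i => t i + ((Real.pi : ℝ) : Real.Angle))
      (fun i j hij => ht (add_right_cancel hij)) fun i => exists_baseAngle (by
        rw [Real.Angle.cos_add_pi, Real.Angle.sin_add_pi]
        linear_combination -(h i))
    refine ⟨σ, Or.inr fun i => ?_⟩
    rw [← hσ, add_assoc, hpi, add_zero]
  · obtain ⟨σ, hσ⟩ := key t ht fun i => exists_baseAngle (h i)
    exact ⟨σ, Or.inl hσ⟩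

/-- At the angles of a special triple, `cos 3 t = 0`, and `sin 3 t` has a common nonzero value. -/
theorem IsSpecialTriple.exists_sin_three {t : Fin 3 → Real.Angle} (h : IsSpecialTriple t) :
    Function.Injective t ∧ ∃ ε : ℝ, ε ≠ 0 ∧ ∀ i, 4 * (t i).cos ^ 3 - 3 * (t i).cos = 0 ∧
      3 * (t i).sin - 4 * (t i).sin ^ 3 = ε := by
  obtain ⟨⟨c0, s0⟩, ⟨c1, s1⟩, c2, s2⟩ := cos_sin_baseAngles
  have h3 : Real.sqrt 3 * Real.sqrt 3 = 3 := Real.mul_self_sqrt (by norm_num)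
  have h3' : Real.sqrt 3 ≠ 0 := by positivity
  have hbase : ∀ i, 4 * (baseAngles i).cos ^ 3 - 3 * (baseAngles i).cos = 0 ∧
      3 * (baseAngles i).sin - 4 * (baseAngles i).sin ^ 3 = -1 := by
    intro i
    fin_cases i
    · simp only [Fin.zero_eta, c0, s0]; norm_num
    · simp only [Fin.mk_one, c1, s1]
      refine ⟨?_, by norm_num⟩
      linear_combination (Real.sqrt 3 / 2) * h3
    · simp only [Fin.reduceFinMk, c2, s2]
      refine ⟨?_, by norm_num⟩
      linear_combination (-(Real.sqrt 3 / 2)) * h3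
  have hbinj : Function.Injective baseAngles := by
    intro i j hij
    have hc := congrArg Real.Angle.cos hij
    have hs := congrArg Real.Angle.sin hij
    fin_cases i <;> fin_cases j <;>
      simp only [Fin.zero_eta, Fin.mk_one, Fin.reduceFinMk, c0, c1, c2, s0, s1, s2] at hc hs ⊢ <;>
      first | (exfalso; norm_num at hs; done) | (exfalso; apply h3'; linarith)
  obtain ⟨σ, hσ | hσ⟩ := h
  · refine ⟨fun i j hij => ?_, -1, by norm_num, fun i => ?_⟩
    · have := hbinj (a₁ := σ.symm i) (a₂ := σ.symm j) (by rw [← hσ, ← hσ]; simpa using hij)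
      simpa using this
    · have := hbase (σ.symm i)
      rw [← hσ] at this
      simpa using this
  · refine ⟨fun i j hij => ?_, 1, by norm_num, fun i => ?_⟩
    · have := hbinj (a₁ := σ.symm i) (a₂ := σ.symm j)
        (add_right_cancel (b := ((Real.pi : ℝ) : Real.Angle)) (by
          rw [← hσ, ← hσ]; simpa using hij))
      simpa using this
    · have h1 := hσ (σ.symm i)
      rw [Equiv.apply_symm_apply] at h1
      have h2 := hbase (σ.symm i)
      rw [h1, Real.Angle.cos_add_pi, Real.Angle.sin_add_pi]
      constructor
      · linear_combination -h2.1
      · linear_combination -h2.2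

end SpecialTriples

/-! ### Limiting directions at an umbilic -/

section UmbilicLimits

variable {f : ℝ × ℝ → ℝ}

theorem norm_le_sqrt (p : ℝ × ℝ) : ‖p‖ ≤ Real.sqrt (p.1 ^ 2 + p.2 ^ 2) := by
  rw [Prod.norm_def]
  exact max_le (Real.abs_le_sqrt (by nlinarith [sq_nonneg p.2]))
    (Real.abs_le_sqrt (by nlinarith [sq_nonneg p.1]))

/-- At an umbilic, `f` is a multiple of the squared Euclidean distance up to terms of third order.
(The norm on `ℝ × ℝ` is the maximum norm.) -/
theorem umbilic_isBigO (hf : ContDiff ℝ (10 : ℕ) f) (h00 : coeff f 0 0 = 0)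
    (h10 : coeff f 1 0 = 0) (h01 : coeff f 0 1 = 0) (hu : coeff f 2 0 = coeff f 0 2)
    (h11 : coeff f 1 1 = 0) :
    (fun p : ℝ × ℝ => f p - coeff f 2 0 * Real.sqrt (p.1 ^ 2 + p.2 ^ 2) ^ 2) =O[𝓝 0]
      fun p => Real.sqrt (p.1 ^ 2 + p.2 ^ 2) ^ 3 := by
  have h1 : (fun p : ℝ × ℝ => ‖p‖ ^ 3) =O[𝓝 0] fun p => Real.sqrt (p.1 ^ 2 + p.2 ^ 2) ^ 3 :=
    Asymptotics.IsBigO.of_bound 1 (Eventually.of_forall fun p => by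
      rw [one_mul, norm_pow, norm_pow, norm_norm, Real.norm_of_nonneg (Real.sqrt_nonneg _)]
      exact pow_le_pow_left₀ (norm_nonneg _) (norm_le_sqrt p) 3)
  refine Asymptotics.IsBigO.trans ?_ h1
  have hm : ∀ (c : ℝ) (i j : ℕ), 3 ≤ i + j → (fun p : ℝ × ℝ => p.1 ^ i * p.2 ^ j * c) =O[𝓝 0]
      fun p => ‖p‖ ^ 3 := fun c i j h => isBigO_monomial_mul (k := fun _ => c) continuous_const h
  have h5 : (fun p : ℝ × ℝ => ‖p‖ ^ 5) =O[𝓝 0] fun p => ‖p‖ ^ 3 := by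
    have := (Asymptotics.isLittleO_pow_pow (𝕜 := ℝ) (show 3 < 5 by norm_num)).isBigO.comp_tendsto
      (continuous_norm.tendsto' (0 : ℝ × ℝ) 0 norm_zero)
    exact this
  have h := (((((((((taylor_isBigO hf h00 h10 h01).trans h5).add
    (hm (coeff f 3 0) 3 0 (by norm_num))).add (hm (coeff f 2 1) 2 1 (by norm_num))).add
    (hm (coeff f 1 2) 1 2 (by norm_num))).add (hm (coeff f 0 3) 0 3 (by norm_num))).add
    (hm (coeff f 4 0) 4 0 (by norm_num))).add (hm (coeff f 3 1) 3 1 (by norm_num))).add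
    ((hm (coeff f 2 2) 2 2 (by norm_num)).add (hm (coeff f 1 3) 1 3 (by norm_num)))).add
    (hm (coeff f 0 4) 0 4 (by norm_num))
  refine h.congr_left fun p => ?_
  rw [Real.sq_sqrt (by positivity)]
  simp only [quadPart, cubicPart, quarticPart, ← hu, h11]
  ring

/-- Points on a common isophote near an umbilic have nearly the same distance from it. -/
theorem exists_abs_sub_le_of_eq (hc : coeff f 2 0 ≠ 0)
    (hO : (fun p : ℝ × ℝ => f p - coeff f 2 0 * Real.sqrt (p.1 ^ 2 + p.2 ^ 2) ^ 2) =O[𝓝 0]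
      fun p => Real.sqrt (p.1 ^ 2 + p.2 ^ 2) ^ 3) :
    ∃ M : ℝ, ∀ᶠ q : (ℝ × ℝ) × (ℝ × ℝ) in 𝓝 0, f q.1 = f q.2 →
      |(q.1.1 ^ 2 + q.1.2 ^ 2) - (q.2.1 ^ 2 + q.2.2 ^ 2)| ≤
        M * Real.sqrt (q.2.1 ^ 2 + q.2.2 ^ 2) ^ 3 := by
  obtain ⟨C, hC, hbound⟩ := hO.exists_pos
  set c := coeff f 2 0 with hcdef
  have hc0 : 0 < |c| := abs_pos.2 hc
  refine ⟨9 * C / |c|, ?_⟩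
  have hsmall : ∀ᶠ p : ℝ × ℝ in 𝓝 0, C * Real.sqrt (p.1 ^ 2 + p.2 ^ 2) ≤ |c| / 2 := by
    have h1 : Continuous fun p : ℝ × ℝ => C * Real.sqrt (p.1 ^ 2 + p.2 ^ 2) := by fun_prop
    have h2 := h1.tendsto 0
    simp only [Prod.fst_zero, Prod.snd_zero] at h2
    norm_num at h2
    exact h2.eventually_le_const (by positivity)
  have hgood := hbound.bound.and hsmall
  have hfst : Tendsto (fun q : (ℝ × ℝ) × (ℝ × ℝ) => q.1) (𝓝 0) (𝓝 0) :=
    continuous_fst.tendsto' _ _ rfl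
  have hsnd : Tendsto (fun q : (ℝ × ℝ) × (ℝ × ℝ) => q.2) (𝓝 0) (𝓝 0) :=
    continuous_snd.tendsto' _ _ rfl
  filter_upwards [hfst.eventually hgood, hsnd.eventually hgood] with q ⟨h1, h2⟩ ⟨h3, h4⟩ heq
  set r := Real.sqrt (q.1.1 ^ 2 + q.1.2 ^ 2) with hr
  set ρ := Real.sqrt (q.2.1 ^ 2 + q.2.2 ^ 2) with hρ
  have hr0 : 0 ≤ r := Real.sqrt_nonneg _
  have hρ0 : 0 ≤ ρ := Real.sqrt_nonneg _
  rw [← Real.sq_sqrt (show 0 ≤ q.1.1 ^ 2 + q.1.2 ^ 2 by positivity), ← hr,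
    ← Real.sq_sqrt (show 0 ≤ q.2.1 ^ 2 + q.2.2 ^ 2 by positivity), ← hρ]
  simp only [Real.norm_eq_abs, abs_of_nonneg (pow_nonneg hr0 3),
    abs_of_nonneg (pow_nonneg hρ0 3)] at h1 h3
  rw [heq] at h1
  have e : |c| * |r ^ 2 - ρ ^ 2| ≤ C * r ^ 3 + C * ρ ^ 3 := by
    rw [← abs_mul]
    calc |c * (r ^ 2 - ρ ^ 2)| = |(f q.2 - c * ρ ^ 2) - (f q.2 - c * r ^ 2)| := by ring_nf
      _ ≤ |f q.2 - c * ρ ^ 2| + |f q.2 - c * r ^ 2| := abs_sub _ _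
      _ ≤ _ := by linarith
  have hr3 : C * r ^ 3 ≤ |c| / 2 * r ^ 2 := by
    calc C * r ^ 3 = C * r * r ^ 2 := by ring
      _ ≤ _ := by gcongr
  have hρ3 : C * ρ ^ 3 ≤ |c| / 2 * ρ ^ 2 := by
    calc C * ρ ^ 3 = C * ρ * ρ ^ 2 := by ring
      _ ≤ _ := by gcongr
  have hle : r ≤ 2 * ρ := by
    have h5 : |c| * (r ^ 2 - ρ ^ 2) ≤ |c| / 2 * r ^ 2 + |c| / 2 * ρ ^ 2 :=
      (mul_le_mul_of_nonneg_left (le_abs_self _) hc0.le).trans (by linarith)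
    have h6 : |c| * r ^ 2 ≤ |c| * (3 * ρ ^ 2) := by linarith
    have h7 := le_of_mul_le_mul_left h6 hc0
    nlinarith
  have h8 : r ^ 3 ≤ 8 * ρ ^ 3 := by
    calc r ^ 3 ≤ (2 * ρ) ^ 3 := pow_le_pow_left₀ hr0 hle 3
      _ = _ := by ring
  rw [div_mul_eq_mul_div, le_div_iff₀ hc0]
  nlinarith

/-- The centre of the circle through three points of an isophote near an umbilic, with distinct
limiting directions, is of second order in their distance from the umbilic. Along an ultrafilter,
all rescaled quantities converge. -/
theorem exists_rescaled_limit {ι : Type} (l : Ultrafilter ι) {p : Fin 3 → ι → ℝ × ℝ}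
    {z : ι → ℝ × ℝ} {R : ι → ℝ} {t : Fin 3 → Real.Angle} (hc : coeff f 2 0 ≠ 0)
    (hO : (fun p : ℝ × ℝ => f p - coeff f 2 0 * Real.sqrt (p.1 ^ 2 + p.2 ^ 2) ^ 2) =O[𝓝 0]
      fun p => Real.sqrt (p.1 ^ 2 + p.2 ^ 2) ^ 3)
    (ht : Function.Injective t) (hp : ∀ i, TendsToOriginAlong (l : Filter ι) (p i) (t i))
    (hf : ∀ i, ∀ᶠ s in (l : Filter ι), f (p i s) = f (p 0 s))
    (hR : ∀ᶠ s in (l : Filter ι), 0 < R s) (hcirc : ∀ i, ∀ᶠ s in (l : Filter ι),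
      ((p i s).1 - (z s).1) ^ 2 + ((p i s).2 - (z s).2) ^ 2 = R s ^ 2) :
    Tendsto R l (𝓝 0) ∧ (∃ w : ℝ × ℝ, Tendsto (fun s => (R s ^ 2)⁻¹ • z s) l (𝓝 w)) ∧
      ∀ i, Tendsto (fun s => ((p i s).1 - (z s).1) / R s) l (𝓝 (t i).cos) ∧
        Tendsto (fun s => ((p i s).2 - (z s).2) / R s) l (𝓝 (t i).sin) := by
  set ρ : Fin 3 → ι → ℝ := fun i s => Real.sqrt ((p i s).1 ^ 2 + (p i s).2 ^ 2) with hρ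
  have hρsq : ∀ i s, ρ i s ^ 2 = (p i s).1 ^ 2 + (p i s).2 ^ 2 := fun i s =>
    Real.sq_sqrt (by positivity)
  have hρnn : ∀ i s, 0 ≤ ρ i s := fun i s => Real.sqrt_nonneg _
  have hρ0 : Tendsto (ρ 0) l (𝓝 0) := by
    have h1 : Continuous fun q : ℝ × ℝ => Real.sqrt (q.1 ^ 2 + q.2 ^ 2) := by fun_prop
    have h2 := (h1.tendsto' (0 : ℝ × ℝ) 0 (by simp)).comp (hp 0).1
    exact h2
  have hρpos : ∀ᶠ s in (l : Filter ι), 0 < ρ 0 s := by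
    have h1 := ((hp 0).2.1.pow 2).add ((hp 0).2.2.pow 2)
    rw [Real.Angle.cos_sq_add_sin_sq] at h1
    filter_upwards [h1.eventually_const_lt (show (0 : ℝ) < 1 by norm_num)] with s hs
    refine lt_of_le_of_ne (hρnn 0 s) fun h0 => ?_
    simp only [hρ] at h0
    rw [← h0] at hs
    simp at hs
  -- differences of squared distances
  obtain ⟨M, hM⟩ := exists_abs_sub_le_of_eq hc hO
  have hdiff : ∀ i, ∀ᶠ s in (l : Filter ι), |ρ i s ^ 2 - ρ 0 s ^ 2| ≤ M * ρ 0 s ^ 3 := fun i => by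
    have h1 : Tendsto (fun s => (p i s, p 0 s)) l (𝓝 (0 : (ℝ × ℝ) × (ℝ × ℝ))) :=
      (hp i).1.prodMk_nhds (hp 0).1
    filter_upwards [h1.eventually hM, hf i] with s hs hfs
    rw [hρsq, hρsq]
    exact hs hfs
  -- the right-hand sides of the rescaled equations of the perpendicular bisectors
  have hβ : ∀ i, ∃ β, Tendsto (fun s => (ρ i s ^ 2 - ρ 0 s ^ 2) / (2 * ρ 0 s ^ 3)) l (𝓝 β) := by
    intro i
    obtain ⟨β, -, hβ⟩ := (isCompact_Icc (a := -(M / 2)) (b := M / 2)).ultrafilter_le_nhds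
      (l.map fun s => (ρ i s ^ 2 - ρ 0 s ^ 2) / (2 * ρ 0 s ^ 3)) (by
        rw [le_principal_iff]
        refine Ultrafilter.mem_map.2 ?_
        filter_upwards [hdiff i, hρpos] with s hs hpos
        rw [Set.mem_preimage, Set.mem_Icc, ← abs_le, abs_div,
          abs_of_pos (show 0 < 2 * ρ 0 s ^ 3 by positivity), div_le_iff₀ (by positivity)]
        linarith)
    exact ⟨β, hβ⟩
  choose β hβ using hβ
  have hratio : ∀ i, Tendsto (fun s => ρ i s / ρ 0 s) l (𝓝 1) := by
    intro i
    have h1 : Tendsto (fun s => 1 + 2 * ρ 0 s * ((ρ i s ^ 2 - ρ 0 s ^ 2) / (2 * ρ 0 s ^ 3))) l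
        (𝓝 (1 + 2 * 0 * β i)) := ((hρ0.const_mul 2).mul (hβ i)).const_add 1
    have h2 := h1.sqrt
    simp only [mul_zero, zero_mul, add_zero, Real.sqrt_one] at h2
    refine h2.congr' ?_
    filter_upwards [hρpos] with s hpos
    rw [← Real.sqrt_sq (div_nonneg (hρnn i s) hpos.le)]
    congr 1
    field_simp
    ring
  have hdir : ∀ i, Tendsto (fun s => (p i s).1 / ρ 0 s) l (𝓝 (t i).cos) ∧
      Tendsto (fun s => (p i s).2 / ρ 0 s) l (𝓝 (t i).sin) := by
    intro i
    have hne : ∀ᶠ s in (l : Filter ι), ρ i s ≠ 0 := by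
      filter_upwards [(hratio i).eventually_const_lt (show (0 : ℝ) < 1 by norm_num)] with s hs h0
      rw [h0, zero_div] at hs
      exact lt_irrefl _ hs
    have h1 := (hp i).2.1.mul (hratio i)
    have h2 := (hp i).2.2.mul (hratio i)
    rw [mul_one] at h1 h2
    refine ⟨h1.congr' ?_, h2.congr' ?_⟩
    all_goals
      filter_upwards [hne, hρpos] with s hs hpos
      change _ / ρ i s * _ = _
      field_simp
  -- Cramer's rule for the rescaled centre `ζ`
  set D : ι → ℝ := fun s =>
    ((p 1 s).1 / ρ 0 s - (p 0 s).1 / ρ 0 s) * ((p 2 s).2 / ρ 0 s - (p 0 s).2 / ρ 0 s) -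
    ((p 2 s).1 / ρ 0 s - (p 0 s).1 / ρ 0 s) * ((p 1 s).2 / ρ 0 s - (p 0 s).2 / ρ 0 s) with hD
  set d : ℝ := ((t 1).cos - (t 0).cos) * ((t 2).sin - (t 0).sin) -
    ((t 2).cos - (t 0).cos) * ((t 1).sin - (t 0).sin) with hd
  have hd0 : d ≠ 0 := by
    refine det_ne_zero_of_unit (x := fun i => (t i).cos) (y := fun i => (t i).sin)
      (fun i => Real.Angle.cos_sq_add_sin_sq _) fun i j hij => ?_
    by_contra! h
    exact hij (ht (angle_eq_of_cos_sin h.1 h.2))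
  have hDlim : Tendsto D l (𝓝 d) :=
    (((hdir 1).1.sub (hdir 0).1).mul ((hdir 2).2.sub (hdir 0).2)).sub
      (((hdir 2).1.sub (hdir 0).1).mul ((hdir 1).2.sub (hdir 0).2))
  have hlin : ∀ i, ∀ᶠ s in (l : Filter ι), ((p i s).1 / ρ 0 s - (p 0 s).1 / ρ 0 s) *
      ((z s).1 / ρ 0 s ^ 2) + ((p i s).2 / ρ 0 s - (p 0 s).2 / ρ 0 s) * ((z s).2 / ρ 0 s ^ 2) =
      (ρ i s ^ 2 - ρ 0 s ^ 2) / (2 * ρ 0 s ^ 3) := by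
    intro i
    filter_upwards [hcirc i, hcirc 0, hρpos] with s h1 h2 hpos
    rw [hρsq i s]
    have h3 := hρsq 0 s
    field_simp
    linear_combination h2 - h1 + h3
  obtain ⟨ζ₁, hζ₁⟩ : ∃ ζ, Tendsto (fun s => (z s).1 / ρ 0 s ^ 2) l (𝓝 ζ) := by
    refine ⟨_, ((((hβ 1).mul ((hdir 2).2.sub (hdir 0).2)).sub
      ((hβ 2).mul ((hdir 1).2.sub (hdir 0).2))).div hDlim hd0).congr' ?_⟩
    filter_upwards [hlin 1, hlin 2, hDlim.eventually_ne hd0] with s h1 h2 hne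
    rw [Pi.div_apply, ← h1, ← h2, div_eq_iff hne]
    simp only [hD]
    ring
  obtain ⟨ζ₂, hζ₂⟩ : ∃ ζ, Tendsto (fun s => (z s).2 / ρ 0 s ^ 2) l (𝓝 ζ) := by
    refine ⟨_, ((((hβ 2).mul ((hdir 1).1.sub (hdir 0).1)).sub
      ((hβ 1).mul ((hdir 2).1.sub (hdir 0).1))).div hDlim hd0).congr' ?_⟩
    filter_upwards [hlin 1, hlin 2, hDlim.eventually_ne hd0] with s h1 h2 hne
    rw [Pi.div_apply, ← h1, ← h2, div_eq_iff hne]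
    simp only [hD]
    ring
  have hrel : ∀ i, Tendsto (fun s => ((p i s).1 - (z s).1) / ρ 0 s) l (𝓝 (t i).cos) ∧
      Tendsto (fun s => ((p i s).2 - (z s).2) / ρ 0 s) l (𝓝 (t i).sin) := by
    intro i
    have h1 := (hdir i).1.sub (hζ₁.mul hρ0)
    have h2 := (hdir i).2.sub (hζ₂.mul hρ0)
    rw [mul_zero, sub_zero] at h1 h2
    refine ⟨h1.congr' ?_, h2.congr' ?_⟩
    all_goals
      filter_upwards [hρpos] with s hpos
      field_simp
  have hRρ : Tendsto (fun s => R s / ρ 0 s) l (𝓝 1) := by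
    have h1 := (((hrel 0).1.pow 2).add ((hrel 0).2.pow 2)).sqrt
    rw [Real.Angle.cos_sq_add_sin_sq, Real.sqrt_one] at h1
    refine h1.congr' ?_
    filter_upwards [hcirc 0, hρpos, hR] with s h2 hpos hRs
    rw [← Real.sqrt_sq (div_nonneg hRs.le hpos.le), div_pow, div_pow, div_pow, ← h2]
    ring_nf
  have hρR : Tendsto (fun s => ρ 0 s / R s) l (𝓝 1) := by
    have := hRρ.inv₀ one_ne_zero
    simpa using this
  refine ⟨?_, ⟨(ζ₁, ζ₂), ?_⟩, fun i => ?_⟩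
  · have h1 := hRρ.mul hρ0
    rw [mul_zero] at h1
    refine h1.congr' ?_
    filter_upwards [hρpos] with s hpos
    field_simp
  · have h1 := (hζ₁.mul (hρR.pow 2)).prodMk_nhds (hζ₂.mul (hρR.pow 2))
    rw [one_pow, mul_one, mul_one] at h1
    refine h1.congr' ?_
    filter_upwards [hρpos, hR] with s hpos hRs
    ext <;> simp <;> field_simp
  · have h1 := (hrel i).1.mul hρR
    have h2 := (hrel i).2.mul hρR
    rw [mul_one] at h1 h2
    refine ⟨h1.congr' ?_, h2.congr' ?_⟩
    all_goals
      filter_upwards [hρpos, hR] with s hpos hRs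
      field_simp

/-- Distinct limiting directions of the points of contact at an umbilic form a special triple. In
the limit, `leading f w` has equal values and vanishing derivatives in these directions. -/
theorem isSpecialTriple_of_tritangent (hf : ContDiff ℝ (10 : ℕ) f) (h00 : coeff f 0 0 = 0)
    (h10 : coeff f 1 0 = 0) (h01 : coeff f 0 1 = 0) (hu : coeff f 2 0 = coeff f 0 2)
    (h11 : coeff f 1 1 = 0) (hc : coeff f 2 0 ≠ 0) (hb : coeff f 3 0 = coeff f 1 2)
    (hb' : coeff f 2 1 ≠ coeff f 0 3) {ι : Type} (l : Ultrafilter ι) {p : Fin 3 → ι → ℝ × ℝ}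
    {t : Fin 3 → Real.Angle}
    (htri : ∀ᶠ s in (l : Filter ι), ∃ (k : ℝ) (z : ℝ × ℝ) (R : ℝ),
      IsTritangent f k z R (fun i => p i s))
    (hp : ∀ i, TendsToOriginAlong (l : Filter ι) (p i) (t i)) (ht : Function.Injective t) :
    IsSpecialTriple t := by
  obtain ⟨k, hk⟩ := htri.choice
  obtain ⟨z, hz⟩ := hk.choice
  obtain ⟨R, hR⟩ := hz.choice
  have hRpos : ∀ᶠ s in (l : Filter ι), 0 < R s := hR.mono fun s hs => (hs.2 0).2.1
  have hangle : ∀ i, ∃ (θ : ι → ℝ) (τ : ℝ), Tendsto θ l (𝓝 τ) ∧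
      ∀ᶠ s in (l : Filter ι), circlePoint (z s) (R s) (θ s) = p i s := by
    intro i
    obtain ⟨θ₀, hθ₀⟩ := (hR.mono fun s hs => (hs.2 i).2.exists_angle).choice
    obtain ⟨θ, τ, -, hlim, hcs⟩ := exists_angle_tendsto l θ₀
    refine ⟨θ, τ, hlim, hθ₀.mono fun s hs => Eq.trans ?_ hs⟩
    rw [circlePoint, circlePoint, (hcs s).1, (hcs s).2]
  choose θ τ hθ hθp using hangle
  obtain ⟨hR0, ⟨w, hw⟩, hdir⟩ := exists_rescaled_limit l hc
    (umbilic_isBigO hf h00 h10 h01 hu h11) ht hp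
    (fun i => hR.mono fun s hs => by rw [(hs.2 i).1, (hs.2 0).1]) hRpos
    (fun i => (hθp i).mono fun s hs => by
      rw [← hs]
      simp only [circlePoint]
      linear_combination R s ^ 2 * Real.cos_sq_add_sin_sq (θ i s))
  have hcos : ∀ i, Real.cos (τ i) = (t i).cos ∧ Real.sin (τ i) = (t i).sin := fun i => by
    constructor
    · refine tendsto_nhds_unique ((Real.continuous_cos.tendsto _).comp (hθ i))
        ((hdir i).1.congr' ?_)
      filter_upwards [hθp i, hRpos] with s hs hpos
      rw [← hs]
      simp only [circlePoint, Function.comp]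
      field_simp
      ring
    · refine tendsto_nhds_unique ((Real.continuous_sin.tendsto _).comp (hθ i))
        ((hdir i).2.congr' ?_)
      filter_upwards [hθp i, hRpos] with s hs hpos
      rw [← hs]
      simp only [circlePoint, Function.comp]
      field_simp
      ring
  obtain ⟨h, hh, hexp, hlead⟩ := exists_umbilic_expansion hf h00 h10 h01 hu h11 hb
  have hh1 : ContDiff ℝ 1 h := hh.of_le (by norm_cast)
  have hpar : ∀ i, Tendsto (fun s => ((((R s ^ 2)⁻¹ • z s, θ i s), R s) : ((ℝ × ℝ) × ℝ) × ℝ)) l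
      (𝓝 ((w, τ i), 0)) := fun i => (hw.prodMk_nhds (hθ i)).prodMk_nhds hR0
  have hexp' : ∀ s φ, 0 < R s → f (circlePoint (z s) (R s) φ) = coeff f 2 0 * R s ^ 2 +
      R s ^ 3 * h (((R s ^ 2)⁻¹ • z s, φ), R s) := fun s φ hs => by
    rw [← hexp, smul_inv_smul₀ (by positivity)]
  -- values and angular derivatives in the limit
  have hval : ∀ i, leading f w (τ i) = leading f w (τ 0) := fun i => by
    rw [← hlead, ← hlead]
    refine tendsto_nhds_unique ((hh.continuous.tendsto _).comp (hpar i))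
      (((hh.continuous.tendsto _).comp (hpar 0)).congr' ?_)
    filter_upwards [hR, hθp i, hθp 0, hRpos] with s hs h1 h2 hpos
    have e1 := hexp' s (θ i s) hpos
    have e2 := hexp' s (θ 0 s) hpos
    rw [h1, (hs.2 i).1] at e1
    rw [h2, (hs.2 0).1] at e2
    have h3 : R s ^ 3 ≠ 0 := by positivity
    refine mul_left_cancel₀ h3 ?_
    simp only [Function.comp]
    linarith
  have hder : ∀ i, leadingDeriv f w (τ i) = 0 := fun i => by
    rw [← angleDeriv_zero hh1 hlead]
    have hcd : Continuous (angleDeriv h) :=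
      (contDiff_angleDeriv (n := 0) (by exact_mod_cast hh1)).continuous
    refine tendsto_nhds_unique ((hcd.tendsto _).comp (hpar i)) (tendsto_const_nhds.congr' ?_)
    filter_upwards [hR, hθp i, hRpos] with s hs h1 hpos
    have h2 := (hs.2 i).2.hasZero h1 1 (by norm_num)
    rw [iteratedDeriv_one] at h2
    have h3 : HasDerivAt (fun φ => f (circlePoint (z s) (R s) φ) - f (p i s))
        (R s ^ 3 * angleDeriv h (((R s ^ 2)⁻¹ • z s, θ i s), R s)) (θ i s) := by
      have h4 := (((hasDerivAt_angle hh1 ((R s ^ 2)⁻¹ • z s) (θ i s) (R s)).const_mul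
        (R s ^ 3)).const_add (coeff f 2 0 * R s ^ 2)).sub_const (f (p i s))
      simpa only [hexp' s _ hpos] using h4
    rw [h3.deriv] at h2
    have h5 : R s ^ 3 ≠ 0 := by positivity
    exact ((mul_eq_zero.1 h2).resolve_left h5).symm
  set δ := coeff f 0 3 - coeff f 2 1 with hδ
  have hδ0 : δ ≠ 0 := sub_ne_zero.2 hb'.symm
  obtain ⟨ε, hε, hsp⟩ := unit_points_of_double_zeros
    (α := (2 * coeff f 2 0 * w.1 + coeff f 3 0) / δ)
    (β := (2 * coeff f 2 0 * w.2 + coeff f 2 1) / δ) (γ := leading f w (τ 0) / δ)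
    (x := fun i => (t i).cos) (y := fun i => (t i).sin)
    (fun i => Real.Angle.cos_sq_add_sin_sq _)
    (fun i j hij => ht (angle_eq_of_cos_sin (congrArg Prod.fst hij) (congrArg Prod.snd hij)))
    (fun i => by
      rw [← hval i]
      simp only [leading, ← hδ, (hcos i).1, (hcos i).2]
      field_simp)
    (fun i => by
      have := hder i
      simp only [leadingDeriv, ← hδ, (hcos i).1, (hcos i).2] at this
      field_simp
      linarith)
  exact isSpecialTriple_of_sin_three ht hε fun i => (hsp i).2

end UmbilicLimits

/-! ### Curves of tritangent points at an umbilic -/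

section UmbilicCurves

variable {f : ℝ × ℝ → ℝ} {h : ((ℝ × ℝ) × ℝ) × ℝ → ℝ}

/-- The equations, in the rescaled centre `w` and the angles `θ`, for a circle of radius `R` to be
tangent to one isophote at three points: equal values of `h` and vanishing angular derivatives. -/
def tritangency (h : ((ℝ × ℝ) × ℝ) × ℝ → ℝ) (q : ℝ × ((ℝ × ℝ) × (Fin 3 → ℝ))) :
    (ℝ × ℝ) × (Fin 3 → ℝ) :=
  ((h ((q.2.1, q.2.2 0), q.1) - h ((q.2.1, q.2.2 1), q.1),
    h ((q.2.1, q.2.2 0), q.1) - h ((q.2.1, q.2.2 2), q.1)),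
    fun i => angleDeriv h ((q.2.1, q.2.2 i), q.1))

theorem contDiff_tritangency (hh : ContDiff ℝ (2 : ℕ) h) :
    ContDiff ℝ (1 : ℕ) (tritangency h) := by
  have h1 : ContDiff ℝ (1 : ℕ) (angleDeriv h) := contDiff_angleDeriv hh
  have h2 : ContDiff ℝ (1 : ℕ) h := hh.of_le (by norm_cast)
  have h3 : ∀ i : Fin 3, ContDiff ℝ (1 : ℕ) (fun q : ℝ × ((ℝ × ℝ) × (Fin 3 → ℝ)) =>
      (((q.2.1, q.2.2 i), q.1) : ((ℝ × ℝ) × ℝ) × ℝ)) := fun i => by fun_prop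
  exact (((h2.comp (h3 0)).sub (h2.comp (h3 1))).prodMk ((h2.comp (h3 0)).sub
    (h2.comp (h3 2)))).prodMk (contDiff_pi.2 fun i => h1.comp (h3 i))

/-- Nondegeneracy of the equations of tritangency at `R = 0`. As the angular derivatives of `h`
vanish, differences of values of `h` depend only on `w` to first order, by an invertible linear map
as the three points are not collinear; the equations for the angles are diagonal in the angles. -/
theorem isInvertible_fderiv_tritangency (hh : ContDiff ℝ (2 : ℕ) h)
    (h0 : ∀ w θ, h ((w, θ), 0) = leading f w θ) (hc : coeff f 2 0 ≠ 0) {w : ℝ × ℝ}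
    {θ : Fin 3 → ℝ} (hθ : ∀ i j, i ≠ j → Real.cos (θ i) ≠ Real.cos (θ j) ∨
      Real.sin (θ i) ≠ Real.sin (θ j)) (h1 : ∀ i, leadingDeriv f w (θ i) = 0)
    (h2 : ∀ i, leadingDeriv₂ f w (θ i) ≠ 0) :
    (fderiv ℝ (tritangency h) (0, (w, θ)) ∘L
      .inr ℝ ℝ ((ℝ × ℝ) × (Fin 3 → ℝ))).IsInvertible := by
  set L := fderiv ℝ (tritangency h) (0, (w, θ)) ∘L .inr ℝ ℝ ((ℝ × ℝ) × (Fin 3 → ℝ)) with hL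
  have hLv : ∀ v, L v = ((2 * coeff f 2 0 * (v.1.1 * (Real.cos (θ 0) - Real.cos (θ 1)) +
      v.1.2 * (Real.sin (θ 0) - Real.sin (θ 1))), 2 * coeff f 2 0 *
      (v.1.1 * (Real.cos (θ 0) - Real.cos (θ 2)) + v.1.2 * (Real.sin (θ 0) - Real.sin (θ 2)))),
      fun i => 2 * coeff f 2 0 * (-v.1.1 * Real.sin (θ i) + v.1.2 * Real.cos (θ i)) +
        v.2 i * leadingDeriv₂ f w (θ i)) := by
    intro v
    have d1 : HasFDerivAt (tritangency h) (fderiv ℝ (tritangency h) (0, (w, θ)))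
        ((0 : ℝ), (w + (0 : ℝ) • v.1, fun i => θ i + 0 * v.2 i)) := by
      simp only [zero_smul, add_zero, zero_mul]
      exact ((contDiff_tritangency hh).differentiable (by norm_num) _).hasFDerivAt
    have d2 : HasDerivAt (fun τ : ℝ => ((0 : ℝ), (w + τ • v.1, fun i => θ i + τ * v.2 i)))
        ((0 : ℝ), v) 0 := by
      refine (hasDerivAt_const _ _).prodMk (HasDerivAt.prodMk ?_ ?_)
      · simpa using ((hasDerivAt_id (0 : ℝ)).smul_const v.1).const_add w
      · refine hasDerivAt_pi.2 fun i => ?_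
        simpa using ((hasDerivAt_id (0 : ℝ)).mul_const (v.2 i)).const_add (θ i)
    have d3 := d1.comp_hasDerivAt (0 : ℝ) d2
    have l1 : ∀ i, HasDerivAt (fun τ : ℝ => leading f (w + τ • v.1) (θ i + τ * v.2 i))
        (2 * coeff f 2 0 * (v.1.1 * Real.cos (θ i) + v.1.2 * Real.sin (θ i))) 0 := fun i => by
      have := hasDerivAt_leading_line (f := f) w v.1 (θ i) (v.2 i)
      rwa [h1 i, mul_zero, add_zero] at this
    have d4 := (((l1 0).sub (l1 1)).prodMk ((l1 0).sub (l1 2))).prodMk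
      (hasDerivAt_pi.2 fun i => hasDerivAt_leadingDeriv_line (f := f) w v.1 (θ i) (v.2 i))
    have heq : (tritangency h ∘ fun τ : ℝ => ((0 : ℝ), (w + τ • v.1, fun i => θ i + τ * v.2 i))) =
        fun τ => ((leading f (w + τ • v.1) (θ 0 + τ * v.2 0) -
          leading f (w + τ • v.1) (θ 1 + τ * v.2 1), leading f (w + τ • v.1) (θ 0 + τ * v.2 0) -
          leading f (w + τ • v.1) (θ 2 + τ * v.2 2)), fun i =>
          leadingDeriv f (w + τ • v.1) (θ i + τ * v.2 i)) := by
      ext τ <;> simp [tritangency, h0, angleDeriv_zero (hh.of_le (by norm_cast)) h0]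
    rw [heq] at d3
    have := d3.unique d4
    simp only [hL, ContinuousLinearMap.comp_apply, ContinuousLinearMap.inr_apply]
    rw [this]
    ext <;> simp <;> ring
  have hinj : Function.Injective L := by
    refine (injective_iff_map_eq_zero L).2 fun v hv => ?_
    rw [hLv] at hv
    have e1 := congrArg (fun q : (ℝ × ℝ) × (Fin 3 → ℝ) => q.1.1) hv
    have e2 := congrArg (fun q : (ℝ × ℝ) × (Fin 3 → ℝ) => q.1.2) hv
    have e3 := fun i => congrArg (fun q : (ℝ × ℝ) × (Fin 3 → ℝ) => q.2 i) hv
    simp only [Prod.fst_zero, Prod.snd_zero, Pi.zero_apply] at e1 e2 e3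
    have hdet := det_ne_zero_of_unit (x := fun i => Real.cos (θ i)) (y := fun i => Real.sin (θ i))
      (fun i => Real.cos_sq_add_sin_sq _) hθ
    have e1' := (mul_eq_zero.1 e1).resolve_left (mul_ne_zero two_ne_zero hc)
    have e2' := (mul_eq_zero.1 e2).resolve_left (mul_ne_zero two_ne_zero hc)
    have v1 : v.1.1 = 0 := by
      refine (mul_eq_zero.1 (?_ : v.1.1 * _ = 0)).resolve_right hdet
      linear_combination (Real.sin (θ 0) - Real.sin (θ 2)) * e1' -
        (Real.sin (θ 0) - Real.sin (θ 1)) * e2'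
    have v2 : v.1.2 = 0 := by
      refine (mul_eq_zero.1 (?_ : v.1.2 * _ = 0)).resolve_right hdet
      linear_combination (Real.cos (θ 0) - Real.cos (θ 1)) * e2' -
        (Real.cos (θ 0) - Real.cos (θ 2)) * e1'
    have v3 : ∀ i, v.2 i = 0 := fun i => by
      have := e3 i
      rw [v1, v2] at this
      simpa [h2 i] using this
    ext i
    · exact v1
    · exact v2
    · exact v3 i
  exact ⟨(LinearEquiv.ofInjectiveEndo (L : _ →ₗ[ℝ] _) hinj).toContinuousLinearEquiv, by
    ext v <;> rfl⟩

/-- A point on the circle with centre `s ^ 2 • w s` and radius `s` tends to the origin in the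
direction of its limiting angle on the circle: the centre is of second order. -/
theorem tendsToOriginAlong_circlePoint {w : ℝ → ℝ × ℝ} {θ : ℝ → ℝ} {w₀ : ℝ × ℝ} {θ₀ : ℝ}
    {t : Real.Angle} (hw : Tendsto w (𝓝[>] 0) (𝓝 w₀)) (hθ : Tendsto θ (𝓝[>] 0) (𝓝 θ₀))
    (hc : Real.cos θ₀ = t.cos) (hs : Real.sin θ₀ = t.sin) :
    TendsToOriginAlong (𝓝[>] 0) (fun s => circlePoint (s ^ 2 • w s) s (θ s)) t := by
  have hid : Tendsto (fun s : ℝ => s) (𝓝[>] 0) (𝓝 0) := tendsto_id.mono_left nhdsWithin_le_nhds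
  have hx : Tendsto (fun s => Real.cos (θ s) + s * (w s).1) (𝓝[>] 0) (𝓝 t.cos) := by
    have := ((Real.continuous_cos.tendsto _).comp hθ).add (hid.mul (hw.fst_nhds))
    rwa [zero_mul, add_zero, hc] at this
  have hy : Tendsto (fun s => Real.sin (θ s) + s * (w s).2) (𝓝[>] 0) (𝓝 t.sin) := by
    have := ((Real.continuous_sin.tendsto _).comp hθ).add (hid.mul (hw.snd_nhds))
    rwa [zero_mul, add_zero, hs] at this
  have hp : ∀ s, circlePoint (s ^ 2 • w s) s (θ s) =
      (s * (Real.cos (θ s) + s * (w s).1), s * (Real.sin (θ s) + s * (w s).2)) := fun s => by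
    ext <;> simp only [circlePoint, Prod.smul_fst, Prod.smul_snd, smul_eq_mul] <;> ring
  have hn := ((hx.pow 2).add (hy.pow 2)).sqrt
  rw [Real.Angle.cos_sq_add_sin_sq, Real.sqrt_one] at hn
  have hsqrt : ∀ s : ℝ, 0 < s → ∀ a b : ℝ, Real.sqrt ((s * a) ^ 2 + (s * b) ^ 2) =
      s * Real.sqrt (a ^ 2 + b ^ 2) := fun s hs a b => by
    rw [show (s * a) ^ 2 + (s * b) ^ 2 = s ^ 2 * (a ^ 2 + b ^ 2) by ring,
      Real.sqrt_mul (sq_nonneg s), Real.sqrt_sq hs.le]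
  simp only [TendsToOriginAlong, hp]
  refine ⟨?_, ?_, ?_⟩
  · have := (hid.mul hx).prodMk_nhds (hid.mul hy)
    rwa [zero_mul, zero_mul] at this
  · have := hx.div hn one_ne_zero
    rw [div_one] at this
    refine this.congr' ?_
    filter_upwards [self_mem_nhdsWithin] with s hs
    have hs' : (0 : ℝ) < s := hs
    rw [hsqrt s hs', mul_div_mul_left _ _ hs'.ne']
    rfl
  · have := hy.div hn one_ne_zero
    rw [div_one] at this
    refine this.congr' ?_
    filter_upwards [self_mem_nhdsWithin] with s hs
    have hs' : (0 : ℝ) < s := hs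
    rw [hsqrt s hs', mul_div_mul_left _ _ hs'.ne']
    rfl

/-- Every special triple is realised by curves of points of ordinary contact. The radius `R` is the
parameter of the curves. -/
theorem exists_tritangent_curves (hf : ContDiff ℝ (10 : ℕ) f) (h00 : coeff f 0 0 = 0)
    (h10 : coeff f 1 0 = 0) (h01 : coeff f 0 1 = 0) (hu : coeff f 2 0 = coeff f 0 2)
    (h11 : coeff f 1 1 = 0) (hc : coeff f 2 0 ≠ 0) (hb : coeff f 3 0 = coeff f 1 2)
    (hb' : coeff f 2 1 ≠ coeff f 0 3) {t : Fin 3 → Real.Angle} (ht : IsSpecialTriple t) :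
    ∃ p : Fin 3 → ℝ → ℝ × ℝ, (∀ᶠ s in 𝓝[>] (0 : ℝ), (∀ i, ContinuousAt (p i) s) ∧
      ∃ (k : ℝ) (z : ℝ × ℝ) (R : ℝ), IsTritangent f k z R (fun i => p i s) ∧
        ∀ i, HasOrdinaryTangency f z R (p i s)) ∧
      ∀ i, TendsToOriginAlong (𝓝[>] (0 : ℝ)) (p i) (t i) := by
  obtain ⟨htinj, ε, hε, hsp⟩ := ht.exists_sin_three
  obtain ⟨h, hh, hexp, hlead⟩ := exists_umbilic_expansion hf h00 h10 h01 hu h11 hb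
  have hh1 : ContDiff ℝ 1 h := hh.of_le (by norm_cast)
  have hh2 : ContDiff ℝ (2 : ℕ) h := hh.of_le (by norm_cast)
  set δ := coeff f 0 3 - coeff f 2 1 with hδ
  have hδ0 : δ ≠ 0 := sub_ne_zero.2 hb'.symm
  -- with this centre the leading part is `-(δ / 4) * sin (3 θ)`
  set w₀ : ℝ × ℝ := (-coeff f 3 0 / (2 * coeff f 2 0),
    -(coeff f 2 1 + 3 / 4 * δ) / (2 * coeff f 2 0)) with hw₀
  have hw1 : 2 * coeff f 2 0 * w₀.1 + coeff f 3 0 = 0 := by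
    simp only [hw₀]; field_simp; ring
  have hw2 : 2 * coeff f 2 0 * w₀.2 + coeff f 2 1 = -(3 / 4 * δ) := by
    simp only [hw₀]; field_simp; ring
  set θ₀ : Fin 3 → ℝ := fun i => (t i).toReal with hθ₀
  have hcos : ∀ i, Real.cos (θ₀ i) = (t i).cos := fun i => Real.Angle.cos_toReal _
  have hsin : ∀ i, Real.sin (θ₀ i) = (t i).sin := fun i => Real.Angle.sin_toReal _
  have hne : ∀ i j, i ≠ j → Real.cos (θ₀ i) ≠ Real.cos (θ₀ j) ∨
      Real.sin (θ₀ i) ≠ Real.sin (θ₀ j) := fun i j hij => by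
    by_contra! hcon
    rw [hcos, hcos, hsin, hsin] at hcon
    exact hij (htinj (angle_eq_of_cos_sin hcon.1 hcon.2))
  have hval : ∀ i, leading f w₀ (θ₀ i) = -(δ / 4) * ε := fun i => by
    simp only [leading, hw1, hw2, ← hδ, hsin]
    linear_combination (-(δ / 4)) * (hsp i).2
  have hder : ∀ i, leadingDeriv f w₀ (θ₀ i) = 0 := fun i => by
    simp only [leadingDeriv, hw1, hw2, ← hδ, hsin, hcos]
    linear_combination (-(3 / 4) * δ) * (hsp i).1 +
      (3 * δ * (t i).cos) * (Real.Angle.cos_sq_add_sin_sq (t i))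
  have hder2 : ∀ i, leadingDeriv₂ f w₀ (θ₀ i) ≠ 0 := fun i => by
    have : leadingDeriv₂ f w₀ (θ₀ i) = 9 / 4 * δ * ε := by
      simp only [leadingDeriv₂, hw1, hw2, ← hδ, hsin, hcos]
      linear_combination (9 / 4 * δ) * (hsp i).2 +
        (6 * δ * (t i).sin) * (Real.Angle.cos_sq_add_sin_sq (t i))
    rw [this]
    positivity
  -- continue the solution at `R = 0` by the implicit function theorem
  have hΦ : ContDiffAt ℝ (1 : ℕ) (tritangency h) (0, (w₀, θ₀)) :=
    (contDiff_tritangency hh2).contDiffAt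
  have hinv := isInvertible_fderiv_tritangency hh2 hlead hc hne hder hder2
  set ψ := hΦ.implicitFunction (by norm_num) hinv with hψ
  have hψ0 : ψ 0 = (w₀, θ₀) := hΦ.implicitFunction_apply_self (by norm_num) hinv
  have hψd : ContDiffAt ℝ (1 : ℕ) ψ 0 := hΦ.contDiffAt_implicitFunction (by norm_num) hinv
  have hψe : ∀ᶠ s in 𝓝 (0 : ℝ), tritangency h (s, ψ s) = 0 := by
    have h1 := hΦ.eventually_apply_implicitFunction (by norm_num) hinv
    have h2 : tritangency h (0, (w₀, θ₀)) = 0 := by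
      refine Prod.ext (by simp [tritangency, hlead, hval]) (funext fun i => ?_)
      exact (angleDeriv_zero hh1 hlead w₀ (θ₀ i)).trans (hder i)
    rw [h2] at h1
    exact h1
  have hψt : Tendsto ψ (𝓝[>] 0) (𝓝 (w₀, θ₀)) := by
    rw [← hψ0]
    exact hψd.continuousAt.tendsto.mono_left nhdsWithin_le_nhds
  have hψw : Tendsto (fun s => (ψ s).1) (𝓝[>] 0) (𝓝 w₀) := hψt.fst_nhds
  have hψθ : ∀ i, Tendsto (fun s => (ψ s).2 i) (𝓝[>] 0) (𝓝 (θ₀ i)) := fun i =>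
    (tendsto_pi_nhds.1 hψt.snd_nhds) i
  have hid : Tendsto (fun s : ℝ => s) (𝓝[>] 0) (𝓝 0) := tendsto_id.mono_left nhdsWithin_le_nhds
  have hpar : ∀ i, Tendsto (fun s => ((((ψ s).1, (ψ s).2 i), s) : ((ℝ × ℝ) × ℝ) × ℝ)) (𝓝[>] 0)
      (𝓝 ((w₀, θ₀ i), 0)) := fun i => (hψw.prodMk_nhds (hψθ i)).prodMk_nhds hid
  -- regularity of `f` at the points of contact, from its radial derivative
  have hreg : ∀ i, ∀ᶠ s in 𝓝[>] (0 : ℝ), 2 * coeff f 2 0 + 3 * s * h (((ψ s).1, (ψ s).2 i), s) +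
      s ^ 2 * fderiv ℝ h (((ψ s).1, (ψ s).2 i), s) (0, 1) ≠ 0 := fun i => by
    have hcd : Continuous fun q => fderiv ℝ h q (0, 1) :=
      (hh1.continuous_fderiv one_ne_zero).clm_apply continuous_const
    have h1 := (((hid.const_mul 3).mul ((hh.continuous.tendsto _).comp (hpar i))).const_add
      (2 * coeff f 2 0)).add ((hid.pow 2).mul ((hcd.tendsto _).comp (hpar i)))
    refine h1.eventually_ne ?_
    simpa using hc
  have hord : ∀ i, ∀ᶠ s in 𝓝[>] (0 : ℝ),
      angleDeriv (angleDeriv h) (((ψ s).1, (ψ s).2 i), s) ≠ 0 := fun i => by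
    have h1 : ContDiff ℝ (1 : ℕ) (angleDeriv h) := contDiff_angleDeriv hh2
    have h2 : ContDiff ℝ (0 : ℕ) (angleDeriv (angleDeriv h)) := contDiff_angleDeriv h1
    refine ((h2.continuous.tendsto _).comp (hpar i)).eventually_ne ?_
    rw [angleDeriv_angleDeriv_zero hh2 hlead]
    exact hder2 i
  have hdist : ∀ i j, i ≠ j → ∀ᶠ s in 𝓝[>] (0 : ℝ),
      Real.cos ((ψ s).2 i) ≠ Real.cos ((ψ s).2 j) ∨
        Real.sin ((ψ s).2 i) ≠ Real.sin ((ψ s).2 j) := by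
    intro i j hij
    rcases hne i j hij with h1 | h1
    · have h2 := ((Real.continuous_cos.tendsto _).comp (hψθ i)).sub
        ((Real.continuous_cos.tendsto _).comp (hψθ j))
      filter_upwards [h2.eventually_ne (sub_ne_zero.2 h1)] with s hs
      exact Or.inl (sub_ne_zero.1 hs)
    · have h2 := ((Real.continuous_sin.tendsto _).comp (hψθ i)).sub
        ((Real.continuous_sin.tendsto _).comp (hψθ j))
      filter_upwards [h2.eventually_ne (sub_ne_zero.2 h1)] with s hs
      exact Or.inr (sub_ne_zero.1 hs)
  refine ⟨fun i s => circlePoint (s ^ 2 • (ψ s).1) s ((ψ s).2 i), ?_, fun i =>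
    tendsToOriginAlong_circlePoint hψw (hψθ i) (hcos i) (hsin i)⟩
  have hcont : ∀ᶠ s in 𝓝[>] (0 : ℝ), ContinuousAt ψ s :=
    ((hψd.eventually (by simp)).mono fun s hs => hs.continuousAt).filter_mono nhdsWithin_le_nhds
  filter_upwards [hcont, hψe.filter_mono nhdsWithin_le_nhds, eventually_all.2 hreg,
    eventually_all.2 hord, eventually_all.2 fun i => eventually_all.2 fun j =>
      eventually_imp_distrib_left.2 (hdist i j), self_mem_nhdsWithin] with s h1 h2 h3 h4 h5 hs
  have hs' : (0 : ℝ) < s := hs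
  have hs0 : s ≠ 0 := hs'.ne'
  refine ⟨fun i => ?_, coeff f 2 0 * s ^ 2 + s ^ 3 * h (((ψ s).1, (ψ s).2 0), s),
    s ^ 2 • (ψ s).1, s, ?_⟩
  · unfold circlePoint
    fun_prop
  have e1 := congrArg (fun q : (ℝ × ℝ) × (Fin 3 → ℝ) => q.1.1) h2
  have e2 := congrArg (fun q : (ℝ × ℝ) × (Fin 3 → ℝ) => q.1.2) h2
  have e3 := fun i => congrArg (fun q : (ℝ × ℝ) × (Fin 3 → ℝ) => q.2 i) h2
  simp only [tritangency, Prod.fst_zero, Prod.snd_zero, Pi.zero_apply] at e1 e2 e3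
  have hvals : ∀ i, h (((ψ s).1, (ψ s).2 i), s) = h (((ψ s).1, (ψ s).2 0), s) := fun i => by
    fin_cases i
    · rfl
    · exact (sub_eq_zero.1 e1).symm
    · exact (sub_eq_zero.1 e2).symm
  have hd1 : ∀ φ, HasDerivAt (fun φ => f (circlePoint (s ^ 2 • (ψ s).1) s φ))
      (s ^ 3 * angleDeriv h (((ψ s).1, φ), s)) φ := fun φ => by
    have h4 := ((hasDerivAt_angle hh1 (ψ s).1 φ s).const_mul (s ^ 3)).const_add
      (coeff f 2 0 * s ^ 2)
    simpa only [hexp] using h4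
  have hregular : ∀ i, fderiv ℝ f (circlePoint (s ^ 2 • (ψ s).1) s ((ψ s).2 i)) ≠ 0 := by
    intro i h0
    have d1 : HasDerivAt (fun R => f (circlePoint (R ^ 2 • (ψ s).1) R ((ψ s).2 i))) 0 s := by
      have d2 : DifferentiableAt ℝ
          (fun R : ℝ => circlePoint (R ^ 2 • (ψ s).1) R ((ψ s).2 i)) s := by
        simp only [circlePoint, Prod.smul_fst, Prod.smul_snd, smul_eq_mul]
        fun_prop
      have d3 := ((hf.differentiable (by norm_num) _).hasFDerivAt).comp_hasDerivAt s d2.hasDerivAt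
      rw [h0] at d3
      simpa [Function.comp_def] using d3
    have d4 : HasDerivAt (fun R => coeff f 2 0 * R ^ 2 + R ^ 3 * h (((ψ s).1, (ψ s).2 i), R))
        (s * (2 * coeff f 2 0 + 3 * s * h (((ψ s).1, (ψ s).2 i), s) +
          s ^ 2 * fderiv ℝ h (((ψ s).1, (ψ s).2 i), s) (0, 1))) s := by
      have d5 := ((hasDerivAt_pow 2 s).const_mul (coeff f 2 0)).add ((hasDerivAt_pow 3 s).mul
        (hasDerivAt_right hh1 ((ψ s).1, (ψ s).2 i) s))
      refine d5.congr_deriv ?_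
      push_cast
      ring
    simp only [hexp] at d1
    exact mul_ne_zero hs0 (h3 i) (d4.unique d1)
  have hcontact : ∀ i, HasContact 1 f (s ^ 2 • (ψ s).1) s
      (circlePoint (s ^ 2 • (ψ s).1) s ((ψ s).2 i)) := fun i => by
    refine ⟨hs', hregular i, (ψ s).2 i, rfl, fun j hj1 hj2 => ?_⟩
    obtain rfl : j = 1 := le_antisymm hj2 hj1
    rw [iteratedDeriv_one, (hd1 _).deriv, e3 i, mul_zero]
  refine ⟨⟨fun i j hij => ?_, fun i => ⟨?_, hcontact i⟩⟩, fun i => ⟨hcontact i, fun hcon => ?_⟩⟩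
  · by_contra hne'
    simp only [circlePoint, Prod.mk.injEq, add_right_inj, mul_right_inj' hs0] at hij
    rcases h5 i j hne' with h6 | h6
    · exact h6 hij.1
    · exact h6 hij.2
  · rw [hexp, hvals]
  · have h6 := hcon.hasZero rfl 2 (by norm_num)
    rw [iteratedDeriv_succ, iteratedDeriv_one] at h6
    have h7 : deriv (fun φ => f (circlePoint (s ^ 2 • (ψ s).1) s φ) -
        f (circlePoint (s ^ 2 • (ψ s).1) s ((ψ s).2 i))) =
        fun φ => s ^ 3 * angleDeriv h (((ψ s).1, φ), s) := by
      ext φ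
      exact ((hd1 φ).sub_const _).deriv
    have h8 : ContDiff ℝ 1 (angleDeriv h) := by exact_mod_cast contDiff_angleDeriv hh2
    rw [h7, ((hasDerivAt_angle h8 (ψ s).1 ((ψ s).2 i) s).const_mul (s ^ 3)).deriv] at h6
    exact mul_ne_zero (pow_ne_zero 3 hs0) (h4 i) h6

end UmbilicCurves

end Isophote

end

theorem proposition2 :
    -- hyperbolic points, generic in the sense of a proper algebraic exceptional set of 4-jets
    (∃ P : MvPolynomial Isophote.JetIndex ℝ, P ≠ 0 ∧
      ∀ f : ℝ × ℝ → ℝ, Isophote.IsMonge f → Isophote.IsHyperbolic f →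
        MvPolynomial.eval (Isophote.jet f) P ≠ 0 →
        ∃ U ∈ 𝓝 (0 : ℝ × ℝ), ∀ k : ℝ,
          Isophote.tripleCrossings f k U = ∅ ∧ Isophote.cusps f k U = ∅) ∧
    -- umbilics with `b₀ = b₂` and `b₁ ≠ b₃`
    (∀ f : ℝ × ℝ → ℝ, Isophote.IsMonge f → Isophote.IsUmbilic f →
      Isophote.coeff f 3 0 = Isophote.coeff f 1 2 →
      Isophote.coeff f 2 1 ≠ Isophote.coeff f 0 3 →
      -- distinct limiting directions of contact points form one of the two special triples
      (∀ (ι : Type) (l : Filter ι) [l.NeBot] (p : Fin 3 → ι → ℝ × ℝ)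
        (t : Fin 3 → Real.Angle),
        (∀ᶠ s in l, ∃ (k : ℝ) (z : ℝ × ℝ) (R : ℝ),
          Isophote.IsTritangent f k z R (fun i => p i s)) →
        (∀ i, Isophote.TendsToOriginAlong l (p i) (t i)) →
        Function.Injective t → Isophote.IsSpecialTriple t) ∧
      -- both special triples are realised by curves of contact points
      (∀ t : Fin 3 → Real.Angle, Isophote.IsSpecialTriple t →
        ∃ (ε : ℝ) (p : Fin 3 → ℝ → ℝ × ℝ), 0 < ε ∧
          (∀ i, ContinuousOn (p i) (Set.Ioo 0 ε)) ∧
          (∀ s ∈ Set.Ioo 0 ε, ∃ (k : ℝ) (z : ℝ × ℝ) (R : ℝ),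
            Isophote.IsTritangent f k z R (fun i => p i s) ∧
            ∀ i, Isophote.HasOrdinaryTangency f z R (p i s)) ∧
          (∀ i, Isophote.TendsToOriginAlong (𝓝[>] (0 : ℝ)) (p i) (t i)))) := by
  refine ⟨Isophote.hyperbolic_part, ?_⟩
  rintro f ⟨hf, h00, h10, h01⟩ ⟨hu, h11, hc⟩ hb hb'
  obtain ⟨g, hg, hfg⟩ := Isophote.exists_global_extension hf 10
  have hcoef := fun i j => Isophote.coeff_congr hfg i j
  simp only [hcoef] at h00 h10 h01 hu h11 hc hb hb'
  have hloc : ∀ᶠ p in 𝓝 (0 : ℝ × ℝ), f =ᶠ[𝓝 p] g := eventually_eventually_nhds.2 hfg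
  refine ⟨fun ι l _ p t htri hp ht => ?_, fun t ht => ?_⟩
  · have hle : ((Ultrafilter.of l : Ultrafilter ι) : Filter ι) ≤ l := Ultrafilter.of_le l
    refine Isophote.isSpecialTriple_of_tritangent hg h00 h10 h01 hu h11 hc hb hb'
      (Ultrafilter.of l) (p := p) ?_ (fun i => ⟨(hp i).1.mono_left hle, (hp i).2.1.mono_left hle,
        (hp i).2.2.mono_left hle⟩) ht
    refine Filter.Eventually.filter_mono hle ?_
    filter_upwards [htri, eventually_all.2 fun i => (hp i).1.eventually hloc] with
      s ⟨k, z, R, hinj, hs⟩ h1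
    exact ⟨k, z, R, hinj, fun i => ⟨by rw [← (h1 i).eq_of_nhds]; exact (hs i).1,
      (hs i).2.congr (h1 i)⟩⟩
  · obtain ⟨p, hev, hp⟩ := Isophote.exists_tritangent_curves hg h00 h10 h01 hu h11 hc hb hb' ht
    obtain ⟨ε, hε, hsub⟩ := mem_nhdsGT_iff_exists_Ioo_subset.1
      (hev.and (eventually_all.2 fun i => (hp i).1.eventually hloc))
    refine ⟨ε, p, hε, fun i s hs => ((hsub hs).1.1 i).continuousWithinAt, fun s hs => ?_, hp⟩
    obtain ⟨⟨-, k, z, R, ⟨hinj, htan⟩, hord⟩, h1⟩ := hsub hs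
    refine ⟨k, z, R, ⟨hinj, fun i => ⟨by rw [(h1 i).eq_of_nhds]; exact (htan i).1,
      (htan i).2.congr (h1 i).symm⟩⟩, fun i => ⟨(hord i).1.congr (h1 i).symm,
      fun h => (hord i).2 (h.congr (h1 i))⟩⟩
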